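/- Consider three bodies in the plane $\mathbb R^2$ with masses $m_1,m_2,m_3>0$ and charges $e_1,e_2,e_3\in\mathbb R$. Put $\delta_{ij}=\frac{m_im_j-e_ie_j}{m_im_j}$, $U(q)=\sum_{i<j}\frac{m_im_j\delta_{ij}}{|q_i-q_j|}$ and $P=\{(1,2),(2,3),(3,1)\}$. Assume that $\delta_{12},\delta_{23},\delta_{31}>0$ and that $\delta_{ij}^{1/3}+\delta_{jk}^{1/3}>\delta_{ki}^{1/3}$ for every cyclic permutation $(i,j,k)$ of $(1,2,3)$. Let $\tau>0$ and $k=(k_{12},k_{23},k_{31})=(1,1,1)$ or $(-1,-1,-1)$. Let $\Omega_{\tau,k}$ be the set of $C^\infty$ $\tau$-periodic loops $q=(q_1,q_2,q_3)$ in $(\mathbb R^2)^3$ with $\sum_i m_iq_i=0$, with $q_i(t)\neq q_j(t)$ for all $t$ and $i\ne j$, and such that $q_i-q_j$ has winding number $k_{ij}$ around the origin for each $(i,j)\in P$. Let $X_{\tau,k}$ be its $W^{1,2}$ completion, i.e. its closure in $W^{1,2}(\mathbb R/\tau\mathbb Z,(\mathbb R^2)^3)$. For $q\in X_{\tau,k}$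 let $$f(q)=\int_0^\tau\Big(\tfrac12\sum_{i=1}^3m_i|\dot q_i(t)|^2+U(q(t))\Big)\,dt\in[0,\infty],$$ where $U=\infty$ at collisions. A configuration $a=(a_1,a_2,a_3)$ of pairwise distinct points is called central if $\lambda m_ia_i+\frac{\partial U}{\partial q_i}(a)=0$ for $i=1,2,3$ with some $\lambda\in\mathbb R$. An elliptic triangle solution is a solution $q$ of $m_i\ddot q_i=\frac{\partial U}{\partial q_i}(q)$ of the form $q_i(t)=r(t)R(\theta(t))a_i$, where $R(\theta)$ is the rotation by $\theta$, $a$ is a non-collinear central configuration with $\sum_i m_i|a_i|^2=1$, and $z=r(\cos\theta,\sin\theta)$, $r>0$, is a solution of the Kepler problem $\ddot z=-\mu z/|z|^3$ with $\mu=U(a)$ on an ellipse of eccentricity in $[0,1)$ (negative energy, nonzero angular momentum). Then: (i) $$\inf_{q\in X_{\tau,k}}f(q)=(m_1+m_2+m_3)^{-1/3}\Big(\sum_{(i,j)\in P}m_im_j\delta_{ij}^{2/3}\Big)\,3\,(2^{-1/3})\,\pi^{2/3}\,\tau^{1/3};$$ in particular the first factor is $1$ if the masses are normalized by $m_1+m_2+m_3=1$.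 (ii) There are elliptic triangle solutions in $X_{\tau,k}$, and every $\tau$-periodic elliptic triangle solution $q$ such that $q_i-q_j$ has winding number $k_{ij}$ for all $(i,j)\in P$ belongs to $X_{\tau,k}$ and attains the minimum of $f$ on $X_{\tau,k}$. (iii) Every $C^2$ minimizer of $f$ on $X_{\tau,k}$ is an elliptic triangle solution. -/

import Mathlib

open MeasureTheory
open scoped ENNReal ContDiff

noncomputable section

namespace ChargedThreeBody

/-! The plane `ℝ²` is identified with `ℂ` (with its Euclidean norm), so that the rotation matrix
`R(θ)` acts as multiplication by `exp (θ * I)`.  The three bodies are indexed by `Fin 3`; the pairs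
`(1,2), (2,3), (3,1)` are the pairs `(i, i + 1)` with `i : Fin 3`, where the addition is modulo 3,
and every unordered pair of bodies occurs exactly once among them. -/

/-- `δ_ij = (m_i m_j - e_i e_j) / (m_i m_j)`, for masses `m` and charges `e`. -/
def delta (m e : Fin 3 → ℝ) (i j : Fin 3) : ℝ :=
  (m i * m j - e i * e j) / (m i * m j)

/-- The force function `U(a) = ∑_{i<j} m_i m_j δ_ij / |a_i - a_j|` of a configuration. -/
def forceFunction (m e : Fin 3 → ℝ) (a : Fin 3 → ℂ) : ℝ :=
  ∑ i : Fin 3, m i * m (i + 1) * delta m e i (i + 1) / ‖a i - a (i + 1)‖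

/-- The partial gradient
`∂U/∂q_i (a) = ∑_{j ≠ i} m_i m_j δ_ij (a_j - a_i) / |a_i - a_j|³`, the force on body `i`. -/
def force (m e : Fin 3 → ℝ) (a : Fin 3 → ℂ) (i : Fin 3) : ℂ :=
  ∑ j ∈ Finset.univ.erase i,
    (m i * m j * delta m e i j / ‖a i - a j‖ ^ 3 : ℝ) • (a j - a i)

/-- `a` is a central configuration: `a_i ≠ a_j` for `i ≠ j`, and `λ M a + ∂U/∂q (a) = 0` for some
real `λ`. -/
def IsCentralConfiguration (m e : Fin 3 → ℝ) (a : Fin 3 → ℂ) : Prop :=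
  (∀ i j, i ≠ j → a i ≠ a j) ∧
    ∃ l : ℝ, ∀ i, (l * m i) • a i + force m e a i = 0

/-- `q` is a collision-free solution of the charged three-body problem `m_i q_i'' = ∂U/∂q_i (q)`. -/
def IsSolution (m e : Fin 3 → ℝ) (q : Fin 3 → ℝ → ℂ) : Prop :=
  (∀ t i j, i ≠ j → q i t ≠ q j t) ∧
    ∃ v : Fin 3 → ℝ → ℂ, ∀ i t,
      HasDerivAt (q i) (v i t) t ∧
        HasDerivAt (fun s => m i • v i s) (force m e (fun j => q j t) i) t

/-- `z` is a solution of the planar Kepler problem `z'' = -μ z / |z|³` (Hamiltonian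
`|Z|² / 2 - μ / |z|`) on an ellipse of eccentricity in `[0, 1)`: it has negative energy and nonzero
angular momentum. -/
def IsEllipticKeplerOrbit (μ : ℝ) (z : ℝ → ℂ) : Prop :=
  (∀ t, z t ≠ 0) ∧
    ∃ w : ℝ → ℂ, ∀ t,
      HasDerivAt z (w t) t ∧
        HasDerivAt w ((-μ / ‖z t‖ ^ 3 : ℝ) • z t) t ∧
        ‖w t‖ ^ 2 / 2 - μ / ‖z t‖ < 0 ∧
        (z t).re * (w t).im - (z t).im * (w t).re ≠ 0

/-- An elliptic triangle solution of the charged three-body problem: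
`q_i(t) = r(t) R(θ(t)) a_i`, where `a` is a non-collinear central configuration with
`∑ m_i |a_i|² = 1` and `z = r exp(iθ)` is an elliptic Kepler orbit for `μ = U(a)`. -/
def IsEllipticTriangleSolution (m e : Fin 3 → ℝ) (q : Fin 3 → ℝ → ℂ) : Prop :=
  IsSolution m e q ∧
    ∃ (a : Fin 3 → ℂ) (r θ : ℝ → ℝ),
      IsCentralConfiguration m e a ∧
      ¬ Collinear ℝ (Set.range a) ∧
      ∑ i, m i * ‖a i‖ ^ 2 = 1 ∧
      (∀ t, 0 < r t) ∧
      IsEllipticKeplerOrbit (forceFunction m e a)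
        (fun t => r t * Complex.exp (θ t * Complex.I)) ∧
      ∀ i t, q i t = r t * Complex.exp (θ t * Complex.I) * a i

/-- The closed curve `u : [0, τ] → ℂ ∖ {0}` has index (winding number) `n` around the origin: a
continuous determination of its argument increases by `2 π n` over one period. -/
def HasIndex (τ : ℝ) (u : ℝ → ℂ) (n : ℤ) : Prop :=
  (∀ t, u t ≠ 0) ∧
    ∃ φ : ℝ → ℝ, Continuous φ ∧ (∀ t, u t = ‖u t‖ * Complex.exp (φ t * Complex.I)) ∧
      φ τ - φ 0 = 2 * Real.pi * n

/-- `Ω_{τ,k}`: smooth `τ`-periodic collision-free loops with center of mass at the origin such that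
the index of `q_i - q_{i+1}` is `k i`; so `k = ![k₁₂, k₂₃, k₃₁]`. -/
def smoothLoops (m : Fin 3 → ℝ) (τ : ℝ) (k : Fin 3 → ℤ) : Set (Fin 3 → ℝ → ℂ) :=
  {q | (∀ i, ContDiff ℝ ∞ (q i)) ∧ (∀ i, Function.Periodic (q i) τ) ∧
    (∀ t, ∑ i, m i • q i t = 0) ∧ (∀ t i j, i ≠ j → q i t ≠ q j t) ∧
    ∀ i, HasIndex τ (fun t => q i t - q (i + 1) t) (k i)}

/-- The Sobolev space `W^{1,2}(ℝ/τℤ, (ℝ²)³)`, each class being given by its continuous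
representative: absolutely continuous `τ`-periodic functions with square integrable derivative. -/
def sobolevLoops (τ : ℝ) : Set (Fin 3 → ℝ → ℂ) :=
  {q | ∀ i, Function.Periodic (q i) τ ∧ AbsolutelyContinuousOnInterval (q i) 0 τ ∧
    MemLp (deriv (q i)) 2 (volume.restrict (Set.Ioc 0 τ))}

/-- The square of the `W^{1,2}` distance of two loops. -/
def sobolevDistSq (τ : ℝ) (q p : Fin 3 → ℝ → ℂ) : ℝ≥0∞ :=
  ∑ i, ∫⁻ t in Set.Ioc 0 τ, (‖q i t - p i t‖ₑ ^ 2 + ‖deriv (q i) t - deriv (p i) t‖ₑ ^ 2)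

/-- `X_{τ,k}`: the completion of `Ω_{τ,k}` for the `W^{1,2}` distance, that is, its closure in the
complete space `W^{1,2}(ℝ/τℤ, (ℝ²)³)`.  It contains loops with collisions. -/
def loopSpace (m : Fin 3 → ℝ) (τ : ℝ) (k : Fin 3 → ℤ) : Set (Fin 3 → ℝ → ℂ) :=
  {q | q ∈ sobolevLoops τ ∧ ∀ ε > 0, ∃ p ∈ smoothLoops m τ k, sobolevDistSq τ q p < ε}

/-- The action `f(q) = ∫_0^τ (½ ∑ m_i |q_i'|² + U(q)) dt`, for positive `m_i` and `δ_ij`.  It takes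
values in `[0, ∞]`: `U = ∞` at collisions, and `f(q) = ∞` if `U(q)` is not integrable. -/
def action (m e : Fin 3 → ℝ) (τ : ℝ) (q : Fin 3 → ℝ → ℂ) : ℝ≥0∞ :=
  ∫⁻ t in Set.Ioc 0 τ,
    (ENNReal.ofReal (1 / 2 * ∑ i, m i * ‖deriv (q i) t‖ ^ 2) +
      ∑ i : Fin 3, ENNReal.ofReal (m i * m (i + 1) * delta m e i (i + 1)) /
        ‖q i t - q (i + 1) t‖ₑ)

end ChargedThreeBody

end

namespace ChargedThreeBody

/-! ### A weighted Wirtinger inequality -/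

section Wirtinger

variable {ρ u u' : ℝ → ℝ}

/-! Write M for the total mass and x_i = q_i - q_{i+1}. Since the centre of mass is at the origin,
Lagrange's identity (`sum_mul_norm_sq_eq`) turns the kinetic energy into a sum over pairs. The
action becomes the sum of m_i m_{i+1} / M times the Kepler action of x_i with constant M δ_{i,i+1}
(`action_eq_sum_pairAction`). The x_i are tied only by x_0 + x_1 + x_2 = 0. The lower bound ignores
this tie and treats each pair alone.

For one pair the bound is Gordon's theorem. A loop x of odd index ±1 has an antiperiodic square root
w. With S = ∫ 1/|x|, a Wirtinger inequality with weight |w|² bounds the kinetic part below by 2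
(π/S)² τ, while the potential part is μ S; minimizing over S gives `gordonBound`. Collision-free
elements of the closure inherit the bound by approximation (`gordonBound_le_pairAction_of_approx`).
Loops with collisions satisfy it by a one-dimensional calibration of |x|
(`gordonBound_le_pairAction_of_collision`).

Elliptic Kepler orbits of index ±1 attain the bound (`integral_eq_gordonBound_of_kepler`). The sides
of a non-collinear central configuration are proportional to δ^{1/3} (`sides_of_central`), which is
exactly what makes each side of a homographic motion a Kepler orbit with its own constant M δ. Hence
all three bounds are attained at once. The strict triangle inequalities provide such a triangle, and
rotating it uniformly gives a solution with the required indices.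

Conversely, a C² minimizer attains all three bounds. It has no collision, because ∫ 1/|x| diverges
at a zero of a Lipschitz function. The equality case of Wirtinger's inequality then yields the
Kepler equation for each x_i. Divided by δ^{1/3}, the three orbits obey one common equation and a
linear relation. Differentiating the relation twice forces equal lengths wherever the orbits are not
parallel, so the orbits are rotations of each other by constant angles
(`exists_rotation_of_kepler`). -/

lemma sq_mul_le_of_forall_lt {c A B : ℝ} (hc : 0 < c) (h : ∀ ν, 0 < ν → ν < c → ν ^ 2 * A ≤ B) :
    c ^ 2 * A ≤ B := by
  have ht : Filter.Tendsto (fun ν : ℝ => ν ^ 2 * A) (nhdsWithin c (Set.Iio c)) (nhds (c ^ 2 * A)) :=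
    ((continuous_id.pow 2).mul continuous_const).continuousAt.tendsto.mono_left nhdsWithin_le_nhds
  refine le_of_tendsto ht ?_
  filter_upwards [Ioo_mem_nhdsLT hc] with ν hν using h ν hν.1 hν.2

lemma integral_one_div_pos (hρ : Continuous ρ) (hpos : ∀ t, 0 < ρ t) {a b : ℝ} (hab : a < b) :
    0 < ∫ x in a..b, 1 / ρ x :=
  intervalIntegral.intervalIntegral_pos_of_pos
    ((continuous_const.div hρ fun t => (hpos t).ne').intervalIntegrable _ _)
    (fun t => one_div_pos.2 (hpos t)) hab

/-- In the time s with ds = dt/ρ this is the classical inequality on an interval of length S with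
Dirichlet ends. The proof is a calibration by a tangent, which needs no change of variables. -/
theorem weighted_wirtinger_of_zero_boundary (hρ : Continuous ρ) (hpos : ∀ t, 0 < ρ t)
    (hu : ∀ t, HasDerivAt u (u' t) t) (hu' : Continuous u') {a b : ℝ} (hab : a < b)
    (ha : u a = 0) (hb : u b = 0) :
    (Real.pi / ∫ x in a..b, 1 / ρ x) ^ 2 * (∫ x in a..b, u x ^ 2 / ρ x) ≤
      ∫ x in a..b, ρ x * u' x ^ 2 := by
  have hSpos := integral_one_div_pos hρ hpos hab
  set S := ∫ x in a..b, 1 / ρ x with hS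
  have huc : Continuous u := continuous_iff_continuousAt.2 fun t => (hu t).continuousAt
  have hinv : Continuous fun x => 1 / ρ x := continuous_const.div hρ fun t => (hpos t).ne'
  have hc1 : Continuous fun x => u x ^ 2 / ρ x := (huc.pow 2).div hρ fun t => (hpos t).ne'
  have hc2 : Continuous fun x => ρ x * u' x ^ 2 := hρ.mul (hu'.pow 2)
  -- Taking ν strictly below π/S keeps the phase ν (s - S/2) inside (-π/2, π/2) on the closed
  -- interval, so the tangent stays finite at the ends.
  refine sq_mul_le_of_forall_lt (by positivity) fun ν hν0 hν => ?_
  set s : ℝ → ℝ := fun t => ∫ x in a..t, 1 / ρ x with hs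
  have hsd : ∀ t, HasDerivAt s (1 / ρ t) t := fun t =>
    intervalIntegral.integral_hasDerivAt_right (hinv.intervalIntegrable _ _)
      hinv.aestronglyMeasurable.stronglyMeasurableAtFilter hinv.continuousAt
  have hsm : Monotone s := monotone_of_deriv_nonneg (fun t => (hsd t).differentiableAt)
    fun t => by rw [(hsd t).deriv]; exact (one_div_pos.2 (hpos t)).le
  have hsa : s a = 0 := by simp [hs]
  have hνS : ν * S < Real.pi := (lt_div_iff₀ hSpos).1 hν
  have hcos : ∀ t ∈ Set.Icc a b, Real.cos (ν * (s t - S / 2)) ≠ 0 := by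
    intro t ht
    have h1 : 0 ≤ s t := hsa ▸ hsm ht.1
    have h2 : s t ≤ S := hsm ht.2
    refine (Real.cos_pos_of_mem_Ioo ⟨?_, ?_⟩).ne' <;> nlinarith
  -- The tangent solves the Riccati equation that completes the square: the derivative of H is ρ
  -- times a square. The added term vanishes at both ends because u does.
  set H : ℝ → ℝ := fun t => (∫ x in a..t, (ρ x * u' x ^ 2 - ν ^ 2 * (u x ^ 2 / ρ x))) +
    ν * Real.tan (ν * (s t - S / 2)) * u t ^ 2 with hH
  have hHd : ∀ t ∈ Set.Icc a b, HasDerivAt H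
      (ρ t * (u' t + ν * Real.tan (ν * (s t - S / 2)) * u t / ρ t) ^ 2) t := by
    intro t ht
    have hcc : Continuous fun x => ρ x * u' x ^ 2 - ν ^ 2 * (u x ^ 2 / ρ x) :=
      hc2.sub (continuous_const.mul hc1)
    have h1 := intervalIntegral.integral_hasDerivAt_right (hcc.intervalIntegrable a t)
      hcc.aestronglyMeasurable.stronglyMeasurableAtFilter hcc.continuousAt
    have h2 := (((Real.hasDerivAt_tan (hcos t ht)).comp t
      (((hsd t).sub_const (S / 2)).const_mul ν)).const_mul ν).mul ((hu t).pow 2)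
    refine (h1.add h2).congr_deriv ?_
    have hρt := (hpos t).ne'
    have hct := hcos t ht
    have hT : 1 / Real.cos (ν * (s t - S / 2)) ^ 2 = 1 + Real.tan (ν * (s t - S / 2)) ^ 2 := by
      rw [Real.tan_eq_sin_div_cos, div_pow, one_add_div (pow_ne_zero 2 hct), Real.cos_sq_add_sin_sq]
    simp only [Function.comp_apply, Pi.pow_apply]
    rw [hT]
    field_simp
    push_cast
    ring
  have hmono : MonotoneOn H (Set.Icc a b) := by
    refine monotoneOn_of_deriv_nonneg (convex_Icc a b)
      (fun t ht => (hHd t ht).continuousAt.continuousWithinAt)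
      (fun t ht => (hHd t (interior_subset ht)).differentiableAt.differentiableWithinAt) ?_
    intro t ht
    rw [(hHd t (interior_subset ht)).deriv]
    exact mul_nonneg (hpos t).le (sq_nonneg _)
  have := hmono (Set.left_mem_Icc.2 hab.le) (Set.right_mem_Icc.2 hab.le) hab.le
  simp only [hH, intervalIntegral.integral_same, ha, hb] at this
  rw [intervalIntegral.integral_sub (hc2.intervalIntegrable _ _)
    ((hc1.const_mul (ν ^ 2)).intervalIntegrable _ _), intervalIntegral.integral_const_mul] at this
  linarith

lemma exists_zero_of_antiperiodic {τ : ℝ} (hu : Continuous u) (ha : Function.Antiperiodic u τ) :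
    ∃ t, u t = 0 := by
  have h := ha 0
  rw [zero_add] at h
  have := intermediate_value_uIcc (a := 0) (b := τ) hu.continuousOn
  have h0 : (0 : ℝ) ∈ Set.uIcc (u 0) (u τ) := by
    rw [h, Set.mem_uIcc]
    rcases le_total (u 0) 0 with h | h
    · exact Or.inl ⟨h, by linarith⟩
    · exact Or.inr ⟨by linarith, h⟩
  obtain ⟨t, -, ht⟩ := this h0
  exact ⟨t, ht⟩

lemma antiperiodic_deriv {E : Type*} [NormedAddCommGroup E] [NormedSpace ℝ E] {f f' : ℝ → E} {τ : ℝ}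
    (hf : ∀ t, HasDerivAt f (f' t) t) (ha : Function.Antiperiodic f τ) :
    Function.Antiperiodic f' τ := by
  intro t
  have h1 : HasDerivAt (fun s => f (s + τ)) (f' (t + τ)) t := (hf (t + τ)).comp_add_const t τ
  have h2 : (fun s => f (s + τ)) = fun s => -f s := funext ha
  rw [h2] at h1
  exact h1.unique (hf t).neg

lemma periodic_deriv {E : Type*} [NormedAddCommGroup E] [NormedSpace ℝ E] {f f' : ℝ → E} {τ : ℝ}
    (hf : ∀ t, HasDerivAt f (f' t) t) (ha : Function.Periodic f τ) : Function.Periodic f' τ := by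
  intro t
  have h1 : HasDerivAt (fun s => f (s + τ)) (f' (t + τ)) t := (hf (t + τ)).comp_add_const t τ
  rw [show (fun s => f (s + τ)) = f from funext ha] at h1
  exact h1.unique (hf t)

/-- An antiperiodic function has a zero, and the three integrands are periodic, so the period can be
cut at that zero. -/
theorem weighted_wirtinger_of_antiperiodic {τ : ℝ} (hτ : 0 < τ) (hρ : Continuous ρ)
    (hpos : ∀ t, 0 < ρ t) (hper : Function.Periodic ρ τ) (hu : ∀ t, HasDerivAt u (u' t) t)
    (hu' : Continuous u') (ha : Function.Antiperiodic u τ) :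
    (Real.pi / ∫ x in (0 : ℝ)..τ, 1 / ρ x) ^ 2 * (∫ x in (0 : ℝ)..τ, u x ^ 2 / ρ x) ≤
      ∫ x in (0 : ℝ)..τ, ρ x * u' x ^ 2 := by
  have huc : Continuous u := continuous_iff_continuousAt.2 fun t => (hu t).continuousAt
  obtain ⟨t₀, h0⟩ := exists_zero_of_antiperiodic huc ha
  have ha' := antiperiodic_deriv hu ha
  have h1 := weighted_wirtinger_of_zero_boundary hρ hpos hu hu'
    (show t₀ < t₀ + τ by linarith) h0 (by rw [ha, h0, neg_zero])
  have p1 : Function.Periodic (fun x => 1 / ρ x) τ := fun t => by simp only [hper t]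
  have p2 : Function.Periodic (fun x => u x ^ 2 / ρ x) τ := fun t => by
    simp only [hper t, ha t, neg_sq]
  have p3 : Function.Periodic (fun x => ρ x * u' x ^ 2) τ := fun t => by
    simp only [hper t, ha' t, neg_sq]
  have e1 := p1.intervalIntegral_add_eq t₀ 0
  have e2 := p2.intervalIntegral_add_eq t₀ 0
  have e3 := p3.intervalIntegral_add_eq t₀ 0
  rw [zero_add] at e1 e2 e3
  rwa [e1, e2, e3] at h1

/-- A nonnegative quadratic polynomial vanishing at the origin has no linear term. -/
lemma eq_zero_of_forall_quadratic_nonneg {B C : ℝ} (h : ∀ ε : ℝ, 0 ≤ 2 * ε * B + ε ^ 2 * C) :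
    B = 0 := by
  have hC : 0 ≤ C ∨ C < 0 := le_or_gt 0 C
  by_contra hB
  -- Near the minimizer of the quadratic; `|C| + 1` avoids dividing by zero and makes the value
  -- negative when B ≠ 0.
  have h1 := h (-B / (|C| + 1))
  have hp : 0 < |C| + 1 := by positivity
  have hB2 : 0 < B ^ 2 := by positivity
  have e : 2 * (-B / (|C| + 1)) * B + (-B / (|C| + 1)) ^ 2 * C =
      B ^ 2 * (C - 2 * (|C| + 1)) / (|C| + 1) ^ 2 := by
    field_simp; ring
  rw [e] at h1
  have : B ^ 2 * (C - 2 * (|C| + 1)) < 0 :=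
    mul_neg_of_pos_of_neg hB2 (by linarith [le_abs_self C, abs_nonneg C])
  have := div_neg_of_neg_of_pos this (pow_pos hp 2)
  linarith

/-- The Euler-Lagrange equation for equality in the weighted Wirtinger inequality. -/
theorem hasDerivAt_of_weighted_wirtinger_eq {τ : ℝ} (hτ : 0 < τ) (hρ : Continuous ρ)
    (hpos : ∀ t, 0 < ρ t) (hper : Function.Periodic ρ τ) (hu : ∀ t, HasDerivAt u (u' t) t)
    (hu' : Continuous u') (ha : Function.Antiperiodic u τ)
    (heq : ∫ x in (0 : ℝ)..τ, ρ x * u' x ^ 2 =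
      (Real.pi / ∫ x in (0 : ℝ)..τ, 1 / ρ x) ^ 2 * (∫ x in (0 : ℝ)..τ, u x ^ 2 / ρ x)) (t : ℝ) :
    HasDerivAt (fun s => ρ s * u' s)
      (-(Real.pi / ∫ x in (0 : ℝ)..τ, 1 / ρ x) ^ 2 * u t / ρ t) t := by
  set ν := Real.pi / ∫ x in (0 : ℝ)..τ, 1 / ρ x with hν
  have huc : Continuous u := continuous_iff_continuousAt.2 fun t => (hu t).continuousAt
  have ha' := antiperiodic_deriv hu ha
  have hρne : ∀ t, ρ t ≠ 0 := fun t => (hpos t).ne'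
  have hkc : Continuous fun x => ν ^ 2 * u x / ρ x := (continuous_const.mul huc).div hρ hρne
  -- This constant makes the primitive K satisfy K(τ) = -K(0), hence antiperiodic. The constant d
  -- below does the same for η.
  set c := -(1 / 2) * ∫ x in (0 : ℝ)..τ, ν ^ 2 * u x / ρ x with hc
  set K : ℝ → ℝ := fun t => c + ∫ x in (0 : ℝ)..t, ν ^ 2 * u x / ρ x with hK
  have hKd : ∀ t, HasDerivAt K (ν ^ 2 * u t / ρ t) t := fun t =>
    (intervalIntegral.integral_hasDerivAt_right (hkc.intervalIntegrable _ _)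
      hkc.aestronglyMeasurable.stronglyMeasurableAtFilter hkc.continuousAt).const_add c
  have anti_of : ∀ g g' : ℝ → ℝ, (∀ t, HasDerivAt g (g' t) t) → Function.Antiperiodic g' τ →
      g τ = - g 0 → Function.Antiperiodic g τ := by
    intro g g' hg hg' h0 t
    have hd : ∀ s, HasDerivAt (fun s => g (s + τ) + g s) 0 s := fun s => by
      refine (((hg (s + τ)).comp_add_const s τ).add (hg s)).congr_deriv ?_
      rw [hg' s]; ring
    have := is_const_of_deriv_eq_zero (fun s => (hd s).differentiableAt) (fun s => (hd s).deriv) t 0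
    simp only [zero_add, h0] at this
    linarith
  have hKa : Function.Antiperiodic K τ := by
    refine anti_of K _ hKd (fun t => ?_) ?_
    · simp only [ha t, hper t]; ring
    · simp only [hK, intervalIntegral.integral_same, hc]; ring
  have hKc : Continuous K := continuous_iff_continuousAt.2 fun t => (hKd t).continuousAt
  -- The equation to be proved says that G is constant, and an antiperiodic constant is 0. As in du
  -- Bois-Reymond's lemma, the primitive η of G is itself the test function, so only u' continuous
  -- is needed.
  set G : ℝ → ℝ := fun t => ρ t * u' t + K t with hG
  have hGc : Continuous G := (hρ.mul hu').add hKc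
  have hGa : Function.Antiperiodic G τ := fun t => by
    simp only [hG, hper t, ha' t, hKa t]; ring
  set d := -(1 / 2) * ∫ x in (0 : ℝ)..τ, G x with hd
  set η : ℝ → ℝ := fun t => d + ∫ x in (0 : ℝ)..t, G x with hη
  have hηd : ∀ t, HasDerivAt η (G t) t := fun t =>
    (intervalIntegral.integral_hasDerivAt_right (hGc.intervalIntegrable _ _)
      hGc.aestronglyMeasurable.stronglyMeasurableAtFilter hGc.continuousAt).const_add d
  have hηa : Function.Antiperiodic η τ := by
    refine anti_of η _ hηd hGa ?_
    simp only [hη, intervalIntegral.integral_same, hd]; ring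
  have hηc : Continuous η := continuous_iff_continuousAt.2 fun t => (hηd t).continuousAt
  have ii : ∀ {f : ℝ → ℝ}, Continuous f → IntervalIntegrable f volume 0 τ :=
    fun h => h.intervalIntegrable _ _
  have c1 : Continuous fun x => ρ x * u' x ^ 2 := hρ.mul (hu'.pow 2)
  have c2 : Continuous fun x => ρ x * u' x * G x := (hρ.mul hu').mul hGc
  have c3 : Continuous fun x => ρ x * G x ^ 2 := hρ.mul (hGc.pow 2)
  have c4 : Continuous fun x => u x ^ 2 / ρ x := (huc.pow 2).div hρ hρne
  have c5 : Continuous fun x => u x * η x / ρ x := (huc.mul hηc).div hρ hρne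
  have c6 : Continuous fun x => η x ^ 2 / ρ x := (hηc.pow 2).div hρ hρne
  -- First variation: u + ε η is still antiperiodic, so the inequality holds for every ε, with
  -- equality at ε = 0.
  have hB : (∫ x in (0 : ℝ)..τ, ρ x * u' x * G x) -
      ν ^ 2 * (∫ x in (0 : ℝ)..τ, u x * η x / ρ x) = 0 := by
    refine eq_zero_of_forall_quadratic_nonneg
      (C := (∫ x in (0 : ℝ)..τ, ρ x * G x ^ 2) - ν ^ 2 * ∫ x in (0 : ℝ)..τ, η x ^ 2 / ρ x)
      fun ε => ?_
    have h := weighted_wirtinger_of_antiperiodic hτ hρ hpos hper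
      (u := fun t => u t + ε * η t) (u' := fun t => u' t + ε * G t)
      (fun t => (hu t).add ((hηd t).const_mul ε)) (hu'.add (continuous_const.mul hGc))
      (fun t => by simp only [ha t, hηa t]; ring)
    rw [← hν] at h
    have e1 : ∫ x in (0 : ℝ)..τ, ρ x * (u' x + ε * G x) ^ 2 =
        (∫ x in (0 : ℝ)..τ, ρ x * u' x ^ 2) + 2 * ε * (∫ x in (0 : ℝ)..τ, ρ x * u' x * G x) +
          ε ^ 2 * ∫ x in (0 : ℝ)..τ, ρ x * G x ^ 2 := by
      rw [← intervalIntegral.integral_const_mul, ← intervalIntegral.integral_const_mul,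
        ← intervalIntegral.integral_add (ii c1) (ii (c2.const_mul _)),
        ← intervalIntegral.integral_add (ii (c1.fun_add (c2.const_mul _)))
          (ii (c3.const_mul _))]
      congr 1; ext x; ring
    have e2 : ∫ x in (0 : ℝ)..τ, (u x + ε * η x) ^ 2 / ρ x =
        (∫ x in (0 : ℝ)..τ, u x ^ 2 / ρ x) + 2 * ε * (∫ x in (0 : ℝ)..τ, u x * η x / ρ x) +
          ε ^ 2 * ∫ x in (0 : ℝ)..τ, η x ^ 2 / ρ x := by
      rw [← intervalIntegral.integral_const_mul, ← intervalIntegral.integral_const_mul,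
        ← intervalIntegral.integral_add (ii c4) (ii (c5.const_mul _)),
        ← intervalIntegral.integral_add (ii (c4.fun_add (c5.const_mul _)))
          (ii (c6.const_mul _))]
      congr 1; ext x; ring
    rw [e1, e2, heq] at h
    linarith
  -- The boundary terms cancel because K η is a product of two antiperiodic functions.
  have hparts : ν ^ 2 * (∫ x in (0 : ℝ)..τ, u x * η x / ρ x) = -∫ x in (0 : ℝ)..τ, K x * G x := by
    have h := intervalIntegral.integral_mul_deriv_eq_deriv_mul (a := 0) (b := τ)
      (u := K) (v := η) (fun t _ => hKd t) (fun t _ => hηd t) (ii hkc) (ii hGc)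
    have k0 := hKa 0
    have n0 := hηa 0
    rw [zero_add] at k0 n0
    rw [h, k0, n0, ← intervalIntegral.integral_const_mul]
    have : ∀ x, ν ^ 2 * u x / ρ x * η x = ν ^ 2 * (u x * η x / ρ x) := fun x => by ring
    simp only [this]; ring
  have hGG : ∫ x in (0 : ℝ)..τ, G x ^ 2 = 0 := by
    have : ∀ x, G x ^ 2 = ρ x * u' x * G x + K x * G x := fun x => by simp only [hG]; ring
    simp only [this]
    rw [intervalIntegral.integral_add (ii c2) (ii (hKc.fun_mul hGc))]
    linarith
  have hG0 : ∀ t, G t = 0 := by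
    by_contra! hne
    obtain ⟨t₁, ht₁⟩ := hne
    have hGp : Function.Periodic (fun x => G x ^ 2) τ := fun t => by
      simp only [hGa t, neg_sq]
    have hint := hGp.intervalIntegral_add_eq t₁ 0
    rw [zero_add, hGG] at hint
    have hpos' : 0 < ∫ x in t₁..(t₁ + τ), G x ^ 2 := by
      refine intervalIntegral.integral_pos (by linarith) (hGc.pow 2).continuousOn
        (fun x _ => sq_nonneg _) ⟨t₁, ⟨le_refl _, by linarith⟩, by positivity⟩
    linarith
  have hfin : (fun s => ρ s * u' s) = fun s => -K s := by
    ext s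
    have := hG0 s
    simp only [hG] at this
    linarith
  rw [hfin]
  exact (hKd t).neg.congr_deriv (by ring)

end Wirtinger

end ChargedThreeBody

noncomputable section
namespace ChargedThreeBody

/-! ### Gordon's theorem for loops of class `C¹` -/

/-- The minimal action of the Kepler problem `x'' = - μ x / |x|³` among loops of period `τ` with
index `±1`. -/
def gordonBound (μ τ : ℝ) : ℝ := 3 / 2 * μ * (4 * Real.pi ^ 2 * τ / μ) ^ (1 / 3 : ℝ)

lemma gordonBound_pos {μ τ : ℝ} (hμ : 0 < μ) (hτ : 0 < τ) : 0 < gordonBound μ τ := by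
  unfold gordonBound; positivity

lemma exists_gordonBound_eq {μ τ : ℝ} (hμ : 0 < μ) (hτ : 0 < τ) :
    ∃ S₀, 0 < S₀ ∧ μ * S₀ ^ 3 = 4 * Real.pi ^ 2 * τ ∧ gordonBound μ τ = 3 / 2 * μ * S₀ := by
  have h0 : 0 < 4 * Real.pi ^ 2 * τ / μ := by positivity
  refine ⟨(4 * Real.pi ^ 2 * τ / μ) ^ (1 / 3 : ℝ), Real.rpow_pos_of_pos h0 _, ?_, rfl⟩
  rw [← Real.rpow_natCast, ← Real.rpow_mul h0.le]
  norm_num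
  field_simp

/-- Let T be the critical point, μ T³ = 4 π² τ. The excess over the bound is μ (S - T)² (2 S + T) /
(2 S²), which gives both the inequality and its equality case. -/
lemma gordon_trade_off {μ τ S : ℝ} (hμ : 0 < μ) (hτ : 0 < τ) (hS : 0 < S) :
    gordonBound μ τ ≤ 2 * (Real.pi / S) ^ 2 * τ + μ * S ∧
      (2 * (Real.pi / S) ^ 2 * τ + μ * S = gordonBound μ τ ↔ μ * S ^ 3 = 4 * Real.pi ^ 2 * τ) := by
  obtain ⟨T, hT, h1, h2⟩ := exists_gordonBound_eq hμ hτ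
  have key : 2 * (Real.pi / S) ^ 2 * τ + μ * S - gordonBound μ τ =
      μ * (S - T) ^ 2 * (2 * S + T) / (2 * S ^ 2) := by
    have : 2 * (Real.pi / S) ^ 2 * τ = μ * T ^ 3 / (2 * S ^ 2) := by
      rw [h1]; field_simp; ring
    rw [this, h2]; field_simp; ring
  have hnn : 0 ≤ μ * (S - T) ^ 2 * (2 * S + T) / (2 * S ^ 2) := by positivity
  refine ⟨by linarith, fun h => ?_, fun h => ?_⟩
  · have h0 : μ * (S - T) ^ 2 * (2 * S + T) / (2 * S ^ 2) = 0 := by linarith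
    have : S - T = 0 := by
      by_contra hne
      have : 0 < (S - T) ^ 2 := by positivity
      have : 0 < μ * (S - T) ^ 2 * (2 * S + T) / (2 * S ^ 2) := by positivity
      linarith
    rw [show S = T by linarith, h1]
  · have hST : S = T := by
      have : S ^ 3 = T ^ 3 := mul_left_cancel₀ hμ.ne' (h.trans h1.symm)
      exact (pow_left_inj₀ hS.le hT.le (by norm_num)).1 this
    rw [hST, sub_self] at key
    rw [hST]
    linarith [key, show μ * 0 ^ 2 * (2 * T + T) / (2 * T ^ 2) = 0 by simp]

/-- The difference quotient of w is that of x = w² divided by w(s) + w(t), and this sum tends to 2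
w(t) ≠ 0. -/
lemma hasDerivAt_sqrt_branch {x w : ℝ → ℂ} {v : ℂ} {t : ℝ} (hx : HasDerivAt x v t)
    (hw : ContinuousAt w t) (hsq : ∀ s, w s ^ 2 = x s) (h0 : w t ≠ 0) :
    HasDerivAt w (v / (2 * w t)) t := by
  rw [hasDerivAt_iff_tendsto_slope] at hx ⊢
  have hadd : Filter.Tendsto (fun s => w s + w t) (nhdsWithin t {t}ᶜ) (nhds (2 * w t)) := by
    rw [two_mul]
    exact (hw.tendsto.mono_left nhdsWithin_le_nhds).add_const _
  have h2 : 2 * w t ≠ 0 := mul_ne_zero two_ne_zero h0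
  refine (hx.div hadd h2).congr' ?_
  filter_upwards [hadd.eventually_ne h2] with s hs
  simp only [slope_def_module, Pi.div_apply]
  rw [← hsq s, ← hsq t, sq_sub_sq, div_eq_iff hs, smul_mul_assoc, mul_comm (w s + w t)]

/-- A loop of index `±1` has an antiperiodic continuous square root. -/
theorem exists_antiperiodic_sqrt {τ : ℝ} {x x' : ℝ → ℂ} {n : ℤ} (hn : n = 1 ∨ n = -1)
    (hx : ∀ t, HasDerivAt x (x' t) t) (hx' : Continuous x') (hper : Function.Periodic x τ)
    (hi : HasIndex τ x n) :
    ∃ w w' : ℝ → ℂ, (∀ t, HasDerivAt w (w' t) t) ∧ Continuous w' ∧ Function.Antiperiodic w τ ∧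
      (∀ t, w t ≠ 0) ∧ (∀ t, w t ^ 2 = x t) ∧ ∀ t, x' t = 2 * w t * w' t := by
  obtain ⟨hne, φ, hφ, hpol, hφτ⟩ := hi
  have hxc : Continuous x := continuous_iff_continuousAt.2 fun t => (hx t).continuousAt
  set w : ℝ → ℂ := fun t => (Real.sqrt ‖x t‖ : ℂ) * Complex.exp ((φ t / 2 : ℝ) * Complex.I) with hw
  have hwc : Continuous w := by
    refine (Complex.continuous_ofReal.comp hxc.norm.sqrt).mul (Complex.continuous_exp.comp ?_)
    exact (Complex.continuous_ofReal.comp (hφ.div_const 2)).mul continuous_const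
  have hsq : ∀ t, w t ^ 2 = x t := by
    intro t
    conv_rhs => rw [hpol t]
    simp only [hw, mul_pow, ← Complex.exp_nat_mul, ← Complex.ofReal_pow,
      Real.sq_sqrt (norm_nonneg _)]
    congr 2
    push_cast; ring
  have hw0 : ∀ t, w t ≠ 0 := fun t h => hne t (by rw [← hsq t, h]; simp)
  have hanti : Function.Antiperiodic w τ := by
    -- The two sides are continuous square roots of the same nonvanishing function on a connected
    -- line, so comparison at 0 suffices. There the half angle grows by n π with n odd, which
    -- produces the sign.
    have h1 : Set.EqOn (fun t => w (t + τ)) (fun t => -w t) Set.univ := by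
      refine isPreconnected_univ.eq_of_sq_eq (hwc.comp (continuous_add_const τ)).continuousOn
        hwc.neg.continuousOn (fun t _ => ?_) (fun _ => neg_ne_zero.2 (hw0 _)) (Set.mem_univ 0) ?_
      · simp only [Pi.pow_apply, neg_sq, hsq, hper t]
      · have hx0 : x τ = x 0 := by simpa using hper 0
        have e : ((φ τ / 2 : ℝ) : ℂ) * Complex.I =
            ((φ 0 / 2 : ℝ) : ℂ) * Complex.I + n * (Real.pi * Complex.I) := by
          rw [show φ τ = φ 0 + 2 * Real.pi * n by linarith]; push_cast; ring
        simp only [hw, zero_add, hx0, e, Complex.exp_add]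
        rcases hn with rfl | rfl <;> simp [Complex.exp_neg]
    exact fun t => h1 (Set.mem_univ t)
  refine ⟨w, fun t => x' t / (2 * w t), fun t =>
    hasDerivAt_sqrt_branch (hx t) hwc.continuousAt hsq (hw0 t), ?_, hanti, hw0, hsq, fun t => ?_⟩
  · exact hx'.div (continuous_const.mul hwc) fun t => mul_ne_zero two_ne_zero (hw0 t)
  · have := hw0 t
    field_simp

/-! ### Levi-Civita regularization x = w². -/

section SquareRoot

variable {τ : ℝ} {x x' w w' : ℝ → ℂ}

/-- The Wirtinger inequality with weight |w|² is applied to the real and imaginary parts of w. The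
right-hand integrals add up to τ because |w|²/|w|² = 1. Equality in the sum forces equality in both,
and the two Euler-Lagrange equations combine into the oscillator equation in the time ds = dt/|w|².
-/
lemma sqrt_wirtinger (hτ : 0 < τ) (hw : ∀ t, HasDerivAt w (w' t) t) (hw' : Continuous w')
    (ha : Function.Antiperiodic w τ) (h0 : ∀ t, w t ≠ 0) :
    (0 < ∫ t in (0 : ℝ)..τ, 1 / ‖w t‖ ^ 2) ∧
    (Real.pi / ∫ t in (0 : ℝ)..τ, 1 / ‖w t‖ ^ 2) ^ 2 * τ ≤
      (∫ t in (0 : ℝ)..τ, ‖w t‖ ^ 2 * ‖w' t‖ ^ 2) ∧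
    ((∫ t in (0 : ℝ)..τ, ‖w t‖ ^ 2 * ‖w' t‖ ^ 2) =
      (Real.pi / ∫ t in (0 : ℝ)..τ, 1 / ‖w t‖ ^ 2) ^ 2 * τ →
      ∀ t, HasDerivAt (fun s => ((‖w s‖ ^ 2 : ℝ) : ℂ) * w' s)
        (-(((Real.pi / ∫ t in (0 : ℝ)..τ, 1 / ‖w t‖ ^ 2) ^ 2 / ‖w t‖ ^ 2 : ℝ) : ℂ) * w t) t) := by
  have hwc : Continuous w := continuous_iff_continuousAt.2 fun t => (hw t).continuousAt
  have hρ : Continuous fun t => ‖w t‖ ^ 2 := hwc.norm.pow 2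
  have hpos : ∀ t, 0 < ‖w t‖ ^ 2 := fun t => pow_pos (norm_pos_iff.2 (h0 t)) 2
  have hper : Function.Periodic (fun t => ‖w t‖ ^ 2) τ := fun t => by simp only [ha t, norm_neg]
  have hre : ∀ t, HasDerivAt (fun s => (w s).re) (w' t).re t := fun t =>
    Complex.reCLM.hasFDerivAt.comp_hasDerivAt t (hw t)
  have him : ∀ t, HasDerivAt (fun s => (w s).im) (w' t).im t := fun t =>
    Complex.imCLM.hasFDerivAt.comp_hasDerivAt t (hw t)
  have hre' : Continuous fun t => (w' t).re := Complex.continuous_re.comp hw'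
  have him' : Continuous fun t => (w' t).im := Complex.continuous_im.comp hw'
  have hrec : Continuous fun t => (w t).re := Complex.continuous_re.comp hwc
  have himc : Continuous fun t => (w t).im := Complex.continuous_im.comp hwc
  have har : Function.Antiperiodic (fun t => (w t).re) τ := fun t => by simp [ha t]
  have hai : Function.Antiperiodic (fun t => (w t).im) τ := fun t => by simp [ha t]
  have W1 := weighted_wirtinger_of_antiperiodic hτ hρ hpos hper hre hre' har
  have W2 := weighted_wirtinger_of_antiperiodic hτ hρ hpos hper him him' hai
  have hS := integral_one_div_pos hρ hpos hτ
  have E1 := hasDerivAt_of_weighted_wirtinger_eq hτ hρ hpos hper hre hre' har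
  have E2 := hasDerivAt_of_weighted_wirtinger_eq hτ hρ hpos hper him him' hai
  set ν := Real.pi / ∫ t in (0 : ℝ)..τ, 1 / ‖w t‖ ^ 2 with hν
  have q1 : Continuous fun t => ‖w t‖ ^ 2 * (w' t).re ^ 2 := hρ.mul (hre'.pow 2)
  have q2 : Continuous fun t => ‖w t‖ ^ 2 * (w' t).im ^ 2 := hρ.mul (him'.pow 2)
  have q3 : Continuous fun t => (w t).re ^ 2 / ‖w t‖ ^ 2 :=
    (hrec.pow 2).div hρ fun t => (hpos t).ne'
  have q4 : Continuous fun t => (w t).im ^ 2 / ‖w t‖ ^ 2 :=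
    (himc.pow 2).div hρ fun t => (hpos t).ne'
  have hsum1 : (∫ t in (0 : ℝ)..τ, ‖w t‖ ^ 2 * ‖w' t‖ ^ 2) =
      (∫ t in (0 : ℝ)..τ, ‖w t‖ ^ 2 * (w' t).re ^ 2) +
        ∫ t in (0 : ℝ)..τ, ‖w t‖ ^ 2 * (w' t).im ^ 2 := by
    rw [← intervalIntegral.integral_add (q1.intervalIntegrable _ _)
      (q2.intervalIntegrable _ _)]
    congr 1; ext t
    rw [Complex.sq_norm (w' t), Complex.normSq_apply]; ring
  have hsum2 : τ = (∫ t in (0 : ℝ)..τ, (w t).re ^ 2 / ‖w t‖ ^ 2) +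
      ∫ t in (0 : ℝ)..τ, (w t).im ^ 2 / ‖w t‖ ^ 2 := by
    rw [← intervalIntegral.integral_add
      (q3.intervalIntegrable _ _) (q4.intervalIntegrable _ _)]
    have : ∀ t, ((w t).re ^ 2) / ‖w t‖ ^ 2 + (w t).im ^ 2 / ‖w t‖ ^ 2 = 1 := by
      intro t
      rw [← add_div, div_eq_one_iff_eq (hpos t).ne', Complex.sq_norm, Complex.normSq_apply]; ring
    simp only [this]
    simp
  have hsum3 : ν ^ 2 * τ = ν ^ 2 * (∫ t in (0 : ℝ)..τ, (w t).re ^ 2 / ‖w t‖ ^ 2) +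
      ν ^ 2 * ∫ t in (0 : ℝ)..τ, (w t).im ^ 2 / ‖w t‖ ^ 2 := by
    rw [← mul_add, ← hsum2]
  refine ⟨hS, by rw [hsum1]; linarith, fun heq t => ?_⟩
  · rw [hsum1] at heq
    have d1 := E1 (by linarith) t
    have d2 := E2 (by linarith) t
    have d := d1.ofReal_comp.add (d2.ofReal_comp.mul_const Complex.I)
    have hf : (fun s => ((‖w s‖ ^ 2 : ℝ) : ℂ) * w' s) =
        (fun s => ((‖w s‖ ^ 2 * (w' s).re : ℝ) : ℂ) + ((‖w s‖ ^ 2 * (w' s).im : ℝ) : ℂ) *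
          Complex.I) := by
      ext s
      conv_lhs => rw [← Complex.re_add_im (w' s)]
      push_cast; ring
    rw [hf]
    refine d.congr_deriv ?_
    generalize ‖w t‖ = N
    conv_rhs => rw [← Complex.re_add_im (w t)]
    push_cast; ring

lemma kinetic_eq (hsq : ∀ t, w t ^ 2 = x t) (hx' : ∀ t, x' t = 2 * w t * w' t) (t : ℝ) :
    ‖x t‖ = ‖w t‖ ^ 2 ∧ 1 / 2 * ‖x' t‖ ^ 2 = 2 * (‖w t‖ ^ 2 * ‖w' t‖ ^ 2) := by
  refine ⟨by rw [← hsq t, norm_pow], ?_⟩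
  rw [hx' t, norm_mul, norm_mul, mul_pow, mul_pow]
  simp; ring

lemma integral_action_eq (μ : ℝ) (hw : ∀ t, HasDerivAt w (w' t) t) (hw' : Continuous w')
    (h0 : ∀ t, w t ≠ 0)
    (hsq : ∀ t, w t ^ 2 = x t) (hx' : ∀ t, x' t = 2 * w t * w' t) :
    ∫ t in (0 : ℝ)..τ, (1 / 2 * ‖x' t‖ ^ 2 + μ / ‖x t‖) =
      2 * (∫ t in (0 : ℝ)..τ, ‖w t‖ ^ 2 * ‖w' t‖ ^ 2) + μ * ∫ t in (0 : ℝ)..τ, 1 / ‖w t‖ ^ 2 := by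
  have hwc : Continuous w := continuous_iff_continuousAt.2 fun t => (hw t).continuousAt
  have c1 : Continuous fun t => ‖w t‖ ^ 2 * ‖w' t‖ ^ 2 := (hwc.norm.pow 2).mul (hw'.norm.pow 2)
  have c2 : Continuous fun t => 1 / ‖w t‖ ^ 2 := continuous_const.div (hwc.norm.pow 2) fun t =>
    pow_ne_zero 2 (norm_ne_zero_iff.2 (h0 t))
  rw [← intervalIntegral.integral_const_mul, ← intervalIntegral.integral_const_mul,
    ← intervalIntegral.integral_add ((c1.const_mul _).intervalIntegrable _ _)
      ((c2.const_mul _).intervalIntegrable _ _)]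
  congr 1; ext t
  rw [(kinetic_eq hsq hx' t).1, (kinetic_eq hsq hx' t).2]
  ring

lemma hasDerivAt_norm_sq {f : ℝ → ℂ} {f' : ℂ} {t : ℝ} (hf : HasDerivAt f f' t) :
    HasDerivAt (fun s => ‖f s‖ ^ 2) (2 * ((starRingEnd ℂ (f t)) * f').re) t := by
  refine hf.norm_sq.congr_deriv ?_
  rw [Complex.inner, mul_comm f']

/-- A square root `w` solving the regularized (harmonic oscillator) equation gives a solution of
the Kepler problem. -/
lemma kepler_of_oscillator {ν μ E : ℝ} (hw : ∀ t, HasDerivAt w (w' t) t)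
    (h0 : ∀ t, w t ≠ 0) (hsq : ∀ t, w t ^ 2 = x t) (hx' : ∀ t, x' t = 2 * w t * w' t)
    (hosc : ∀ t, HasDerivAt (fun s => ((‖w s‖ ^ 2 : ℝ) : ℂ) * w' s)
      (-((ν ^ 2 / ‖w t‖ ^ 2 : ℝ) : ℂ) * w t) t)
    (hE : ∀ t, (‖w t‖ ^ 2 * ‖w' t‖) ^ 2 + ν ^ 2 * ‖w t‖ ^ 2 = E) (hμ : μ = 2 * E) (t : ℝ) :
    HasDerivAt x' ((-μ / ‖x t‖ ^ 3 : ℝ) • x t) t := by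
  set p : ℝ → ℂ := fun s => ((‖w s‖ ^ 2 : ℝ) : ℂ) * w' s with hp
  have hcw : ∀ s, starRingEnd ℂ (w s) ≠ 0 := fun s => by simpa using h0 s
  have hn : ∀ s, ((‖w s‖ ^ 2 : ℝ) : ℂ) = w s * starRingEnd ℂ (w s) := fun s => by
    rw [Complex.mul_conj, Complex.normSq_eq_norm_sq]
  -- Since |w|² = w · conj w, the velocity is 2 p / conj w, where p = dw/ds has a known derivative;
  -- w' itself is not known to be differentiable beforehand.
  have hfun : x' = fun s => 2 * p s / starRingEnd ℂ (w s) := by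
    ext s
    rw [hx' s]
    simp only [hp, hn s]
    have := hcw s
    field_simp
  have hconj : HasDerivAt (fun s => starRingEnd ℂ (w s)) (starRingEnd ℂ (w' t)) t :=
    Complex.conjCLE.toContinuousLinearMap.hasFDerivAt.comp_hasDerivAt t (hw t)
  have hd := ((hosc t).const_mul 2).div hconj (hcw t)
  rw [hfun]
  refine hd.congr_deriv ?_
  have hEt : ((‖w t‖ ^ 2 : ℝ) : ℂ) ^ 2 * (w' t * starRingEnd ℂ (w' t)) +
      ν ^ 2 * ((‖w t‖ ^ 2 : ℝ) : ℂ) = E := by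
    rw [← hE t, Complex.mul_conj, Complex.normSq_eq_norm_sq]; push_cast; ring
  have hxn : ‖x t‖ = ‖w t‖ ^ 2 := by rw [← hsq t, norm_pow]
  have hw2 : ((‖w t‖ ^ 2 : ℝ) : ℂ) ≠ 0 := by
    rw [hn]; exact mul_ne_zero (h0 t) (hcw t)
  rw [hxn, Complex.real_smul, ← hsq t]
  have e1 : ((-μ / (‖w t‖ ^ 2) ^ 3 : ℝ) : ℂ) = -2 * E / ((‖w t‖ ^ 2 : ℝ) : ℂ) ^ 3 := by
    rw [hμ]; push_cast; ring
  have e2 : ((ν ^ 2 / ‖w t‖ ^ 2 : ℝ) : ℂ) = ν ^ 2 / ((‖w t‖ ^ 2 : ℝ) : ℂ) := by push_cast; ring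
  rw [e1, e2, ← hEt]
  simp only [hp]
  rw [hn t] at hw2 ⊢
  have := hcw t
  have := h0 t
  field_simp
  ring

end SquareRoot

section Gordon

variable {τ μ : ℝ} {x x' : ℝ → ℂ} {n : ℤ}

/-- **Gordon's theorem** for loops of class `C¹` without collisions. -/
theorem gordonBound_le_integral (hμ : 0 < μ) (hτ : 0 < τ) (hn : n = 1 ∨ n = -1)
    (hx : ∀ t, HasDerivAt x (x' t) t) (hx' : Continuous x') (hper : Function.Periodic x τ)
    (hi : HasIndex τ x n) :
    gordonBound μ τ ≤ ∫ t in (0 : ℝ)..τ, (1 / 2 * ‖x' t‖ ^ 2 + μ / ‖x t‖) := by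
  obtain ⟨w, w', hw, hw', ha, h0, hsq, h2⟩ := exists_antiperiodic_sqrt hn hx hx' hper hi
  obtain ⟨hS, hW, -⟩ := sqrt_wirtinger hτ hw hw' ha h0
  rw [integral_action_eq μ hw hw' h0 hsq h2]
  have := (gordon_trade_off hμ hτ hS).1
  linarith

/-- Loops of class `C¹` without collisions that attain Gordon's bound solve the Kepler problem, with
negative energy. -/
theorem kepler_of_integral_eq_gordonBound (hμ : 0 < μ) (hτ : 0 < τ) (hn : n = 1 ∨ n = -1)
    (hx : ∀ t, HasDerivAt x (x' t) t) (hx' : Continuous x') (hper : Function.Periodic x τ)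
    (hi : HasIndex τ x n)
    (heq : ∫ t in (0 : ℝ)..τ, (1 / 2 * ‖x' t‖ ^ 2 + μ / ‖x t‖) = gordonBound μ τ) (t : ℝ) :
    HasDerivAt x' ((-μ / ‖x t‖ ^ 3 : ℝ) • x t) t ∧ ‖x' t‖ ^ 2 / 2 - μ / ‖x t‖ < 0 := by
  obtain ⟨w, w', hw, hw', ha, h0, hsq, h2⟩ := exists_antiperiodic_sqrt hn hx hx' hper hi
  obtain ⟨hS, hW, hosc⟩ := sqrt_wirtinger hτ hw hw' ha h0
  rw [integral_action_eq μ hw hw' h0 hsq h2] at heq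
  have hwc : Continuous w := continuous_iff_continuousAt.2 fun t => (hw t).continuousAt
  set S := ∫ t in (0 : ℝ)..τ, 1 / ‖w t‖ ^ 2 with hSdef
  have htr := gordon_trade_off hμ hτ hS
  -- The chain action ≥ 2 (π/S)² τ + μ S ≥ bound collapses, so both links are equalities.
  have hW' : (∫ t in (0 : ℝ)..τ, ‖w t‖ ^ 2 * ‖w' t‖ ^ 2) = (Real.pi / S) ^ 2 * τ := by
    linarith [htr.1]
  have hopt : μ * S ^ 3 = 4 * Real.pi ^ 2 * τ := htr.2.1 (by linarith)
  specialize hosc hW'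
  set ν := Real.pi / S with hν
  have hν0 : 0 < ν := by positivity
  have hne : ∀ t, ‖w t‖ ≠ 0 := fun t => norm_ne_zero_iff.2 (h0 t)
  -- Conservation of the oscillator energy |dw/ds|² + ν² |w|².
  have hEd : ∀ t, HasDerivAt (fun s => (‖w s‖ ^ 2 * ‖w' s‖) ^ 2 + ν ^ 2 * ‖w s‖ ^ 2) 0 t := by
    intro t
    have d1 := hasDerivAt_norm_sq (hosc t)
    have d2 := (hasDerivAt_norm_sq (hw t)).const_mul (ν ^ 2)
    have e : (fun s => (‖w s‖ ^ 2 * ‖w' s‖) ^ 2 + ν ^ 2 * ‖w s‖ ^ 2) =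
        fun s => ‖((‖w s‖ ^ 2 : ℝ) : ℂ) * w' s‖ ^ 2 + ν ^ 2 * ‖w s‖ ^ 2 := by
      ext s
      rw [norm_mul, Complex.norm_real, Real.norm_of_nonneg (sq_nonneg _)]
    rw [e]
    refine (d1.add d2).congr_deriv ?_
    have hn := hne t
    simp only [map_mul, Complex.conj_ofReal, Complex.mul_re, Complex.mul_im, Complex.conj_re,
      Complex.conj_im, Complex.ofReal_re, Complex.ofReal_im, Complex.neg_re, Complex.neg_im]
    field_simp
    ring
  set E := (‖w 0‖ ^ 2 * ‖w' 0‖) ^ 2 + ν ^ 2 * ‖w 0‖ ^ 2 with hE0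
  have hE : ∀ t, (‖w t‖ ^ 2 * ‖w' t‖) ^ 2 + ν ^ 2 * ‖w t‖ ^ 2 = E := fun t =>
    is_const_of_deriv_eq_zero (fun s => (hEd s).differentiableAt) (fun s => (hEd s).deriv) t 0
  -- Energy conservation divided by |w|² is integrated over a period. With the optimal value of S it
  -- identifies μ as 2 E.
  have hES : E * S = 2 * ν ^ 2 * τ := by
    have c1 : Continuous fun t => ‖w t‖ ^ 2 * ‖w' t‖ ^ 2 := (hwc.norm.pow 2).mul (hw'.norm.pow 2)
    rw [hSdef, ← intervalIntegral.integral_const_mul]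
    have : ∀ t, E * (1 / ‖w t‖ ^ 2) = ‖w t‖ ^ 2 * ‖w' t‖ ^ 2 + ν ^ 2 := fun t => by
      rw [← hE t]
      have := hne t
      field_simp
    simp only [this]
    rw [intervalIntegral.integral_add (c1.intervalIntegrable _ _) (by simp), hW']
    simp
    ring
  have hμE : μ = 2 * E := by
    have h1 : μ * S ^ 3 = 2 * E * S ^ 3 := by
      have : 2 * E * S ^ 3 = 2 * S ^ 2 * (E * S) := by ring
      rw [this, hES, hopt, hν]
      field_simp
      ring
    exact mul_right_cancel₀ (pow_pos hS 3).ne' h1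
  refine ⟨kepler_of_oscillator hw h0 hsq h2 hosc hE hμE t, ?_⟩
  obtain ⟨k1, k2⟩ := kinetic_eq hsq h2 t
  have : ‖x' t‖ ^ 2 / 2 - μ / ‖x t‖ = -2 * ν ^ 2 := by
    rw [show ‖x' t‖ ^ 2 / 2 = 1 / 2 * ‖x' t‖ ^ 2 by ring, k1, k2, hμE, ← hE t]
    have := hne t
    field_simp
    ring
  rw [this]
  nlinarith

end Gordon

end ChargedThreeBody
end

noncomputable section
namespace ChargedThreeBody

/-! ### Elliptic Kepler orbits attain Gordon's bound -/

/-- For s near t the quotient x(s)/x(t) is near 1, and the imaginary part of its principal logarithm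
is φ(s) - φ(t) as long as this difference lies in (-π, π). -/
lemma hasDerivAt_angle {x : ℝ → ℂ} {v : ℂ} {φ : ℝ → ℝ} {t : ℝ} (hx : HasDerivAt x v t)
    (h0 : ∀ s, x s ≠ 0) (hφ : Continuous φ)
    (hpol : ∀ s, x s = ‖x s‖ * Complex.exp (φ s * Complex.I)) :
    HasDerivAt φ (v / x t).im t := by
  have h1 : HasDerivAt (fun s => x s / x t) (v / x t) t := hx.div_const _
  have h2 : HasDerivAt (fun s => Complex.log (x s / x t)) (v / x t / (x t / x t)) t :=
    h1.clog_real (by rw [div_self (h0 t)]; exact Complex.one_mem_slitPlane)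
  rw [div_self (h0 t), div_one] at h2
  have h3 : HasDerivAt (fun s => (Complex.log (x s / x t)).im + φ t) (v / x t).im t :=
    (Complex.imCLM.hasFDerivAt.comp_hasDerivAt t h2).add_const _
  refine h3.congr_of_eventuallyEq ?_
  have hball : ∀ᶠ s in nhds t, φ s - φ t ∈ Set.Ioo (-Real.pi) Real.pi := by
    refine (hφ.sub continuous_const).continuousAt.eventually_mem (Ioo_mem_nhds ?_ ?_) <;>
      simp [Real.pi_pos]
  filter_upwards [hball] with s hs
  have hpos : 0 < ‖x s‖ / ‖x t‖ := div_pos (norm_pos_iff.2 (h0 s)) (norm_pos_iff.2 (h0 t))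
  have e : x s / x t = ((‖x s‖ / ‖x t‖ : ℝ) : ℂ) *
      (Real.cos (φ s - φ t) + Real.sin (φ s - φ t) * Complex.I) := by
    conv_lhs => rw [hpol s, hpol t]
    rw [mul_div_mul_comm, ← Complex.exp_sub, ← sub_mul, Complex.ofReal_cos, Complex.ofReal_sin,
      ← Complex.exp_mul_I]
    push_cast; ring
  rw [Complex.log_im, e, Complex.ofReal_cos, Complex.ofReal_sin,
    Complex.arg_mul_cos_add_sin_mul_I hpos ⟨hs.1, hs.2.le⟩]
  ring

lemma im_div_eq (z w : ℂ) : (w / z).im = (z.re * w.im - z.im * w.re) / ‖z‖ ^ 2 := by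
  rw [Complex.div_im, Complex.sq_norm]
  ring

section Kepler

variable {τ μ : ℝ} {x x' : ℝ → ℂ}

lemma kepler_energy_const (hx : ∀ t, HasDerivAt x (x' t) t) (h0 : ∀ t, x t ≠ 0)
    (hx' : ∀ t, HasDerivAt x' ((-μ / ‖x t‖ ^ 3 : ℝ) • x t) t) (t s : ℝ) :
    ‖x' t‖ ^ 2 / 2 - μ / ‖x t‖ = ‖x' s‖ ^ 2 / 2 - μ / ‖x s‖ := by
  have hd : ∀ t, HasDerivAt (fun t => ‖x' t‖ ^ 2 / 2 - μ / ‖x t‖) 0 t := by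
    intro t
    have hn : ‖x t‖ ≠ 0 := norm_ne_zero_iff.2 (h0 t)
    have d1 := (hasDerivAt_norm_sq (hx' t)).div_const 2
    have d2 := (hasDerivAt_norm_sq (hx t)).sqrt (pow_ne_zero 2 hn)
    have d3 := (hasDerivAt_const t μ).div d2 (by simpa using h0 t)
    have e : (fun t => ‖x' t‖ ^ 2 / 2 - μ / ‖x t‖) =
        fun t => ‖x' t‖ ^ 2 / 2 - μ / Real.sqrt (‖x t‖ ^ 2) := by
      ext t; rw [Real.sqrt_sq (norm_nonneg _)]
    rw [e]
    refine (d1.sub d3).congr_deriv ?_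
    rw [Real.sqrt_sq (norm_nonneg _)]
    simp only [Complex.real_smul, Complex.mul_re, Complex.conj_re, Complex.conj_im,
      Complex.ofReal_re, Complex.ofReal_im, Complex.mul_im]
    field_simp
    ring
  exact is_const_of_deriv_eq_zero (fun s => (hd s).differentiableAt) (fun s => (hd s).deriv) t s

/-- The argument of an orbit with nonvanishing angular momentum and index `±1` takes its initial
value modulo `2 π` only once per period. -/
lemma angle_ne_of_angularMomentum_ne_zero {n : ℤ} (hn : n = 1 ∨ n = -1)
    (hx : ∀ t, HasDerivAt x (x' t) t) (h0 : ∀ t, x t ≠ 0)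
    (hL : ∀ t, (x t).re * (x' t).im - (x t).im * (x' t).re ≠ 0) {φ : ℝ → ℝ} (hφ : Continuous φ)
    (hpol : ∀ s, x s = ‖x s‖ * Complex.exp (φ s * Complex.I))
    (hφτ : φ τ - φ 0 = 2 * Real.pi * n) {t : ℝ} (ht : t ∈ Set.Ioo 0 τ) (k : ℤ) :
    φ t - φ 0 ≠ 2 * Real.pi * k := by
  have hd : ∀ t, HasDerivAt φ (x' t / x t).im t := fun t => hasDerivAt_angle (hx t) h0 hφ hpol
  -- The derivative of φ is the angular momentum divided by |x|², so Rolle's theorem makes φ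
  -- injective and hence strictly monotone.
  have hinj : Function.Injective φ := by
    have hlt : ∀ a b, a < b → φ a ≠ φ b := by
      intro a b hab heq
      obtain ⟨c, -, hc⟩ := exists_hasDerivAt_eq_zero hab hφ.continuousOn heq fun c _ => hd c
      rw [im_div_eq] at hc
      exact div_ne_zero (hL c) (pow_ne_zero 2 (norm_ne_zero_iff.2 (h0 c))) hc
    intro a b hab
    by_contra hne
    rcases lt_or_gt_of_ne hne with h | h
    · exact hlt a b h hab
    · exact hlt b a h hab.symm
  have hpi := Real.pi_pos
  intro hk
  rcases hφ.strictMono_of_inj hinj with hm | hm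
  · have h1 := hm ht.1
    have h2 := hm ht.2
    have hn1 : n = 1 := hn.resolve_right fun h => by
      rw [h] at hφτ; push_cast at hφτ; linarith
    rw [hn1] at hφτ
    have k1 : (0 : ℝ) < k := by
      by_contra! h; nlinarith
    have k2 : (k : ℝ) < 1 := by
      by_contra! h; push_cast at hφτ; nlinarith
    have k1' : 0 < k := by exact_mod_cast k1
    have k2' : k < 1 := by exact_mod_cast k2
    omega
  · have h1 := hm ht.1
    have h2 := hm ht.2
    have hn1 : n = -1 := hn.resolve_left fun h => by
      rw [h] at hφτ; push_cast at hφτ; linarith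
    rw [hn1] at hφτ
    have k1 : (k : ℝ) < 0 := by
      by_contra! h; nlinarith
    have k2 : (-1 : ℝ) < k := by
      by_contra! h; push_cast at hφτ; nlinarith
    have k1' : k < 0 := by exact_mod_cast k1
    have k2' : -1 < k := by exact_mod_cast k2
    omega

/-- The regularized orbit is an oscillator whose frequency ν is read off the energy -2 ν². Index ±1
and nonzero angular momentum allow exactly half an oscillation per period, so ν = π/S. A virial
identity then evaluates the kinetic part, and energy conservation gives the optimality condition on
S. -/
theorem integral_eq_gordonBound_of_kepler {n : ℤ} (hμ : 0 < μ) (hτ : 0 < τ)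
    (hn : n = 1 ∨ n = -1)
    (hx : ∀ t, HasDerivAt x (x' t) t) (hx' : ∀ t, HasDerivAt x' ((-μ / ‖x t‖ ^ 3 : ℝ) • x t) t)
    (hper : Function.Periodic x τ) (hi : HasIndex τ x n)
    (hE : ‖x' 0‖ ^ 2 / 2 - μ / ‖x 0‖ < 0)
    (hL : ∀ t, (x t).re * (x' t).im - (x t).im * (x' t).re ≠ 0) :
    ∫ t in (0 : ℝ)..τ, (1 / 2 * ‖x' t‖ ^ 2 + μ / ‖x t‖) = gordonBound μ τ := by
  have hx'c : Continuous x' := continuous_iff_continuousAt.2 fun t => (hx' t).continuousAt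
  obtain ⟨w, w', hw, hw', ha, h0, hsq, h2⟩ := exists_antiperiodic_sqrt hn hx hx'c hper hi
  obtain ⟨hS, -, -⟩ := sqrt_wirtinger hτ hw hw' ha h0
  rw [integral_action_eq μ hw hw' h0 hsq h2]
  have hwc : Continuous w := continuous_iff_continuousAt.2 fun t => (hw t).continuousAt
  have hinv : Continuous fun t => 1 / ‖w t‖ ^ 2 := continuous_const.div (hwc.norm.pow 2) fun t =>
    pow_ne_zero 2 (norm_ne_zero_iff.2 (h0 t))
  have c1 : Continuous fun t => ‖w t‖ ^ 2 * ‖w' t‖ ^ 2 := (hwc.norm.pow 2).mul (hw'.norm.pow 2)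
  have hne : ∀ t, ‖w t‖ ≠ 0 := fun t => norm_ne_zero_iff.2 (h0 t)
  set ν := Real.sqrt ((μ / ‖x 0‖ - ‖x' 0‖ ^ 2 / 2) / 2) with hν
  have hν2 : 2 * ν ^ 2 = μ / ‖x 0‖ - ‖x' 0‖ ^ 2 / 2 := by
    rw [hν, Real.sq_sqrt (by linarith)]; ring
  have henergy : ∀ t, 2 * (‖w t‖ ^ 2 * ‖w' t‖ ^ 2) = μ * (1 / ‖w t‖ ^ 2) - 2 * ν ^ 2 := fun t => by
    have := kepler_energy_const hx hi.1 hx' t 0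
    have k := kinetic_eq hsq h2 t
    rw [← k.2, mul_one_div, ← k.1]
    linarith
  have hcw : ∀ s, starRingEnd ℂ (w s) ≠ 0 := fun s => by simpa using h0 s
  have hnn : ∀ s, ((‖w s‖ ^ 2 : ℝ) : ℂ) = w s * starRingEnd ℂ (w s) := fun s => by
    rw [Complex.mul_conj, Complex.normSq_eq_norm_sq]
  have hosc : ∀ t, HasDerivAt (fun s => ((‖w s‖ ^ 2 : ℝ) : ℂ) * w' s)
      (-((ν ^ 2 / ‖w t‖ ^ 2 : ℝ) : ℂ) * w t) t := by
    intro t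
    have hconj : HasDerivAt (fun s => starRingEnd ℂ (w s)) (starRingEnd ℂ (w' t)) t :=
      Complex.conjCLE.toContinuousLinearMap.hasFDerivAt.comp_hasDerivAt t (hw t)
    have e : (fun s => ((‖w s‖ ^ 2 : ℝ) : ℂ) * w' s) = fun s => starRingEnd ℂ (w s) * x' s / 2 := by
      ext s; rw [hnn s, h2 s]; ring
    rw [e]
    refine ((hconj.mul (hx' t)).div_const 2).congr_deriv ?_
    have hen : ((‖w' t‖ ^ 2 : ℝ) : ℂ) =
        ((μ / (2 * (‖w t‖ ^ 2) ^ 2) - ν ^ 2 / ‖w t‖ ^ 2 : ℝ) : ℂ) := by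
      congr 1
      have h := henergy t
      have := hne t
      field_simp at h ⊢
      linarith
    have hk := kinetic_eq hsq h2 t
    rw [h2 t, Complex.real_smul, hk.1, ← hsq t]
    have e1 : starRingEnd ℂ (w' t) * (2 * w t * w' t) = 2 * w t * ((‖w' t‖ ^ 2 : ℝ) : ℂ) := by
      rw [← Complex.normSq_eq_norm_sq, ← Complex.mul_conj]; ring
    have e2 : starRingEnd ℂ (w t) * (((-μ / (‖w t‖ ^ 2) ^ 3 : ℝ) : ℂ) * w t ^ 2) =
        ((-μ / (‖w t‖ ^ 2) ^ 3 : ℝ) : ℂ) * ((‖w t‖ ^ 2 : ℝ) : ℂ) * w t := by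
      rw [hnn t]; ring
    rw [e1, e2, hen, ← Complex.ofReal_mul]
    have e3 : -μ / (‖w t‖ ^ 2) ^ 3 * ‖w t‖ ^ 2 = -μ / (‖w t‖ ^ 2) ^ 2 := by
      have := hne t
      field_simp
    rw [e3]
    have : (‖w t‖ : ℂ) ≠ 0 := Complex.ofReal_ne_zero.2 (hne t)
    push_cast
    field_simp
    ring
  set S := ∫ t in (0 : ℝ)..τ, 1 / ‖w t‖ ^ 2 with hSdef
  set p : ℝ → ℂ := fun s => ((‖w s‖ ^ 2 : ℝ) : ℂ) * w' s with hp
  -- the frequency is determined by comparison with `sin (π s / S)`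
  have hfreq : ν ^ 2 = (Real.pi / S) ^ 2 := by
    set c := Real.pi / S with hc
    set s : ℝ → ℝ := fun t => ∫ y in (0 : ℝ)..t, 1 / ‖w y‖ ^ 2 with hs
    have hsd : ∀ t, HasDerivAt s (1 / ‖w t‖ ^ 2) t := fun t =>
      intervalIntegral.integral_hasDerivAt_right (hinv.intervalIntegrable _ _)
        hinv.aestronglyMeasurable.stronglyMeasurableAtFilter hinv.continuousAt
    have hsm : StrictMono s := strictMono_of_deriv_pos fun t => by
      rw [(hsd t).deriv]
      exact one_div_pos.2 (pow_pos (norm_pos_iff.2 (h0 t)) 2)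
    have hs0 : s 0 = 0 := by simp [hs]
    have hsτ : s τ = S := rfl
    -- This factor turns w(0) into a positive real number, so Im(b w) vanishes at 0 and, by
    -- antiperiodicity, at τ.
    set b := starRingEnd ℂ (w 0) with hb
    have him : ∀ {f : ℝ → ℂ} {f' : ℂ} {t : ℝ}, HasDerivAt f f' t →
        HasDerivAt (fun s => (b * f s).im) (b * f').im t := fun h =>
      Complex.imCLM.hasFDerivAt.comp_hasDerivAt _ (h.const_mul b)
    -- The Wronskian of Im(b w) and sin(c s) in the time s. It vanishes at both ends, so Rolle gives
    -- an interior zero of its derivative, which is c² - ν² times a factor shown to be nonzero.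
    set W : ℝ → ℝ := fun t => (b * p t).im * Real.sin (c * s t) -
      c * Real.cos (c * s t) * (b * w t).im with hW
    have hWd : ∀ t, HasDerivAt W
        ((c ^ 2 - ν ^ 2) * ((b * w t).im * Real.sin (c * s t) / ‖w t‖ ^ 2)) t := by
      intro t
      have hcs := (hsd t).const_mul c
      refine (((him (hosc t)).mul hcs.sin).sub
        ((hcs.cos.const_mul c).mul (him (hw t)))).congr_deriv ?_
      have := hne t
      simp only [hp, Complex.mul_im, Complex.mul_re, Complex.ofReal_re, Complex.ofReal_im,
        Complex.neg_re, Complex.neg_im]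
      field_simp
      ring
    have hb0 : (b * w 0).im = 0 := by
      rw [hb, mul_comm, Complex.mul_conj, Complex.ofReal_im]
    have hbτ : (b * w τ).im = 0 := by
      have := ha 0
      rw [zero_add] at this
      rw [this, mul_neg, Complex.neg_im, hb0, neg_zero]
    have hW0 : W 0 = W τ := by
      simp only [hW, hb0, hbτ, hs0, hsτ, hc]
      rw [div_mul_cancel₀ _ hS.ne']
      simp
    obtain ⟨t, ht, htW⟩ := exists_hasDerivAt_eq_zero hτ
      (continuous_iff_continuousAt.2 fun t => (hWd t).continuousAt).continuousOn hW0
      fun t _ => hWd t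
    have hsin : Real.sin (c * s t) ≠ 0 := by
      have h1 := hsm ht.1
      have h2 := hsm ht.2
      rw [hs0] at h1
      rw [hsτ] at h2
      refine (Real.sin_pos_of_pos_of_lt_pi (by positivity) ?_).ne'
      calc c * s t < c * S := by gcongr
        _ = Real.pi := by rw [hc, div_mul_cancel₀ _ hS.ne']
    -- If b w(t) were real, then conj(x(0)) x(t) = (b w(t))² would be positive. The argument of x
    -- would thus return to its initial value modulo 2π inside the period, contrary to monotonicity.
    have hv : (b * w t).im ≠ 0 := by
      intro hz
      obtain ⟨-, φ, hφ, hpol, hφτ⟩ := hi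
      have hre : b * w t = ((b * w t).re : ℂ) := by
        apply Complex.ext <;> simp [hz]
      have hbne : b ≠ 0 := hcw 0
      set d := (b * w t).re with hd
      have hd0 : d ≠ 0 := fun h => mul_ne_zero hbne (h0 t) (by rw [hre, h]; simp)
      have hxx : starRingEnd ℂ (x 0) * x t = ((d ^ 2 : ℝ) : ℂ) := by
        rw [← hsq 0, ← hsq t, map_pow, ← mul_pow, ← hb, hre]; push_cast; rfl
      have hexp : Complex.exp ((φ t - φ 0 : ℝ) * Complex.I) = 1 := by
        have hconj : starRingEnd ℂ (Complex.exp (φ 0 * Complex.I)) =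
            Complex.exp (-(φ 0 * Complex.I)) := by
          rw [← Complex.exp_conj]; simp
        have e : starRingEnd ℂ (x 0) * x t =
            ((‖x 0‖ * ‖x t‖ : ℝ) : ℂ) * Complex.exp ((φ t - φ 0 : ℝ) * Complex.I) := by
          conv_lhs => rw [hpol 0, hpol t]
          rw [map_mul, hconj, Complex.conj_ofReal, Complex.ofReal_sub, sub_mul, sub_eq_add_neg,
            Complex.exp_add]
          push_cast; ring
        have hnorm : ‖x 0‖ * ‖x t‖ = d ^ 2 := by
          have := congrArg norm hxx
          rwa [Complex.norm_real, Real.norm_of_nonneg (sq_nonneg d), norm_mul, RCLike.norm_conj]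
            at this
        have hd2 : ((d ^ 2 : ℝ) : ℂ) ≠ 0 := Complex.ofReal_ne_zero.2 (pow_ne_zero 2 hd0)
        rw [e, hnorm] at hxx
        exact mul_left_cancel₀ hd2 (hxx.trans (mul_one _).symm)
      obtain ⟨k, hk⟩ := Complex.exp_eq_one_iff.1 hexp
      refine angle_ne_of_angularMomentum_ne_zero hn hx (fun s => ?_) hL hφ hpol hφτ ht k ?_
      · rw [← hsq s]; exact pow_ne_zero 2 (h0 s)
      · have h3 : ((φ t - φ 0 : ℝ) : ℂ) = ((2 * Real.pi * k : ℝ) : ℂ) := by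
          apply mul_right_cancel₀ Complex.I_ne_zero
          rw [hk]; push_cast; ring
        exact_mod_cast h3
    have hz := mul_eq_zero.1 htW
    rcases hz with h | h
    · linarith
    · exact absurd h (div_ne_zero (mul_ne_zero hv hsin) (pow_ne_zero 2 (hne t)))
  -- Virial identity: |w|² |w'|² - ν² is the derivative of the periodic function |w|² Re(conj w ·
  -- w').
  have hkin : (∫ t in (0 : ℝ)..τ, ‖w t‖ ^ 2 * ‖w' t‖ ^ 2) = ν ^ 2 * τ := by
    have hd : ∀ t, HasDerivAt (fun s => ‖w s‖ ^ 2 * ((starRingEnd ℂ (w s)) * w' s).re)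
        (‖w t‖ ^ 2 * ‖w' t‖ ^ 2 - ν ^ 2) t := by
      intro t
      have hconj : HasDerivAt (fun s => starRingEnd ℂ (w s)) (starRingEnd ℂ (w' t)) t :=
        Complex.conjCLE.toContinuousLinearMap.hasFDerivAt.comp_hasDerivAt t (hw t)
      have h := Complex.reCLM.hasFDerivAt.comp_hasDerivAt t (hconj.mul (hosc t))
      have e : (fun s => ‖w s‖ ^ 2 * ((starRingEnd ℂ (w s)) * w' s).re) =
          fun s => (starRingEnd ℂ (w s) * p s).re := by
        ext s
        simp only [hp]
        rw [mul_left_comm, Complex.re_ofReal_mul]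
      rw [e]
      refine h.congr_deriv ?_
      have := hne t
      have hw2 : ‖w t‖ ^ 2 = (w t).re * (w t).re + (w t).im * (w t).im := by
        rw [Complex.sq_norm, Complex.normSq_apply]
      have hw'2 : ‖w' t‖ ^ 2 = (w' t).re * (w' t).re + (w' t).im * (w' t).im := by
        rw [Complex.sq_norm, Complex.normSq_apply]
      have hwp : (w t).re ^ 2 + (w t).im ^ 2 ≠ 0 := by
        rw [sq, sq, ← hw2]; exact pow_ne_zero 2 this
      simp only [hp, Complex.reCLM_apply, Complex.add_re, Complex.mul_re, Complex.mul_im,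
        Complex.conj_re, Complex.conj_im, Complex.ofReal_re, Complex.ofReal_im, Complex.neg_re,
        Complex.neg_im, hw2, hw'2]
      field_simp
      ring
    have hint := intervalIntegral.integral_eq_sub_of_hasDerivAt (a := 0) (b := τ)
      (fun t _ => hd t) ((c1.sub continuous_const).intervalIntegrable _ _)
    have ha' := antiperiodic_deriv hw ha 0
    have ha0 := ha 0
    rw [zero_add] at ha' ha0
    rw [intervalIntegral.integral_sub (c1.intervalIntegrable _ _) (by simp), ha', ha0] at hint
    simp at hint
    linarith
  have hμS : μ * S = 4 * ν ^ 2 * τ := by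
    have h : (∫ t in (0 : ℝ)..τ, 2 * (‖w t‖ ^ 2 * ‖w' t‖ ^ 2)) =
        ∫ t in (0 : ℝ)..τ, (μ * (1 / ‖w t‖ ^ 2) - 2 * ν ^ 2) := by
      congr 1; ext t; exact henergy t
    rw [intervalIntegral.integral_const_mul, hkin, intervalIntegral.integral_sub
      ((hinv.const_mul _).intervalIntegrable _ _) (by simp),
      intervalIntegral.integral_const_mul] at h
    simp at h
    simp only [hSdef, one_div]
    linarith
  rw [hkin, hfreq, ← mul_assoc]
  refine (gordon_trade_off hμ hτ hS).2.2 ?_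
  rw [hfreq] at hμS
  calc μ * S ^ 3 = (μ * S) * S ^ 2 := by ring
    _ = 4 * Real.pi ^ 2 * τ := by rw [hμS]; field_simp

end Kepler

end ChargedThreeBody
end

/-! ### Absolutely continuous functions -/

/-- Used with the norm and with the tangent on a compact interval. -/
theorem LipschitzOnWith.comp_absolutelyContinuousOnInterval {X Y : Type*} [PseudoMetricSpace X]
    [PseudoMetricSpace Y] {g : X → Y} {f : ℝ → X} {s : Set X} {K : NNReal} {a b : ℝ}
    (hg : LipschitzOnWith K g s) (hf : AbsolutelyContinuousOnInterval f a b)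
    (hs : Set.MapsTo f (Set.uIcc a b) s) :
    AbsolutelyContinuousOnInterval (fun t => g (f t)) a b := by
  unfold AbsolutelyContinuousOnInterval at hf
  refine squeeze_zero' (.of_forall fun E => Finset.sum_nonneg fun i _ => dist_nonneg) ?_
    (by simpa using hf.const_mul (K : ℝ))
  rw [Filter.eventually_inf_principal]
  filter_upwards with ⟨n, I⟩ hE
  simp only [Finset.mul_sum]
  gcongr with i hi
  exact hg.dist_le_mul _ (hs (hE.1 i hi).1) _ (hs (hE.1 i hi).2)

theorem AbsolutelyContinuousOnInterval.norm {f : ℝ → ℂ} {a b : ℝ}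
    (hf : AbsolutelyContinuousOnInterval f a b) :
    AbsolutelyContinuousOnInterval (fun t => ‖f t‖) a b :=
  (lipschitzWith_one_norm (E := ℂ)).lipschitzOnWith (s := Set.univ)
    |>.comp_absolutelyContinuousOnInterval hf (Set.mapsTo_univ _ _)

theorem AbsolutelyContinuousOnInterval.ae_differentiableAt_complex {f : ℝ → ℂ} {a b : ℝ}
    (hf : AbsolutelyContinuousOnInterval f a b) :
    ∀ᵐ t, t ∈ Set.uIcc a b → DifferentiableAt ℝ f t :=
  hf.boundedVariationOn.ae_differentiableAt_of_mem_uIcc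

/-- The norm is 1-Lipschitz, so difference quotients compare. Hence passing from x to |x| can only
lower the kinetic energy. -/
lemma abs_deriv_norm_le {f : ℝ → ℂ} {t : ℝ} (hf : DifferentiableAt ℝ f t)
    (hn : DifferentiableAt ℝ (fun s => ‖f s‖) t) : |deriv (fun s => ‖f s‖) t| ≤ ‖deriv f t‖ := by
  have h1 := (hasDerivAt_iff_tendsto_slope.1 hf.hasDerivAt).norm
  have h2 := (hasDerivAt_iff_tendsto_slope.1 hn.hasDerivAt).norm
  refine le_of_tendsto_of_tendsto h2 h1 (.of_forall fun s => ?_)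
  simp only [slope_def_module, norm_smul]
  gcongr
  exact abs_norm_sub_norm_le _ _

noncomputable section
namespace ChargedThreeBody

/-! ### The action of a pair of bodies -/

/-- The action of the Kepler problem `x'' = - μ x / |x|³`. -/
def pairAction (μ τ : ℝ) (x : ℝ → ℂ) : ℝ≥0∞ :=
  ∫⁻ t in Set.Ioc 0 τ, (ENNReal.ofReal (1 / 2 * ‖deriv x t‖ ^ 2) + ENNReal.ofReal μ / ‖x t‖ₑ)

lemma ofReal_div_enorm (μ : ℝ) {z : ℂ} (hz : z ≠ 0) :
    ENNReal.ofReal μ / ‖z‖ₑ = ENNReal.ofReal (μ / ‖z‖) := by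
  rw [ENNReal.ofReal_div_of_pos (norm_pos_iff.2 hz), ofReal_norm]

lemma pairAction_eq_ofReal {μ τ : ℝ} (hμ : 0 < μ) (hτ : 0 < τ) {x x' : ℝ → ℂ}
    (hx : ∀ t, HasDerivAt x (x' t) t) (hx' : Continuous x') (h0 : ∀ t, x t ≠ 0) :
    pairAction μ τ x =
      ENNReal.ofReal (∫ t in (0 : ℝ)..τ, (1 / 2 * ‖x' t‖ ^ 2 + μ / ‖x t‖)) := by
  have hxc : Continuous x := continuous_iff_continuousAt.2 fun t => (hx t).continuousAt
  have hc : Continuous fun t => 1 / 2 * ‖x' t‖ ^ 2 + μ / ‖x t‖ :=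
    (continuous_const.mul (hx'.norm.pow 2)).add
      (continuous_const.div hxc.norm fun t => norm_ne_zero_iff.2 (h0 t))
  rw [intervalIntegral.integral_of_le hτ.le, ofReal_integral_eq_lintegral_ofReal
    ((hc.intervalIntegrable 0 τ).1) (.of_forall fun t => by positivity)]
  refine lintegral_congr fun t => ?_
  rw [(hx t).deriv, ofReal_div_enorm μ (h0 t), ENNReal.ofReal_add (by positivity) (by positivity)]

/-- The calibration of the collision-ejection orbit. -/
lemma two_mul_sq_mul_le_of_collision_calibration {r : ℝ → ℝ} {a b ν c α : ℝ} (hab : a ≤ b)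
    (hr : AbsolutelyContinuousOnInterval r a b) (hr0 : ∀ᵐ t, t ∈ Set.uIcc a b → r t ≠ 0)
    (hinv : IntervalIntegrable (fun t => 1 / r t) volume a b)
    (hsq : IntervalIntegrable (fun t => deriv r t ^ 2) volume a b) (hα : α < Real.pi / 2)
    (hθ : ∀ t ∈ Set.Icc a b, ν * ((∫ y in a..t, 1 / r y) + c) ∈ Set.Icc (-α) α) :
    2 * ν ^ 2 * (b - a) ≤ (∫ t in a..b, 1 / 2 * deriv r t ^ 2) +
      2 * ν * (Real.tan (ν * ((∫ y in a..b, 1 / r y) + c)) * r b - Real.tan (ν * c) * r a) := by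
  set s : ℝ → ℝ := fun t => ∫ y in a..t, 1 / r y with hs
  set θ : ℝ → ℝ := fun t => ν * (s t + c) with hθdef
  rw [← Set.uIcc_of_le hab] at hθ
  have hsAC : AbsolutelyContinuousOnInterval s a b :=
    hinv.absolutelyContinuousOnInterval_intervalIntegral Set.left_mem_uIcc
  have hcos : ∀ y ∈ Set.Icc (-α) α, Real.cos y ≠ 0 := fun y hy =>
    (Real.cos_pos_of_mem_Ioo ⟨by linarith [hy.1], by linarith [hy.2]⟩).ne'
  -- Here r is only absolutely continuous. The Lipschitz bound keeps tan(θ) r absolutely continuous,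
  -- so its derivative can be integrated.
  obtain ⟨K, hK⟩ : ∃ K, LipschitzOnWith K Real.tan (Set.Icc (-α) α) :=
    ContDiffOn.exists_lipschitzOnWith (n := 1)
      (fun y hy => (Real.contDiffAt_tan.2 (hcos y hy)).contDiffWithinAt) (by simp)
      (convex_Icc _ _) isCompact_Icc
  have hθAC : AbsolutelyContinuousOnInterval θ a b := by
    have hc : AbsolutelyContinuousOnInterval (fun _ : ℝ => c) a b :=
      (LipschitzWith.const c).lipschitzOnWith.absolutelyContinuousOnInterval
    exact (hsAC.fun_add hc).const_mul ν
  have hTAC := hK.comp_absolutelyContinuousOnInterval hθAC hθ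
  have hgAC := hTAC.fun_mul hr
  have hint := hgAC.integral_deriv_eq_sub
  have hsa : s a = 0 := by simp [hs]
  have hle : ∫ t in a..b, (2 * ν ^ 2 : ℝ) ≤
      ∫ t in a..b, (1 / 2 * deriv r t ^ 2 + 2 * ν * deriv (fun t => Real.tan (θ t) * r t) t) := by
    refine intervalIntegral.integral_mono_ae_restrict hab (by simp)
      ((hsq.const_mul _).add (hgAC.intervalIntegrable_deriv.const_mul _)) ?_
    rw [Filter.EventuallyLE, ae_restrict_iff' measurableSet_Icc, ← Set.uIcc_of_le hab]
    filter_upwards [hr.ae_differentiableAt, hinv.ae_hasDerivAt_integral, hr0] with t h1 h2 h3 ht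
    have hc := hcos _ (hθ t ht)
    have hd := ((Real.hasDerivAt_tan hc).comp t
      (((h2 ht a Set.left_mem_uIcc).add_const c).const_mul ν)).mul (h1 ht).hasDerivAt
    have hd' : deriv (fun t => Real.tan (θ t) * r t) t = _ := hd.deriv
    have hT : 1 / Real.cos (θ t) ^ 2 = 1 + Real.tan (θ t) ^ 2 := by
      rw [Real.tan_eq_sin_div_cos, div_pow, one_add_div (pow_ne_zero 2 hc), Real.cos_sq_add_sin_sq]
    have hrt := h3 ht
    rw [hd']
    simp only [Function.comp_apply]
    change 2 * ν ^ 2 ≤ 1 / 2 * deriv r t ^ 2 +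
      2 * ν * (1 / Real.cos (θ t) ^ 2 * (ν * (1 / r t)) * r t + Real.tan (θ t) * deriv r t)
    have e : 1 / Real.cos (θ t) ^ 2 * (ν * (1 / r t)) * r t = ν * (1 + Real.tan (θ t) ^ 2) := by
      rw [hT]; field_simp
    rw [e]
    -- The difference of the two sides is half of this square.
    nlinarith [sq_nonneg (deriv r t + 2 * ν * Real.tan (θ t))]
  rw [intervalIntegral.integral_add (hsq.const_mul _) (hgAC.intervalIntegrable_deriv.const_mul _),
    intervalIntegral.integral_const_mul (2 * ν), hint] at hle
  simp only [hθdef, hsa, zero_add] at hle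
  simp at hle
  simp only [hs] at hle ⊢
  norm_num at hle ⊢
  linarith

/-- The phase is measured from the collision once around the period, through τ ~ 0, so it runs from
-ν S/2 to ν S/2. The boundary terms vanish at the collision, where r = 0, and those at τ and 0
cancel by periodicity. -/
lemma two_mul_sq_mul_le_of_collision {r : ℝ → ℝ} {τ t₀ : ℝ} (hτ : 0 < τ)
    (ht₀ : t₀ ∈ Set.Icc 0 τ) (hr : AbsolutelyContinuousOnInterval r 0 τ) (hnn : ∀ t, 0 ≤ r t)
    (hr0 : ∀ᵐ t, t ∈ Set.uIcc 0 τ → r t ≠ 0) (hper : r 0 = r τ) (hcol : r t₀ = 0)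
    (hinv : IntervalIntegrable (fun t => 1 / r t) volume 0 τ)
    (hsq : IntervalIntegrable (fun t => deriv r t ^ 2) volume 0 τ)
    (hS : 0 < ∫ t in (0 : ℝ)..τ, 1 / r t) :
    (Real.pi / ∫ t in (0 : ℝ)..τ, 1 / r t) ^ 2 * (2 * τ) ≤
      ∫ t in (0 : ℝ)..τ, 1 / 2 * deriv r t ^ 2 := by
  set S := ∫ t in (0 : ℝ)..τ, 1 / r t with hSdef
  have hpi := Real.pi_pos
  refine sq_mul_le_of_forall_lt (by positivity) fun ν hν0 hν => ?_
  have hνS : ν * S < Real.pi := (lt_div_iff₀ hS).1 hν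
  have sub1 : Set.uIcc 0 t₀ ⊆ Set.uIcc 0 τ :=
    Set.uIcc_subset_uIcc Set.left_mem_uIcc (by rwa [Set.uIcc_of_le hτ.le])
  have sub2 : Set.uIcc t₀ τ ⊆ Set.uIcc 0 τ :=
    Set.uIcc_subset_uIcc (by rwa [Set.uIcc_of_le hτ.le]) Set.right_mem_uIcc
  have inv_nn : ∀ t, 0 ≤ 1 / r t := fun t => one_div_nonneg.2 (hnn t)
  have i1 := hinv.mono_set sub1
  have i2 := hinv.mono_set sub2
  have hadd : (∫ y in (0 : ℝ)..t₀, 1 / r y) + (∫ y in t₀..τ, 1 / r y) = S :=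
    intervalIntegral.integral_add_adjacent_intervals i1 i2
  have n1 : 0 ≤ ∫ y in (0 : ℝ)..t₀, 1 / r y :=
    intervalIntegral.integral_nonneg ht₀.1 fun t _ => inv_nn t
  have n2 : 0 ≤ ∫ y in t₀..τ, 1 / r y :=
    intervalIntegral.integral_nonneg ht₀.2 fun t _ => inv_nn t
  have p2 := two_mul_sq_mul_le_of_collision_calibration (ν := ν) (c := -(S / 2))
    (α := ν * S / 2) ht₀.2 (hr.mono sub2)
    (by filter_upwards [hr0] with t h ht using h (sub2 ht)) i2 (hsq.mono_set sub2)
    (by linarith) (fun t ht => by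
      have a1 : 0 ≤ ∫ y in t₀..t, 1 / r y :=
        intervalIntegral.integral_nonneg ht.1 fun t _ => inv_nn t
      have a2 : (∫ y in t₀..t, 1 / r y) ≤ ∫ y in t₀..τ, 1 / r y :=
        intervalIntegral.integral_mono_interval le_rfl ht.1 ht.2 (.of_forall inv_nn) i2
      constructor <;> nlinarith)
  have p1 := two_mul_sq_mul_le_of_collision_calibration (ν := ν)
    (c := (∫ y in t₀..τ, 1 / r y) - S / 2)
    (α := ν * S / 2) ht₀.1 (hr.mono sub1)
    (by filter_upwards [hr0] with t h ht using h (sub1 ht)) i1 (hsq.mono_set sub1)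
    (by linarith) (fun t ht => by
      have a1 : 0 ≤ ∫ y in (0 : ℝ)..t, 1 / r y :=
        intervalIntegral.integral_nonneg ht.1 fun t _ => inv_nn t
      have a2 : (∫ y in (0 : ℝ)..t, 1 / r y) ≤ ∫ y in (0 : ℝ)..t₀, 1 / r y :=
        intervalIntegral.integral_mono_interval le_rfl ht.1 ht.2 (.of_forall inv_nn) i1
      constructor <;> nlinarith)
  have hK : (∫ t in (0 : ℝ)..t₀, 1 / 2 * deriv r t ^ 2) + (∫ t in t₀..τ, 1 / 2 * deriv r t ^ 2) =
      ∫ t in (0 : ℝ)..τ, 1 / 2 * deriv r t ^ 2 :=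
    intervalIntegral.integral_add_adjacent_intervals ((hsq.mono_set sub1).const_mul _)
      ((hsq.mono_set sub2).const_mul _)
  rw [hcol, mul_zero] at p1 p2
  rw [← sub_eq_add_neg, ← hper] at p2
  linarith

/-- Gordon's bound for loops through the origin. -/
theorem gordonBound_le_pairAction_of_collision {μ τ t₀ : ℝ} {x : ℝ → ℂ} (hμ : 0 < μ) (hτ : 0 < τ)
    (hx : AbsolutelyContinuousOnInterval x 0 τ) (hper : x 0 = x τ) (ht₀ : t₀ ∈ Set.Icc 0 τ)
    (hcol : x t₀ = 0) : ENNReal.ofReal (gordonBound μ τ) ≤ pairAction μ τ x := by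
  by_cases htop : pairAction μ τ x = ⊤
  · rw [htop]; exact le_top
  have hxc : ContinuousOn x (Set.Icc 0 τ) := by
    have := hx.continuousOn
    rwa [Set.uIcc_of_le hτ.le] at this
  have hxm : AEMeasurable x (volume.restrict (Set.Ioc 0 τ)) :=
    (hxc.mono Set.Ioc_subset_Icc_self).aemeasurable measurableSet_Ioc
  have hdm : Measurable (deriv x) := measurable_deriv x
  have hsplit : pairAction μ τ x =
      (∫⁻ t in Set.Ioc 0 τ, ENNReal.ofReal (1 / 2 * ‖deriv x t‖ ^ 2)) +
        ∫⁻ t in Set.Ioc 0 τ, ENNReal.ofReal μ / ‖x t‖ₑ :=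
    lintegral_add_left ((hdm.norm.pow_const 2).const_mul _).ennreal_ofReal _
  have hfin1 : (∫⁻ t in Set.Ioc 0 τ, ENNReal.ofReal (1 / 2 * ‖deriv x t‖ ^ 2)) ≠ ⊤ :=
    fun h => htop (by rw [hsplit, h, top_add])
  have hfin2 : (∫⁻ t in Set.Ioc 0 τ, ENNReal.ofReal μ / ‖x t‖ₑ) ≠ ⊤ :=
    fun h => htop (by rw [hsplit, h, add_top])
  -- Collision times form a null set, since the potential is ∞ there and has finite integral. Hence
  -- the real function 1/|x|, equal to 0 at collisions, represents the potential almost everywhere.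
  have hne : ∀ᵐ t ∂(volume.restrict (Set.Ioc 0 τ)), x t ≠ 0 := by
    filter_upwards [ae_lt_top' (hxm.enorm.const_div _) hfin2] with t ht h0
    rw [h0, enorm_zero, ENNReal.div_zero (by simpa using hμ)] at ht
    exact lt_irrefl _ ht
  have hI1 : IntegrableOn (fun t => 1 / 2 * ‖deriv x t‖ ^ 2) (Set.Ioc 0 τ) :=
    ⟨((hdm.norm.pow_const 2).const_mul _).aestronglyMeasurable, by
      rw [hasFiniteIntegral_iff_ofReal (.of_forall fun t => by positivity)]
      exact lt_top_iff_ne_top.2 hfin1⟩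
  have hI2eq : (∫⁻ t in Set.Ioc 0 τ, ENNReal.ofReal μ / ‖x t‖ₑ) =
      ∫⁻ t in Set.Ioc 0 τ, ENNReal.ofReal (μ * (1 / ‖x t‖)) := by
    refine lintegral_congr_ae ?_
    filter_upwards [hne] with t ht
    rw [ofReal_div_enorm μ ht, mul_one_div]
  have hI2' : IntegrableOn (fun t => μ * (1 / ‖x t‖)) (Set.Ioc 0 τ) :=
    ⟨((hxm.norm.const_div 1).const_mul μ).aestronglyMeasurable, by
      rw [hasFiniteIntegral_iff_ofReal (.of_forall fun t => by positivity), ← hI2eq]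
      exact lt_top_iff_ne_top.2 hfin2⟩
  have hI2 : IntegrableOn (fun t => 1 / ‖x t‖) (Set.Ioc 0 τ) := by
    refine (hI2'.const_mul (1 / μ)).congr (.of_forall fun t => ?_)
    field_simp
  have hr := hx.norm
  have hdle : ∀ᵐ t ∂(volume.restrict (Set.Ioc 0 τ)),
      deriv (fun s => ‖x s‖) t ^ 2 ≤ ‖deriv x t‖ ^ 2 := by
    rw [ae_restrict_iff' measurableSet_Ioc]
    filter_upwards [hx.ae_differentiableAt_complex, hr.ae_differentiableAt] with t h1 h2 ht
    have ht' : t ∈ Set.uIcc 0 τ := Set.Ioc_subset_Icc_self.trans Set.Icc_subset_uIcc ht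
    rw [← sq_abs]
    gcongr
    exact abs_deriv_norm_le (h1 ht') (h2 ht')
  have hI3 : IntegrableOn (fun t => deriv (fun s => ‖x s‖) t ^ 2) (Set.Ioc 0 τ) := by
    refine Integrable.mono' (hI1.const_mul 2)
      ((measurable_deriv _).pow_const 2).aestronglyMeasurable ?_
    filter_upwards [hdle] with t ht
    rw [Real.norm_of_nonneg (sq_nonneg _)]
    linarith
  have hS : 0 < ∫ t in (0 : ℝ)..τ, 1 / ‖x t‖ := by
    rw [intervalIntegral.integral_of_le hτ.le, integral_pos_iff_support_of_nonneg_ae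
      (.of_forall fun t => by positivity) hI2]
    have : volume.restrict (Set.Ioc 0 τ) (Function.support fun t => 1 / ‖x t‖) =
        volume.restrict (Set.Ioc 0 τ) Set.univ := by
      refine measure_congr ?_
      filter_upwards [hne] with t ht
      exact propext ⟨fun _ => trivial,
        fun _ => one_div_ne_zero (norm_ne_zero_iff.2 ht)⟩
    rw [this]
    simpa using hτ
  have hr0 : ∀ᵐ t, t ∈ Set.uIcc 0 τ → ‖x t‖ ≠ 0 := by
    rw [ae_restrict_iff' measurableSet_Ioc] at hne
    have h0 : ∀ᵐ t : ℝ, t ≠ 0 := by simp [ae_iff, measure_singleton]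
    filter_upwards [hne, h0] with t h1 h2 ht
    rw [Set.uIcc_of_le hτ.le] at ht
    exact norm_ne_zero_iff.2 (h1 ⟨lt_of_le_of_ne ht.1 (Ne.symm h2), ht.2⟩)
  have iu : ∀ {f : ℝ → ℝ}, IntegrableOn f (Set.Ioc 0 τ) → IntervalIntegrable f volume 0 τ :=
    fun h => (intervalIntegrable_iff_integrableOn_Ioc_of_le hτ.le).2 h
  have hmain := two_mul_sq_mul_le_of_collision hτ ht₀ hr (fun t => norm_nonneg _) hr0
    (by rw [hper]) (by rw [hcol, norm_zero]) (iu hI2) (iu hI3) hS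
  have hle : ∫ t in (0 : ℝ)..τ, 1 / 2 * deriv (fun s => ‖x s‖) t ^ 2 ≤
      ∫ t in (0 : ℝ)..τ, 1 / 2 * ‖deriv x t‖ ^ 2 := by
    rw [intervalIntegral.integral_of_le hτ.le, intervalIntegral.integral_of_le hτ.le]
    refine integral_mono_ae (hI3.const_mul _) hI1 ?_
    filter_upwards [hdle] with t ht
    linarith
  rw [hsplit, hI2eq, ← ofReal_integral_eq_lintegral_ofReal hI1 (.of_forall fun t => by positivity),
    ← ofReal_integral_eq_lintegral_ofReal hI2' (.of_forall fun t => by positivity),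
    ← ENNReal.ofReal_add (integral_nonneg fun t => by positivity)
      (integral_nonneg fun t => by positivity),
    ← intervalIntegral.integral_of_le hτ.le, ← intervalIntegral.integral_of_le hτ.le,
    intervalIntegral.integral_const_mul μ]
  refine ENNReal.ofReal_le_ofReal ?_
  have := (gordon_trade_off hμ hτ hS).1
  linarith

end ChargedThreeBody
end

noncomputable section
namespace ChargedThreeBody

/-! ### Approximation by smooth loops -/

/-- A `W^{1,2}` bound on an interval controls the supremum norm. -/
lemma norm_sq_le_of_lintegral_le {g : ℝ → ℂ} {τ ε : ℝ} (hτ : 0 < τ) (hε : 0 ≤ ε)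
    (hg : AbsolutelyContinuousOnInterval g 0 τ)
    (h : ∫⁻ t in Set.Ioc 0 τ, (‖g t‖ₑ ^ 2 + ‖deriv g t‖ₑ ^ 2) ≤ ENNReal.ofReal ε) {t : ℝ}
    (ht : t ∈ Set.Icc 0 τ) : ‖g t‖ ^ 2 ≤ ε * (1 + 1 / τ) := by
  have hgc : ContinuousOn g (Set.Icc 0 τ) := by
    have := hg.continuousOn
    rwa [Set.uIcc_of_le hτ.le] at this
  have hgm : AEMeasurable g (volume.restrict (Set.Ioc 0 τ)) :=
    (hgc.mono Set.Ioc_subset_Icc_self).aemeasurable measurableSet_Ioc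
  have hdm : Measurable (deriv g) := measurable_deriv g
  have hpt : ∀ t, ‖g t‖ₑ ^ 2 + ‖deriv g t‖ₑ ^ 2 =
      ENNReal.ofReal (‖g t‖ ^ 2 + ‖deriv g t‖ ^ 2) := fun t => by
    rw [ENNReal.ofReal_add (by positivity) (by positivity), ENNReal.ofReal_pow (norm_nonneg _),
      ENNReal.ofReal_pow (norm_nonneg _), ofReal_norm, ofReal_norm]
  simp only [hpt] at h
  have hI : IntegrableOn (fun t => ‖g t‖ ^ 2 + ‖deriv g t‖ ^ 2) (Set.Ioc 0 τ) :=
    ⟨((hgm.norm.pow_const 2).add (hdm.norm.pow_const 2).aemeasurable).aestronglyMeasurable, by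
      rw [hasFiniteIntegral_iff_ofReal (.of_forall fun t => by positivity)]
      exact h.trans_lt ENNReal.ofReal_lt_top⟩
  have hle : ∫ t in Set.Ioc 0 τ, (‖g t‖ ^ 2 + ‖deriv g t‖ ^ 2) ≤ ε := by
    rw [← ofReal_integral_eq_lintegral_ofReal hI (.of_forall fun t => by positivity)] at h
    exact (ENNReal.ofReal_le_ofReal_iff hε).1 h
  have hr := hg.norm
  have hII : IntervalIntegrable (fun t => ‖g t‖ ^ 2 + ‖deriv g t‖ ^ 2) volume 0 τ :=
    (intervalIntegrable_iff_integrableOn_Ioc_of_le hτ.le).2 hI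
  -- The variation of |g|² is at most ∫ 2 |g| |g'| ≤ ∫ (|g|² + |g'|²).
  have hosc : ∀ s ∈ Set.Icc 0 τ, ‖g t‖ ^ 2 - ‖g s‖ ^ 2 ≤ ε := by
    intro s hs
    have hsub : Set.uIcc s t ⊆ Set.uIcc 0 τ := by
      rw [← Set.uIcc_of_le hτ.le] at hs ht
      exact Set.uIcc_subset_uIcc hs ht
    have hr' := hr.mono hsub
    have h2 := (hr'.fun_mul hr').integral_deriv_eq_sub
    have h3 : ‖g t‖ ^ 2 - ‖g s‖ ^ 2 = ∫ y in s..t, deriv (fun y => ‖g y‖ * ‖g y‖) y := by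
      rw [h2]; ring
    rw [h3]
    refine (le_abs_self _).trans ?_
    rw [← Real.norm_eq_abs]
    have hst : Set.uIoc s t ⊆ Set.Ioc 0 τ := by
      intro y hy
      rw [Set.mem_uIoc] at hy
      rcases hy with hy | hy
      · exact ⟨hs.1.trans_lt hy.1, hy.2.trans ht.2⟩
      · exact ⟨ht.1.trans_lt hy.1, hy.2.trans hs.2⟩
    refine (intervalIntegral.norm_integral_le_integral_norm_uIoc).trans ?_
    refine le_trans ?_ hle
    refine le_trans ?_ (setIntegral_mono_set hI (.of_forall fun t => by positivity)
      (LE.le.eventuallyLE hst))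
    refine integral_mono_ae ?_ (hI.mono_set hst) ?_
    · exact (intervalIntegrable_iff.1 (hr'.fun_mul hr').intervalIntegrable_deriv).norm
    · rw [Filter.EventuallyLE, ae_restrict_iff' measurableSet_uIoc]
      filter_upwards [hg.ae_differentiableAt_complex, hr.ae_differentiableAt] with y h1 h2 hy
      have hy' : y ∈ Set.uIcc 0 τ :=
        Set.Ioc_subset_Icc_self.trans Set.Icc_subset_uIcc (hst hy)
      have h4 := abs_deriv_norm_le (h1 hy') (h2 hy')
      have h5 := ((h2 hy').hasDerivAt.mul (h2 hy').hasDerivAt).deriv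
      have h6 : deriv (fun y => ‖g y‖ * ‖g y‖) y = 2 * ‖g y‖ * deriv (fun s => ‖g s‖) y := by
        refine Eq.trans h5 ?_
        ring
      rw [h6, Real.norm_eq_abs, abs_mul, abs_mul, abs_of_nonneg (norm_nonneg _)]
      norm_num
      nlinarith [sq_nonneg (‖g y‖ - ‖deriv g y‖), norm_nonneg (g y)]
  -- Otherwise |g|² would exceed its admissible mean ε/τ everywhere.
  have hmin : ∃ s ∈ Set.Icc 0 τ, ‖g s‖ ^ 2 ≤ ε / τ := by
    by_contra! hcon
    have : ε < ∫ t in Set.Ioc 0 τ, (‖g t‖ ^ 2 + ‖deriv g t‖ ^ 2) := by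
      obtain ⟨s, hs, hsmin⟩ := isCompact_Icc.exists_isMinOn (Set.nonempty_Icc.2 hτ.le)
        (hgc.norm.pow 2)
      have h1 := hcon s hs
      have h2 : ∫ t in Set.Ioc 0 τ, ‖g s‖ ^ 2 ≤
          ∫ t in Set.Ioc 0 τ, (‖g t‖ ^ 2 + ‖deriv g t‖ ^ 2) := by
        refine setIntegral_mono_on (by simp) hI measurableSet_Ioc fun y hy => ?_
        have h3 : ‖g s‖ ^ 2 ≤ ‖g y‖ ^ 2 := hsmin (Set.Ioc_subset_Icc_self hy)
        nlinarith [sq_nonneg ‖deriv g y‖]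
      rw [setIntegral_const] at h2
      simp [hτ.le] at h2
      rw [div_lt_iff₀ hτ] at h1
      linarith
    linarith
  obtain ⟨s, hs, hs'⟩ := hmin
  have := hosc s hs
  have e : ε * (1 + 1 / τ) = ε + ε / τ := by ring
  linarith

lemma absolutelyContinuousOnInterval_of_contDiff {f : ℝ → ℂ} (hf : ContDiff ℝ 1 f) (a b : ℝ) :
    AbsolutelyContinuousOnInterval f a b :=
  hf.contDiffOn.absolutelyContinuousOnInterval

/-- Two periodic functions that are close over one period are close. -/
lemma norm_sub_le_of_periodic {τ ε : ℝ} (hτ : 0 < τ) {x y : ℝ → ℂ} (hx : Function.Periodic x τ)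
    (hy : Function.Periodic y τ) (h : ∀ t ∈ Set.Icc 0 τ, ‖x t - y t‖ ≤ ε) (t : ℝ) :
    ‖x t - y t‖ ≤ ε := by
  have hp : Function.Periodic (fun t => x t - y t) τ := hx.sub hy
  obtain ⟨s, hs, hst⟩ := hp.exists_mem_Ico₀ hτ t
  rw [show x t - y t = x s - y s from hst]
  exact h s (Set.Ico_subset_Icc_self hs)

/-- Elements of the loop space are limits of smooth loops, uniformly, with convergence of the
derivatives in the quadratic mean. -/
theorem exists_smoothLoops_close {m : Fin 3 → ℝ} {τ : ℝ} {k : Fin 3 → ℤ} (hτ : 0 < τ)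
    {q : Fin 3 → ℝ → ℂ} (hq : q ∈ loopSpace m τ k) {ε : ℝ} (hε : 0 < ε) :
    ∃ p ∈ smoothLoops m τ k, ∀ i, (∀ t, ‖q i t - p i t‖ ≤ ε) ∧
      ∫⁻ t in Set.Ioc 0 τ, ‖deriv (q i) t - deriv (p i) t‖ₑ ^ 2 ≤ ENNReal.ofReal ε := by
  -- The second entry makes the supremum bound κ (1 + 1/τ) at most ε²; the first controls the
  -- derivatives.
  set κ := min ε (ε ^ 2 / (1 + 1 / τ)) with hκ
  have hκ0 : 0 < κ := lt_min hε (by positivity)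
  obtain ⟨p, hp, hd⟩ := hq.2 (ENNReal.ofReal κ) (by simpa using hκ0)
  refine ⟨p, hp, fun i => ?_⟩
  have hpi : ContDiff ℝ 1 (p i) := (hp.1 i).of_le (by exact_mod_cast le_top)
  have hi : ∫⁻ t in Set.Ioc 0 τ, (‖q i t - p i t‖ₑ ^ 2 + ‖deriv (q i) t - deriv (p i) t‖ₑ ^ 2) ≤
      ENNReal.ofReal κ :=
    (Finset.single_le_sum (f := fun i => ∫⁻ t in Set.Ioc 0 τ,
      (‖q i t - p i t‖ₑ ^ 2 + ‖deriv (q i) t - deriv (p i) t‖ₑ ^ 2))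
      (fun _ _ => zero_le) (Finset.mem_univ i)).trans hd.le
  obtain ⟨hqp, hqac, -⟩ := hq.1 i
  refine ⟨norm_sub_le_of_periodic hτ hqp (hp.2.1 i) fun t ht => ?_, ?_⟩
  · have h := norm_sq_le_of_lintegral_le (g := fun t => q i t - p i t) hτ hκ0.le
      (hqac.fun_sub (absolutelyContinuousOnInterval_of_contDiff hpi 0 τ)) ?_ ht
    · have h1 : κ * (1 + 1 / τ) ≤ ε ^ 2 := by
        rw [← le_div_iff₀ (by positivity)]
        exact min_le_right _ _
      exact (pow_le_pow_iff_left₀ (norm_nonneg _) hε.le two_ne_zero).1 (h.trans h1)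
    · refine le_trans (le_of_eq (lintegral_congr_ae ?_)) hi
      rw [Filter.EventuallyEq, ae_restrict_iff' measurableSet_Ioc]
      filter_upwards [hqac.ae_differentiableAt_complex] with t h1 ht
      have ht' : t ∈ Set.uIcc 0 τ := Set.Ioc_subset_Icc_self.trans Set.Icc_subset_uIcc ht
      have := ((h1 ht').hasDerivAt.sub
        ((hpi.differentiable one_ne_zero).differentiableAt (x := t)).hasDerivAt).deriv
      change ‖q i t - p i t‖ₑ ^ 2 + ‖deriv (q i - p i) t‖ₑ ^ 2 = _
      rw [this]
  · refine le_trans ?_ (hi.trans (ENNReal.ofReal_le_ofReal (min_le_left _ _)))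
    exact lintegral_mono fun t => le_add_self

/-! ### What survives in the closure: continuity, centre of mass, index. -/

section LoopSpace

variable {m : Fin 3 → ℝ} {τ : ℝ} {k : Fin 3 → ℤ} {q : Fin 3 → ℝ → ℂ}

lemma continuous_of_mem_loopSpace (hτ : 0 < τ) (hq : q ∈ loopSpace m τ k) (i : Fin 3) :
    Continuous (q i) := by
  refine continuous_of_uniform_approx_of_continuous fun u hu => ?_
  obtain ⟨ε, hε, hεu⟩ := Metric.mem_uniformity_dist.1 hu
  obtain ⟨p, hp, hpq⟩ := exists_smoothLoops_close hτ hq (half_pos hε)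
  refine ⟨p i, (hp.1 i).continuous, fun t => hεu ?_⟩
  rw [dist_eq_norm]
  linarith [(hpq i).1 t]

lemma sum_smul_eq_zero_of_mem_loopSpace (hτ : 0 < τ) (hm : ∀ i, 0 < m i)
    (hq : q ∈ loopSpace m τ k) (t : ℝ) : ∑ i, m i • q i t = 0 := by
  have hM : 0 < ∑ i, m i := Finset.sum_pos (fun i _ => hm i) Finset.univ_nonempty
  rw [← norm_eq_zero]
  refine le_antisymm (le_of_forall_pos_le_add fun ε hε => ?_) (norm_nonneg _)
  obtain ⟨p, hp, hpq⟩ := exists_smoothLoops_close hτ hq (div_pos hε hM)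
  have h : ∑ i, m i • q i t = ∑ i, m i • (q i t - p i t) := by
    simp only [smul_sub, Finset.sum_sub_distrib, hp.2.2.1 t, sub_zero]
  rw [h, zero_add]
  calc ‖∑ i, m i • (q i t - p i t)‖ ≤ ∑ i, ‖m i • (q i t - p i t)‖ := norm_sum_le _ _
    _ ≤ ∑ i, m i * (ε / ∑ i, m i) := by
        refine Finset.sum_le_sum fun i _ => ?_
        rw [norm_smul, Real.norm_of_nonneg (hm i).le]
        exact mul_le_mul_of_nonneg_left ((hpq i).1 t) (hm i).le
    _ = ε := by rw [← Finset.sum_mul, mul_div_cancel₀ _ hM.ne']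

lemma ae_differentiableAt_of_mem_loopSpace (hq : q ∈ loopSpace m τ k) :
    ∀ᵐ t ∂(volume.restrict (Set.Ioc 0 τ)), ∀ i, DifferentiableAt ℝ (q i) t := by
  rw [ae_all_iff]
  intro i
  rw [ae_restrict_iff' measurableSet_Ioc]
  filter_upwards [(hq.1 i).2.1.ae_differentiableAt_complex] with t h ht
  exact h (Set.Ioc_subset_Icc_self.trans Set.Icc_subset_uIcc ht)

/-- Approximation of the relative position of a pair by smooth loops of index `k i`. -/
lemma exists_smooth_pair_close (hτ : 0 < τ) (hq : q ∈ loopSpace m τ k) (i : Fin 3) {ε : ℝ}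
    (hε : 0 < ε) :
    ∃ y : ℝ → ℂ, ContDiff ℝ 1 y ∧ Function.Periodic y τ ∧ HasIndex τ y (k i) ∧
      (∀ t, ‖q i t - q (i + 1) t - y t‖ ≤ ε) ∧
      ∫⁻ t in Set.Ioc 0 τ, ‖deriv (fun s => q i s - q (i + 1) s) t - deriv y t‖ₑ ^ 2 ≤
        ENNReal.ofReal ε := by
  -- The factor 1/4 absorbs |a - b|² ≤ 2 |a|² + 2 |b|² for the difference of two bodies.
  obtain ⟨p, hp, hpq⟩ := exists_smoothLoops_close hτ hq (show 0 < ε / 4 by positivity)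
  have hp1 : ∀ j, ContDiff ℝ 1 (p j) := fun j => (hp.1 j).of_le (by exact_mod_cast le_top)
  refine ⟨fun t => p i t - p (i + 1) t, (hp1 i).sub (hp1 (i + 1)), (hp.2.1 i).sub (hp.2.1 _),
    hp.2.2.2.2 i, fun t => ?_, ?_⟩
  · rw [show q i t - q (i + 1) t - (p i t - p (i + 1) t) =
      (q i t - p i t) - (q (i + 1) t - p (i + 1) t) by ring]
    linarith [norm_sub_le (q i t - p i t) (q (i + 1) t - p (i + 1) t), (hpq i).1 t,
      (hpq (i + 1)).1 t]
  · have hdm : ∀ j, Measurable fun t => ‖deriv (q j) t - deriv (p j) t‖ₑ ^ 2 := fun j =>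
      (((measurable_deriv (q j)).sub (measurable_deriv (p j))).enorm).pow_const 2
    have hle : ∫⁻ t in Set.Ioc 0 τ, ‖deriv (fun s => q i s - q (i + 1) s) t -
          deriv (fun t => p i t - p (i + 1) t) t‖ₑ ^ 2 ≤
        ∫⁻ t in Set.Ioc 0 τ, (2 * ‖deriv (q i) t - deriv (p i) t‖ₑ ^ 2 +
          2 * ‖deriv (q (i + 1)) t - deriv (p (i + 1)) t‖ₑ ^ 2) := by
      refine lintegral_mono_ae ?_
      filter_upwards [ae_differentiableAt_of_mem_loopSpace hq] with t h
      have e1 : deriv (fun s => q i s - q (i + 1) s) t = _ :=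
        ((h i).hasDerivAt.sub (h (i + 1)).hasDerivAt).deriv
      have hd : ∀ j, DifferentiableAt ℝ (p j) t := fun j =>
        ((hp1 j).differentiable one_ne_zero).differentiableAt
      have e2 : deriv (fun s => p i s - p (i + 1) s) t = _ :=
        ((hd i).hasDerivAt.sub (hd (i + 1)).hasDerivAt).deriv
      rw [e1, e2, show deriv (q i) t - deriv (q (i + 1)) t - (deriv (p i) t - deriv (p (i + 1)) t) =
        (deriv (q i) t - deriv (p i) t) - (deriv (q (i + 1)) t - deriv (p (i + 1)) t) by ring]
      generalize deriv (q i) t - deriv (p i) t = a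
      generalize deriv (q (i + 1)) t - deriv (p (i + 1)) t = b
      have : ‖a - b‖ ^ 2 ≤ 2 * ‖a‖ ^ 2 + 2 * ‖b‖ ^ 2 := by
        have := norm_sub_le a b
        nlinarith [sq_nonneg (‖a‖ - ‖b‖), norm_nonneg (a - b), norm_nonneg a, norm_nonneg b]
      have h2 := ENNReal.ofReal_le_ofReal this
      rw [ENNReal.ofReal_add (by positivity) (by positivity), ENNReal.ofReal_mul (by norm_num),
        ENNReal.ofReal_mul (by norm_num), ENNReal.ofReal_pow (norm_nonneg _),
        ENNReal.ofReal_pow (norm_nonneg _), ENNReal.ofReal_pow (norm_nonneg _), ofReal_norm,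
        ofReal_norm, ofReal_norm] at h2
      simpa using h2
    refine hle.trans ?_
    rw [lintegral_add_left ((hdm i).const_mul 2), lintegral_const_mul 2 (hdm i),
      lintegral_const_mul 2 (hdm (i + 1))]
    calc _ ≤ 2 * ENNReal.ofReal (ε / 4) + 2 * ENNReal.ofReal (ε / 4) := by
          gcongr
          · exact (hpq i).2
          · exact (hpq (i + 1)).2
      _ = ENNReal.ofReal ε := by
          rw [← two_mul, ← mul_assoc, show (2 : ℝ≥0∞) * 2 = ENNReal.ofReal 4 by norm_num,
            ← ENNReal.ofReal_mul (by norm_num)]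
          congr 1; ring

/-- The index is locally constant for the uniform distance. -/
lemma HasIndex.of_close {x y : ℝ → ℂ} {n : ℤ} (hy : HasIndex τ y n) (hx : Continuous x)
    (hyc : Continuous y) (hxp : Function.Periodic x τ) (hyp : Function.Periodic y τ)
    (h : ∀ t, ‖x t - y t‖ < ‖x t‖) : HasIndex τ x n := by
  obtain ⟨hy0, φ, hφ, hpol, hφτ⟩ := hy
  have hx0 : ∀ t, x t ≠ 0 := fun t => norm_pos_iff.1 ((norm_nonneg _).trans_lt (h t))
  -- The quotient y/x stays in the unit disc around 1, so its principal argument is continuous and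
  -- periodic. Subtracting it from an argument of y gives an argument of x with the same increment.
  have hslit : ∀ t, y t / x t ∈ Complex.slitPlane := by
    intro t
    refine Complex.ball_one_subset_slitPlane ?_
    rw [mem_ball_iff_norm, div_sub_one (hx0 t), norm_div, div_lt_one (norm_pos_iff.2 (hx0 t)),
      norm_sub_rev]
    exact h t
  refine ⟨hx0, fun t => φ t - Complex.arg (y t / x t), ?_, fun t => ?_, ?_⟩
  · refine hφ.sub (continuous_iff_continuousAt.2 fun t => ?_)
    exact ContinuousAt.comp (f := fun s => y s / x s) (Complex.continuousAt_arg (hslit t))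
      (hyc.continuousAt.div hx.continuousAt (hx0 t))
  · have h1 := hpol t
    have h2 := Complex.norm_mul_exp_arg_mul_I (y t / x t)
    have h3 : x t = y t / (y t / x t) := by
      have := hx0 t
      have := hy0 t
      field_simp
    have hn : (‖y t‖ : ℂ) ≠ 0 := by simpa using hy0 t
    have hn' : (‖x t‖ : ℂ) ≠ 0 := by simpa using hx0 t
    conv_lhs => rw [h3, ← h2, h1]
    rw [Complex.ofReal_sub, sub_mul, Complex.exp_sub, norm_div]
    rw [← h1]
    push_cast
    field_simp
    rw [mul_comm Complex.I]
    exact h1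
  · have hx1 : x τ = x 0 := by simpa using hxp 0
    have hy1 : y τ = y 0 := by simpa using hyp 0
    simp only [hx1, hy1]
    linarith

lemma hasIndex_of_mem_loopSpace (hτ : 0 < τ) (hq : q ∈ loopSpace m τ k) (i : Fin 3)
    (h0 : ∀ t, q i t ≠ q (i + 1) t) : HasIndex τ (fun t => q i t - q (i + 1) t) (k i) := by
  have hc : Continuous fun t => q i t - q (i + 1) t :=
    (continuous_of_mem_loopSpace hτ hq i).sub (continuous_of_mem_loopSpace hτ hq (i + 1))
  have hper : Function.Periodic (fun t => q i t - q (i + 1) t) τ :=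
    ((hq.1 i).1).sub (hq.1 (i + 1)).1
  obtain ⟨s, hs, hmin⟩ := isCompact_Icc.exists_isMinOn (Set.nonempty_Icc.2 hτ.le)
    hc.norm.continuousOn
  have hpos : 0 < ‖q i s - q (i + 1) s‖ := norm_pos_iff.2 (sub_ne_zero.2 (h0 s))
  -- An error of half the minimal distance is strictly smaller than |x| at every time.
  obtain ⟨y, hy, hyp, hyi, hclose, -⟩ := exists_smooth_pair_close hτ hq i (half_pos hpos)
  refine hyi.of_close hc hy.continuous hper hyp fun t => ?_
  obtain ⟨t', ht', htt⟩ := hper.exists_mem_Ico₀ hτ t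
  have h1 : ‖q i s - q (i + 1) s‖ ≤ ‖q i t' - q (i + 1) t'‖ := hmin (Set.Ico_subset_Icc_self ht')
  have h2 : q i t - q (i + 1) t = q i t' - q (i + 1) t' := htt
  have h3 := hclose t
  rw [h2] at h3 ⊢
  linarith

end LoopSpace

end ChargedThreeBody
end

noncomputable section
namespace ChargedThreeBody

/-! ### The lower bound on the loop space -/

section LowerBound

variable {m e : Fin 3 → ℝ} {τ : ℝ} {k : Fin 3 → ℤ} {q : Fin 3 → ℝ → ℂ}

/-- Young's inequality: the main term keeps a factor close to 1, while the large factor 1 + 1/η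
falls on the approximation error, which is chosen afterwards. -/
lemma half_sq_norm_le {η : ℝ} (hη : 0 < η) (a b : ℂ) :
    1 / 2 * ‖b‖ ^ 2 ≤ (1 + η) * (1 / 2 * ‖a‖ ^ 2) + (1 + 1 / η) / 2 * ‖a - b‖ ^ 2 := by
  have h1 : ‖b‖ ≤ ‖a‖ + ‖a - b‖ := by
    have := norm_sub_le a (a - b)
    rwa [sub_sub_cancel] at this
  have h2 : ‖b‖ ^ 2 ≤ (‖a‖ + ‖a - b‖) ^ 2 := pow_le_pow_left₀ (norm_nonneg _) h1 2
  have h3 : 2 * (‖a‖ * ‖a - b‖) ≤ η * ‖a‖ ^ 2 + 1 / η * ‖a - b‖ ^ 2 := by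
    have h4 : 0 ≤ 1 / η * (η * ‖a‖ - ‖a - b‖) ^ 2 := by positivity
    have h5 : 1 / η * (η * ‖a‖ - ‖a - b‖) ^ 2 =
        η * ‖a‖ ^ 2 + 1 / η * ‖a - b‖ ^ 2 - 2 * (‖a‖ * ‖a - b‖) := by
      field_simp; ring
    linarith
  nlinarith

/-- Gordon's bound passes to `W^{1,2}` limits without collision. -/
theorem gordonBound_le_pairAction_of_approx {μ : ℝ} {n : ℤ} {x : ℝ → ℂ} (hμ : 0 < μ)
    (hτ : 0 < τ) (hn : n = 1 ∨ n = -1) (hx : ContinuousOn x (Set.Icc 0 τ))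
    (h0 : ∀ t ∈ Set.Icc 0 τ, x t ≠ 0)
    (happ : ∀ ε > 0, ∃ y : ℝ → ℂ, ContDiff ℝ 1 y ∧ Function.Periodic y τ ∧ HasIndex τ y n ∧
      (∀ t, ‖x t - y t‖ ≤ ε) ∧
      ∫⁻ t in Set.Ioc 0 τ, ‖deriv x t - deriv y t‖ₑ ^ 2 ≤ ENNReal.ofReal ε) :
    ENNReal.ofReal (gordonBound μ τ) ≤ pairAction μ τ x := by
  by_cases htop : pairAction μ τ x = ⊤
  · rw [htop]; exact le_top
  obtain ⟨s, hs, hmin⟩ := isCompact_Icc.exists_isMinOn (Set.nonempty_Icc.2 hτ.le) hx.norm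
  have hc : 0 < ‖x s‖ := norm_pos_iff.2 (h0 s hs)
  have key : ∀ η > 0, ENNReal.ofReal (gordonBound μ τ) ≤
      ENNReal.ofReal (1 + η) * pairAction μ τ x + ENNReal.ofReal η := by
    intro η hη
    have hη1 : 0 < 1 + η := by linarith
    set C := (1 + 1 / η) / 2 with hC
    have hC0 : 0 < C := by positivity
    -- The first entry makes the error in the derivatives cost at most η; the second gives |x| ≤ (1
    -- + η) |y|, which compares the potentials.
    set ε := min (η / C) (‖x s‖ * (η / (1 + η))) with hε
    have hε0 : 0 < ε := lt_min (by positivity) (by positivity)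
    obtain ⟨y, hy, hyp, hyi, hclose, hder⟩ := happ ε hε0
    have hyd : ∀ t, HasDerivAt y (deriv y t) t := fun t =>
      ((hy.differentiable one_ne_zero).differentiableAt).hasDerivAt
    have hyc : Continuous (deriv y) := hy.continuous_deriv le_rfl
    have h1 := gordonBound_le_integral hμ hτ hn hyd hyc hyp hyi
    have h2 : ENNReal.ofReal (gordonBound μ τ) ≤ pairAction μ τ y := by
      rw [pairAction_eq_ofReal hμ hτ hyd hyc hyi.1]
      exact ENNReal.ofReal_le_ofReal h1
    refine h2.trans ?_
    have hpt : ∀ t ∈ Set.Ioc 0 τ,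
        ENNReal.ofReal (1 / 2 * ‖deriv y t‖ ^ 2) + ENNReal.ofReal μ / ‖y t‖ₑ ≤
        ENNReal.ofReal (1 + η) *
          (ENNReal.ofReal (1 / 2 * ‖deriv x t‖ ^ 2) + ENNReal.ofReal μ / ‖x t‖ₑ) +
        ENNReal.ofReal C * ‖deriv x t - deriv y t‖ₑ ^ 2 := by
      intro t ht
      have ht' := Set.Ioc_subset_Icc_self ht
      have hxt : 0 < ‖x t‖ := norm_pos_iff.2 (h0 t ht')
      have hyt : 0 < ‖y t‖ := norm_pos_iff.2 (hyi.1 t)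
      rw [ofReal_div_enorm μ (h0 t ht'), ofReal_div_enorm μ (hyi.1 t), ← ofReal_norm,
        ← ENNReal.ofReal_pow (norm_nonneg _), ← ENNReal.ofReal_add (by positivity) (by positivity),
        ← ENNReal.ofReal_add (by positivity) (by positivity), ← ENNReal.ofReal_mul hη1.le,
        ← ENNReal.ofReal_mul hC0.le, ← ENNReal.ofReal_add (by positivity) (by positivity)]
      refine ENNReal.ofReal_le_ofReal ?_
      have k1 := half_sq_norm_le hη (deriv x t) (deriv y t)
      rw [← hC] at k1
      have k2 : μ / ‖y t‖ ≤ (1 + η) * (μ / ‖x t‖) := by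
        rw [div_le_iff₀ hyt, mul_div_assoc', div_mul_eq_mul_div, le_div_iff₀ hxt]
        have k3 : ‖x t‖ - ‖y t‖ ≤ ε := (norm_sub_norm_le _ _).trans (hclose t)
        have k4 : ε ≤ ‖x t‖ * (η / (1 + η)) :=
          (min_le_right _ _).trans (mul_le_mul_of_nonneg_right (hmin ht') (by positivity))
        have k5 : ‖x t‖ * (η / (1 + η)) * (1 + η) = ‖x t‖ * η := by field_simp
        have k6 : ‖x t‖ ≤ (1 + η) * ‖y t‖ := by nlinarith
        nlinarith
      linarith
    have hI : pairAction μ τ y ≤ ∫⁻ t in Set.Ioc 0 τ, (ENNReal.ofReal (1 + η) *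
          (ENNReal.ofReal (1 / 2 * ‖deriv x t‖ ^ 2) + ENNReal.ofReal μ / ‖x t‖ₑ) +
        ENNReal.ofReal C * ‖deriv x t - deriv y t‖ₑ ^ 2) :=
      setLIntegral_mono' measurableSet_Ioc hpt
    refine hI.trans ?_
    have hdm : Measurable fun t => ‖deriv x t - deriv y t‖ₑ ^ 2 :=
      (((measurable_deriv x).sub (measurable_deriv y)).enorm).pow_const 2
    rw [lintegral_add_right _ (hdm.const_mul _), lintegral_const_mul' _ _ ENNReal.ofReal_ne_top,
      lintegral_const_mul _ hdm]
    refine add_le_add le_rfl ?_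
    calc ENNReal.ofReal C * _ ≤ ENNReal.ofReal C * ENNReal.ofReal ε := by gcongr
      _ ≤ ENNReal.ofReal C * ENNReal.ofReal (η / C) := by
        gcongr
        exact min_le_left _ _
      _ = ENNReal.ofReal η := by
        rw [← ENNReal.ofReal_mul hC0.le, mul_div_cancel₀ _ hC0.ne']
  obtain ⟨A, hA⟩ : ∃ A : ℝ, A = (pairAction μ τ x).toReal := ⟨_, rfl⟩
  have hA0 : 0 ≤ A := hA ▸ ENNReal.toReal_nonneg
  have hAe : pairAction μ τ x = ENNReal.ofReal A := by rw [hA, ENNReal.ofReal_toReal htop]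
  rw [hAe] at key ⊢
  refine ENNReal.ofReal_le_ofReal (le_of_forall_pos_le_add fun δ hδ => ?_)
  -- With this η the total error η A + η is exactly δ.
  have h := key (δ / (A + 1)) (by positivity)
  rw [← ENNReal.ofReal_mul (by positivity), ← ENNReal.ofReal_add (by positivity) (by positivity),
    ENNReal.ofReal_le_ofReal_iff (by positivity)] at h
  calc gordonBound μ τ ≤ _ := h
    _ = A + δ := by field_simp; ring

theorem gordonBound_le_pairAction {μ : ℝ} (hμ : 0 < μ) (hτ : 0 < τ)
    (hq : q ∈ loopSpace m τ k) (i : Fin 3) (hk : k i = 1 ∨ k i = -1) :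
    ENNReal.ofReal (gordonBound μ τ) ≤ pairAction μ τ (fun t => q i t - q (i + 1) t) := by
  have hc : Continuous fun t => q i t - q (i + 1) t :=
    (continuous_of_mem_loopSpace hτ hq i).sub (continuous_of_mem_loopSpace hτ hq (i + 1))
  have hper : Function.Periodic (fun t => q i t - q (i + 1) t) τ :=
    ((hq.1 i).1).sub (hq.1 (i + 1)).1
  by_cases hcol : ∃ t ∈ Set.Icc 0 τ, q i t - q (i + 1) t = 0
  · obtain ⟨t, ht, h⟩ := hcol
    exact gordonBound_le_pairAction_of_collision hμ hτ
      ((hq.1 i).2.1.fun_sub (hq.1 (i + 1)).2.1) (by simpa using (hper 0).symm) ht h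
  · push Not at hcol
    exact gordonBound_le_pairAction_of_approx hμ hτ hk hc.continuousOn hcol
      fun ε hε => exists_smooth_pair_close hτ hq i hε

/-- Lagrange's identity: M times the left side equals the sum of m_i m_j |v_i - v_j|² over pairs
plus |∑ m_i v_i|², and the last term is 0. -/
lemma sum_mul_norm_sq_eq (hM : ∑ i, m i ≠ 0) {v : Fin 3 → ℂ} (hv : ∑ i, m i • v i = 0) :
    ∑ i, m i * ‖v i‖ ^ 2 = ∑ i : Fin 3, m i * m (i + 1) / (∑ j, m j) * ‖v i - v (i + 1)‖ ^ 2 := by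
  have h1 := congrArg Complex.re hv
  have h2 := congrArg Complex.im hv
  simp only [Fin.sum_univ_three, Complex.add_re, Complex.add_im, Complex.real_smul,
    Complex.re_ofReal_mul, Complex.im_ofReal_mul, Complex.zero_re, Complex.zero_im] at h1 h2 hM ⊢
  simp only [Complex.sq_norm, Complex.normSq_apply, Complex.sub_re, Complex.sub_im,
    show (0 : Fin 3) + 1 = 1 from rfl, show (1 : Fin 3) + 1 = 2 from rfl,
    show (2 : Fin 3) + 1 = 0 from rfl]
  field_simp
  linear_combination (m 0 * (v 0).re + m 1 * (v 1).re + m 2 * (v 2).re) * h1 +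
    (m 0 * (v 0).im + m 1 * (v 1).im + m 2 * (v 2).im) * h2

/-- The action is a weighted sum of Kepler actions of the pairs. -/
theorem action_eq_sum_pairAction (hm : ∀ i, 0 < m i) (hτ : 0 < τ)
    (hδ : ∀ i j, i ≠ j → 0 < delta m e i j) (hq : q ∈ loopSpace m τ k) :
    action m e τ q = ∑ i : Fin 3, ENNReal.ofReal (m i * m (i + 1) / ∑ j, m j) *
      pairAction ((∑ j, m j) * delta m e i (i + 1)) τ (fun t => q i t - q (i + 1) t) := by
  have hM : 0 < ∑ i, m i := Finset.sum_pos (fun i _ => hm i) Finset.univ_nonempty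
  have hδi : ∀ i : Fin 3, 0 < delta m e i (i + 1) := fun i => hδ i _ (by fin_cases i <;> decide)
  have hcm : ∀ i : Fin 3, Measurable fun t => q i t - q (i + 1) t := fun i =>
    ((continuous_of_mem_loopSpace hτ hq i).sub
      (continuous_of_mem_loopSpace hτ hq (i + 1))).measurable
  simp only [pairAction]
  have hmeas : ∀ i : Fin 3, Measurable fun t =>
      ENNReal.ofReal (1 / 2 * ‖deriv (fun t => q i t - q (i + 1) t) t‖ ^ 2) +
        ENNReal.ofReal ((∑ j, m j) * delta m e i (i + 1)) / ‖q i t - q (i + 1) t‖ₑ := fun i =>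
    (((measurable_deriv _).norm.pow_const 2).const_mul _).ennreal_ofReal.add
      ((hcm i).enorm.const_div _)
  simp only [← lintegral_const_mul _ (hmeas _)]
  rw [← lintegral_finsetSum _ fun i _ => (hmeas i).const_mul _]
  refine lintegral_congr_ae ?_
  filter_upwards [ae_differentiableAt_of_mem_loopSpace hq] with t h
  have hder : ∀ i : Fin 3, deriv (fun t => q i t - q (i + 1) t) t =
      deriv (q i) t - deriv (q (i + 1)) t := fun i =>
    ((h i).hasDerivAt.sub (h (i + 1)).hasDerivAt).deriv
  have hv : ∑ i, m i • deriv (q i) t = 0 := by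
    have h1 : HasDerivAt (fun t => ∑ i, m i • q i t) (∑ i, m i • deriv (q i) t) t :=
      HasDerivAt.fun_sum fun i _ => (h i).hasDerivAt.const_smul (m i)
    rw [funext fun t => sum_smul_eq_zero_of_mem_loopSpace hτ hm hq t] at h1
    exact h1.unique (hasDerivAt_const t 0)
  simp only [hder]
  rw [sum_mul_norm_sq_eq hM.ne' hv]
  have hc : ∀ i : Fin 3, 0 < m i * m (i + 1) / ∑ j, m j := fun i =>
    div_pos (mul_pos (hm _) (hm _)) hM
  rw [Finset.mul_sum, ENNReal.ofReal_sum_of_nonneg fun i _ => by have := (hc i).le; positivity,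
    ← Finset.sum_add_distrib]
  refine Finset.sum_congr rfl fun i _ => ?_
  rw [mul_add, ← ENNReal.ofReal_mul (hc i).le, ← mul_div_assoc, ← ENNReal.ofReal_mul (hc i).le]
  congr 1
  · congr 1; ring
  · congr 2; field_simp

/-- The value of the infimum. -/
def minimalAction (m e : Fin 3 → ℝ) (τ : ℝ) : ℝ :=
  ∑ i : Fin 3, m i * m (i + 1) / (∑ j, m j) *
    gordonBound ((∑ j, m j) * delta m e i (i + 1)) τ

lemma minimalAction_eq (hm : ∀ i, 0 < m i) (hτ : 0 < τ)
    (hδ : ∀ i j, i ≠ j → 0 < delta m e i j) :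
    minimalAction m e τ = (∑ i, m i) ^ (-(1 / 3) : ℝ) *
        ((∑ i : Fin 3, m i * m (i + 1) * delta m e i (i + 1) ^ (2 / 3 : ℝ)) *
          (3 * (2 : ℝ) ^ (-(1 / 3) : ℝ) * Real.pi ^ (2 / 3 : ℝ) * τ ^ (1 / 3 : ℝ))) := by
  have hM : 0 < ∑ i, m i := Finset.sum_pos (fun i _ => hm i) Finset.univ_nonempty
  have hδi : ∀ i : Fin 3, 0 < delta m e i (i + 1) := fun i => hδ i _ (by fin_cases i <;> decide)
  unfold minimalAction
  set M := ∑ i, m i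
  rw [Finset.sum_mul, Finset.mul_sum]
  refine Finset.sum_congr rfl fun i _ => ?_
  have hd := hδi i
  generalize delta m e i (i + 1) = d at hd ⊢
  have hpi := Real.pi_pos
  have key : gordonBound (M * d) τ = M ^ (2 / 3 : ℝ) * d ^ (2 / 3 : ℝ) *
      (3 * (2 : ℝ) ^ (-(1 / 3) : ℝ) * Real.pi ^ (2 / 3 : ℝ) * τ ^ (1 / 3 : ℝ)) := by
    -- Comparing cubes removes every fractional exponent.
    refine (pow_left_inj₀ (gordonBound_pos (by positivity) hτ).le (by positivity)
      (three_ne_zero)).1 ?_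
    have cube : ∀ {a : ℝ} (b : ℝ), 0 < a → (a ^ b) ^ 3 = a ^ (b * 3) := fun b ha => by
      rw [← Real.rpow_natCast, ← Real.rpow_mul ha.le]; norm_num
    simp only [gordonBound, mul_pow]
    rw [cube _ (by positivity : 0 < 4 * Real.pi ^ 2 * τ / (M * d)), cube _ hM, cube _ hd,
      cube _ (by norm_num : (0 : ℝ) < 2), cube _ hpi, cube _ hτ]
    norm_num [Real.rpow_neg_one]
    field_simp
    norm_num
  rw [key]
  have e1 : M ^ (2 / 3 : ℝ) = M * M ^ (-(1 / 3) : ℝ) := by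
    nth_rewrite 2 [← Real.rpow_one M]
    rw [← Real.rpow_add hM]; norm_num
  rw [e1]
  field_simp

theorem ofReal_minimalAction (hm : ∀ i, 0 < m i) (hτ : 0 < τ)
    (hδ : ∀ i j, i ≠ j → 0 < delta m e i j) :
    ENNReal.ofReal (minimalAction m e τ) =
      ∑ i : Fin 3, ENNReal.ofReal (m i * m (i + 1) / ∑ j, m j) *
        ENNReal.ofReal (gordonBound ((∑ j, m j) * delta m e i (i + 1)) τ) := by
  have hM : 0 < ∑ i, m i := Finset.sum_pos (fun i _ => hm i) Finset.univ_nonempty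
  have hc : ∀ i : Fin 3, 0 ≤ m i * m (i + 1) / ∑ j, m j := fun i =>
    (div_pos (mul_pos (hm _) (hm _)) hM).le
  have hδi : ∀ i : Fin 3, 0 < delta m e i (i + 1) := fun i => hδ i _ (by fin_cases i <;> decide)
  rw [minimalAction, ENNReal.ofReal_sum_of_nonneg fun i _ => mul_nonneg (hc i)
    (gordonBound_pos (mul_pos hM (hδi i)) hτ).le]
  exact Finset.sum_congr rfl fun i _ => ENNReal.ofReal_mul (hc i)

theorem minimalAction_le_action (hm : ∀ i, 0 < m i) (hτ : 0 < τ)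
    (hk : ∀ i, k i = 1 ∨ k i = -1)
    (hδ : ∀ i j, i ≠ j → 0 < delta m e i j) (hq : q ∈ loopSpace m τ k) :
    ENNReal.ofReal (minimalAction m e τ) ≤ action m e τ q := by
  have hM : 0 < ∑ i, m i := Finset.sum_pos (fun i _ => hm i) Finset.univ_nonempty
  have hδi : ∀ i : Fin 3, 0 < delta m e i (i + 1) := fun i => hδ i _ (by fin_cases i <;> decide)
  rw [action_eq_sum_pairAction hm hτ hδ hq, ofReal_minimalAction hm hτ hδ]
  gcongr with i
  exact gordonBound_le_pairAction (mul_pos hM (hδi i)) hτ hq i (hk i)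

/-- In a loop attaining the bound every pair attains Gordon's bound. -/
theorem pairAction_eq_of_action_eq (hm : ∀ i, 0 < m i) (hτ : 0 < τ)
    (hk : ∀ i, k i = 1 ∨ k i = -1)
    (hδ : ∀ i j, i ≠ j → 0 < delta m e i j) (hq : q ∈ loopSpace m τ k)
    (h : action m e τ q ≤ ENNReal.ofReal (minimalAction m e τ)) (i : Fin 3) :
    pairAction ((∑ j, m j) * delta m e i (i + 1)) τ (fun t => q i t - q (i + 1) t) =
      ENNReal.ofReal (gordonBound ((∑ j, m j) * delta m e i (i + 1)) τ) := by
  have hM : 0 < ∑ i, m i := Finset.sum_pos (fun i _ => hm i) Finset.univ_nonempty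
  have hδi : ∀ i : Fin 3, 0 < delta m e i (i + 1) := fun i => hδ i _ (by fin_cases i <;> decide)
  have hle : ∀ i, _ := fun i =>
    gordonBound_le_pairAction (mul_pos hM (hδi i)) hτ hq i (hk i)
  refine le_antisymm ?_ (hle i)
  by_contra! hlt
  rw [action_eq_sum_pairAction hm hτ hδ hq, ofReal_minimalAction hm hτ hδ] at h
  refine absurd h (not_le.2 ?_)
  rw [← Finset.add_sum_erase _ _ (Finset.mem_univ i),
    ← Finset.add_sum_erase _ (fun i => ENNReal.ofReal (m i * m (i + 1) / ∑ j, m j) *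
      pairAction ((∑ j, m j) * delta m e i (i + 1)) τ _) (Finset.mem_univ i)]
  -- A strict inequality for one pair makes the sum strict, because the Gordon bounds of the other
  -- pairs are finite.
  refine ENNReal.add_lt_add_of_lt_of_le
    (ENNReal.sum_ne_top.2 fun j _ => ENNReal.mul_ne_top ENNReal.ofReal_ne_top
      ENNReal.ofReal_ne_top) ?_
    (Finset.sum_le_sum fun j _ => mul_le_mul_of_nonneg_left (hle j) zero_le)
  refine (ENNReal.mul_lt_mul_iff_right ?_ ENNReal.ofReal_ne_top).2 hlt
  simpa using div_pos (mul_pos (hm i) (hm (i + 1))) hM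

end LowerBound

end ChargedThreeBody
end

noncomputable section
namespace ChargedThreeBody

/-! ### Triangular central configurations -/

section Central

variable {m e : Fin 3 → ℝ} {a : Fin 3 → ℂ}

lemma delta_comm (m e : Fin 3 → ℝ) (i j : Fin 3) : delta m e i j = delta m e j i := by
  simp only [delta, mul_comm]

/-- The coefficient of `a_i - a_{i+1}` in the force. -/
def pairForce (m e : Fin 3 → ℝ) (a : Fin 3 → ℂ) (i : Fin 3) : ℝ :=
  m i * m (i + 1) * delta m e i (i + 1) / ‖a i - a (i + 1)‖ ^ 3

lemma force_eq (m e : Fin 3 → ℝ) (a : Fin 3 → ℂ) (i : Fin 3) :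
    force m e a i = (pairForce m e a i : ℂ) * (a (i + 1) - a i) +
      (pairForce m e a (i + 2) : ℂ) * (a (i + 2) - a i) := by
  have h : (Finset.univ.erase i : Finset (Fin 3)) = {i + 1, i + 2} := by
    revert i; decide
  have hne : i + 1 ≠ i + 2 := by revert i; decide
  have h3 : i + 2 + 1 = i := by revert i; decide
  rw [force, h, Finset.sum_pair hne]
  simp only [pairForce, h3, Complex.real_smul]
  rw [delta_comm m e (i + 2) i, norm_sub_rev (a (i + 2)) (a i), mul_comm (m (i + 2)) (m i)]

lemma sum_force (m e : Fin 3 → ℝ) (a : Fin 3 → ℂ) : ∑ i, force m e a i = 0 := by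
  simp only [force_eq, Fin.sum_univ_three, show (0 : Fin 3) + 1 = 1 from rfl,
    show (1 : Fin 3) + 1 = 2 from rfl, show (2 : Fin 3) + 1 = 0 from rfl,
    show (0 : Fin 3) + 2 = 2 from rfl, show (1 : Fin 3) + 2 = 0 from rfl,
    show (2 : Fin 3) + 2 = 1 from rfl]
  ring

/-- The real part is Euler's identity for U, homogeneous of degree -1; the imaginary part says that
the total torque vanishes. -/
lemma sum_conj_mul_force (m e : Fin 3 → ℝ) (h : ∀ i, a i ≠ a (i + 1)) :
    ∑ i, (starRingEnd ℂ (a i) * force m e a i) = -(forceFunction m e a : ℂ) := by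
  have key : ∀ i, m i * m (i + 1) * delta m e i (i + 1) / ‖a i - a (i + 1)‖ =
      pairForce m e a i * ‖a i - a (i + 1)‖ ^ 2 := fun i => by
    have : ‖a i - a (i + 1)‖ ≠ 0 := norm_ne_zero_iff.2 (sub_ne_zero.2 (h i))
    rw [pairForce]
    field_simp
  have hn : ∀ z : ℂ, ((‖z‖ ^ 2 : ℝ) : ℂ) = z * starRingEnd ℂ z := fun z => by
    rw [Complex.mul_conj, Complex.normSq_eq_norm_sq]
  simp only [forceFunction, key, Complex.ofReal_sum, Complex.ofReal_mul, hn]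
  simp only [force_eq, Fin.sum_univ_three, show (0 : Fin 3) + 1 = 1 from rfl,
    show (1 : Fin 3) + 1 = 2 from rfl, show (2 : Fin 3) + 1 = 0 from rfl,
    show (0 : Fin 3) + 2 = 2 from rfl, show (1 : Fin 3) + 2 = 0 from rfl,
    show (2 : Fin 3) + 2 = 1 from rfl, map_sub]
  ring

/-- The oriented area of the triangle `a` (doubled). -/
def area (a : Fin 3 → ℂ) : ℝ := (starRingEnd ℂ (a 0 - a 1) * (a 1 - a 2)).im

lemma collinear_of_area_eq_zero (h01 : a 0 ≠ a 1) (h : area a = 0) :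
    Collinear ℝ (Set.range a) := by
  rw [collinear_iff_of_mem (Set.mem_range_self 1)]
  refine ⟨a 0 - a 1, ?_⟩
  rintro _ ⟨i, rfl⟩
  have hd : a 0 - a 1 ≠ 0 := sub_ne_zero.2 h01
  have hc : starRingEnd ℂ (a 0 - a 1) ≠ 0 := (map_ne_zero _).2 hd
  fin_cases i
  · exact ⟨1, by simp⟩
  · exact ⟨0, by simp⟩
  · refine ⟨-(starRingEnd ℂ (a 0 - a 1) * (a 1 - a 2)).re / ‖a 0 - a 1‖ ^ 2, ?_⟩
    have hre : starRingEnd ℂ (a 0 - a 1) * (a 1 - a 2) =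
        ((starRingEnd ℂ (a 0 - a 1) * (a 1 - a 2)).re : ℂ) := by
      apply Complex.ext
      · simp
      · rw [Complex.ofReal_im]; exact h
    have hn : ((‖a 0 - a 1‖ ^ 2 : ℝ) : ℂ) = (a 0 - a 1) * starRingEnd ℂ (a 0 - a 1) := by
      rw [Complex.mul_conj, Complex.normSq_eq_norm_sq]
    simp only [vadd_eq_add, Complex.real_smul, Complex.ofReal_div, Complex.ofReal_neg, ← hre, hn]
    change a 2 = _
    field_simp
    ring

lemma not_collinear_of_area_ne_zero (h : area a ≠ 0) : ¬ Collinear ℝ (Set.range a) := by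
  intro hc
  rw [collinear_iff_of_mem (Set.mem_range_self 1)] at hc
  obtain ⟨v, hv⟩ := hc
  obtain ⟨r, hr⟩ := hv _ (Set.mem_range_self 0)
  obtain ⟨s, hs⟩ := hv _ (Set.mem_range_self 2)
  apply h
  rw [vadd_eq_add, Complex.real_smul] at hr hs
  rw [area, hr, hs]
  simp
  ring

lemma eq_of_smul_add_smul_eq {u v : ℂ} (huv : (starRingEnd ℂ u * v).im ≠ 0) {p q p' q' : ℝ}
    (h : (p : ℂ) * u + (q : ℂ) * v = p' * u + q' * v) : p = p' ∧ q = q' := by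
  have hre := congrArg Complex.re h
  have him := congrArg Complex.im h
  simp only [Complex.add_re, Complex.add_im, Complex.re_ofReal_mul, Complex.im_ofReal_mul] at hre him
  simp only [Complex.mul_im, Complex.conj_re, Complex.conj_im] at huv
  constructor
  · refine sub_eq_zero.1 ((mul_eq_zero.1 (?_ : (p - p') * (u.re * v.im + -u.im * v.re) = 0)).resolve_right huv)
    linear_combination v.im * hre - v.re * him
  · refine sub_eq_zero.1 ((mul_eq_zero.1 (?_ : (q - q') * (u.re * v.im + -u.im * v.re) = 0)).resolve_right huv)
    linear_combination u.re * him - u.im * hre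

lemma forceFunction_pos (hm : ∀ i, 0 < m i) (hδ : ∀ i j, i ≠ j → 0 < delta m e i j)
    (h : ∀ i, a i ≠ a (i + 1)) : 0 < forceFunction m e a := by
  refine Finset.sum_pos (fun i _ => div_pos (mul_pos (mul_pos (hm _) (hm _)) (hδ _ _ ?_))
    (norm_pos_iff.2 (sub_ne_zero.2 (h i)))) Finset.univ_nonempty
  fin_cases i <;> decide

/-- The multiplier of a normalized central configuration is `U(a)`. -/
lemma multiplier_eq_forceFunction {l : ℝ} (h : ∀ i, a i ≠ a (i + 1))
    (hc : ∀ i, (l * m i) • a i + force m e a i = 0) (hn : ∑ i, m i * ‖a i‖ ^ 2 = 1) :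
    l = forceFunction m e a := by
  have h1 : ∑ i, starRingEnd ℂ (a i) * ((l * m i) • a i + force m e a i) = 0 :=
    Finset.sum_eq_zero fun i _ => by rw [hc i, mul_zero]
  simp only [mul_add, Finset.sum_add_distrib] at h1
  rw [sum_conj_mul_force m e h] at h1
  have h2 : ∑ i, starRingEnd ℂ (a i) * (l * m i) • a i = (l : ℂ) := by
    have : ∀ i, starRingEnd ℂ (a i) * (l * m i) • a i = ((l * (m i * ‖a i‖ ^ 2) : ℝ) : ℂ) := by
      intro i
      have hn : ((‖a i‖ ^ 2 : ℝ) : ℂ) = a i * starRingEnd ℂ (a i) := by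
        rw [Complex.mul_conj, Complex.normSq_eq_norm_sq]
      rw [Complex.ofReal_mul, Complex.ofReal_mul, hn, Complex.real_smul]
      push_cast; ring
    simp only [this]
    rw [← Complex.ofReal_sum, ← Finset.mul_sum, hn, mul_one]
  rw [h2, ← sub_eq_add_neg, sub_eq_zero] at h1
  exact_mod_cast h1

/-- The sides of a normalized non-collinear central configuration. -/
theorem sides_of_central (hm : ∀ i, 0 < m i) (hδ : ∀ i j, i ≠ j → 0 < delta m e i j)
    (hc : IsCentralConfiguration m e a) (hcol : ¬ Collinear ℝ (Set.range a))
    (hn : ∑ i, m i * ‖a i‖ ^ 2 = 1) :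
    (∀ i, (forceFunction m e a * m i) • a i + force m e a i = 0) ∧ (∑ i, m i • a i = 0) ∧
      ∀ i, forceFunction m e a * ‖a i - a (i + 1)‖ ^ 3 = (∑ j, m j) * delta m e i (i + 1) := by
  obtain ⟨hne, l, hl⟩ := hc
  have hne' : ∀ i, a i ≠ a (i + 1) := fun i => hne _ _ (by fin_cases i <;> decide)
  obtain rfl := multiplier_eq_forceFunction hne' hl hn
  have hU := forceFunction_pos hm hδ hne'
  set U := forceFunction m e a
  have hsum : ∑ i, m i • a i = 0 := by
    have h1 : ∑ i, ((U * m i) • a i + force m e a i) = 0 :=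
      Finset.sum_eq_zero fun i _ => hl i
    rw [Finset.sum_add_distrib, sum_force, add_zero] at h1
    simp only [mul_smul] at h1
    rw [← Finset.smul_sum] at h1
    exact (smul_eq_zero.1 h1).resolve_left hU.ne'
  refine ⟨hl, hsum, ?_⟩
  have hM : 0 < ∑ i, m i := Finset.sum_pos (fun i _ => hm i) Finset.univ_nonempty
  have harea : area a ≠ 0 := fun h => hcol (collinear_of_area_eq_zero (hne 0 1 (by decide)) h)
  -- The vectors a_{i+1} - a_i and a_{i+2} - a_i form a real basis. The centre of mass condition
  -- gives a_i the coordinates -m_{i+1}/M and -m_{i+2}/M, so the central equation determines the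
  -- force coefficients, and through them the sides.
  have hpf : ∀ i, pairForce m e a i = U * m i * m (i + 1) / ∑ j, m j := by
    intro i
    have h0 := hl i
    rw [force_eq] at h0
    have hsum' : m i • a i + m (i + 1) • a (i + 1) + m (i + 2) • a (i + 2) = 0 := by
      rw [← hsum, Fin.sum_univ_three]
      fin_cases i
      · rfl
      · simp only [show (1 : Fin 3) + 1 = 2 from rfl, show (1 : Fin 3) + 2 = 0 from rfl,
          Fin.mk_one, Fin.isValue]; abel
      · simp only [show (2 : Fin 3) + 1 = 0 from rfl, show (2 : Fin 3) + 2 = 1 from rfl,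
          Fin.reduceFinMk, Fin.isValue]; abel
    have hMsum : ∑ j, m j = m i + m (i + 1) + m (i + 2) := by
      rw [Fin.sum_univ_three]
      fin_cases i
      · rfl
      · simp only [show (1 : Fin 3) + 1 = 2 from rfl, show (1 : Fin 3) + 2 = 0 from rfl,
          Fin.mk_one, Fin.isValue]; ring
      · simp only [show (2 : Fin 3) + 1 = 0 from rfl, show (2 : Fin 3) + 2 = 1 from rfl,
          Fin.reduceFinMk, Fin.isValue]; ring
    have him : (starRingEnd ℂ (a (i + 1) - a i) * (a (i + 2) - a i)).im ≠ 0 := by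
      have : (starRingEnd ℂ (a (i + 1) - a i) * (a (i + 2) - a i)).im = area a := by
        unfold area
        fin_cases i
        · simp; ring
        · simp [show (1 : Fin 3) + 1 = 2 from rfl, show (1 : Fin 3) + 2 = 0 from rfl]; ring
        · simp [show (2 : Fin 3) + 1 = 0 from rfl, show (2 : Fin 3) + 2 = 1 from rfl]; ring
      rwa [this]
    refine (eq_of_smul_add_smul_eq him (q := pairForce m e a (i + 2))
      (q' := U * m i * m (i + 2) / ∑ j, m j) ?_).1
    have hMC : ((∑ j, m j : ℝ) : ℂ) ≠ 0 := Complex.ofReal_ne_zero.2 hM.ne'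
    have h3 : (U * m i / ((∑ j, m j : ℝ) : ℂ)) *
        (m i * a i + m (i + 1) * a (i + 1) + m (i + 2) * a (i + 2)) = 0 := by
      simp only [Complex.real_smul] at hsum'
      rw [hsum', mul_zero]
    rw [Complex.real_smul] at h0
    push_cast at h0 h3 ⊢
    push_cast at hMC
    have hMC' : (∑ j, (m j : ℂ)) = m i + m (i + 1) + m (i + 2) := by
      exact_mod_cast congrArg (fun x : ℝ => (x : ℂ)) hMsum
    rw [hMC'] at hMC h3 ⊢
    field_simp at h3 ⊢
    linear_combination (m i + m (i + 1) + m (i + 2) : ℂ) * h0 - h3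
  intro i
  have h1 := hpf i
  rw [pairForce] at h1
  have hs : 0 < ‖a i - a (i + 1)‖ := norm_pos_iff.2 (sub_ne_zero.2 (hne' i))
  have h2 := hm i
  have h3 := hm (i + 1)
  field_simp at h1
  linarith

/-- A triangle whose sides are proportional to `δ_ij^{1/3}` is a central configuration. -/
theorem central_of_sides (hm : ∀ i, 0 < m i) {κ : ℝ} (hsum : ∑ i, m i • a i = 0)
    (hside : ∀ i, κ * ‖a i - a (i + 1)‖ ^ 3 = (∑ j, m j) * delta m e i (i + 1))
    (hne : ∀ i, a i ≠ a (i + 1)) (i : Fin 3) : (κ * m i) • a i + force m e a i = 0 := by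
  have hM : 0 < ∑ i, m i := Finset.sum_pos (fun i _ => hm i) Finset.univ_nonempty
  have hpf : ∀ i, pairForce m e a i = κ / (∑ j, m j) * m i * m (i + 1) := by
    intro i
    have hs : 0 < ‖a i - a (i + 1)‖ := norm_pos_iff.2 (sub_ne_zero.2 (hne i))
    have := hside i
    rw [pairForce]
    field_simp
    linear_combination -(m i * m (i + 1)) * this
  have hMC : (m 0 + m 1 + m 2 : ℂ) ≠ 0 := by
    rw [Fin.sum_univ_three] at hM
    exact_mod_cast hM.ne'
  rw [force_eq, hpf, hpf, Complex.real_smul]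
  simp only [Fin.sum_univ_three, Complex.real_smul] at hsum ⊢
  push_cast
  fin_cases i <;> simp [show (1 : Fin 3) + 1 = 2 from rfl, show (2 : Fin 3) + 1 = 0 from rfl,
    show (1 : Fin 3) + 2 = 0 from rfl, show (2 : Fin 3) + 2 = 1 from rfl] <;> field_simp
  · linear_combination (κ * m 0 : ℂ) * hsum
  · linear_combination (κ * m 1 : ℂ) * hsum
  · linear_combination (κ * m 2 : ℂ) * hsum

/-- The force is homogeneous of degree -2 and commutes with rotations; multiplication by z does both
at once. -/
lemma force_mul (m e : Fin 3 → ℝ) (a : Fin 3 → ℂ) (z : ℂ) (i : Fin 3) :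
    force m e (fun j => z * a j) i = ((1 / ‖z‖ ^ 3 : ℝ) : ℂ) * z * force m e a i := by
  have hp : ∀ i, pairForce m e (fun j => z * a j) i = 1 / ‖z‖ ^ 3 * pairForce m e a i := by
    intro i
    simp only [pairForce, ← mul_sub, norm_mul, mul_pow]
    rw [mul_comm (‖z‖ ^ 3), ← div_div]; ring
  simp only [force_eq, hp]
  push_cast
  ring

/-- Homographic solutions. -/
theorem isSolution_of_central {μ : ℝ} (hne : ∀ i j, i ≠ j → a i ≠ a j)
    (hc : ∀ i, (μ * m i) • a i + force m e a i = 0) {z w : ℝ → ℂ} (hz0 : ∀ t, z t ≠ 0)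
    (hz : ∀ t, HasDerivAt z (w t) t) (hw : ∀ t, HasDerivAt w ((-μ / ‖z t‖ ^ 3 : ℝ) • z t) t) :
    IsSolution m e (fun i t => z t * a i) := by
  refine ⟨fun t i j hij h => hne i j hij (mul_left_cancel₀ (hz0 t) h),
    fun i t => w t * a i, fun i t => ⟨(hz t).mul_const _, ?_⟩⟩
  refine (((hw t).mul_const (a i)).const_smul (m i)).congr_deriv ?_
  rw [force_mul, eq_neg_of_add_eq_zero_right (hc i)]
  simp only [Complex.real_smul]
  push_cast
  ring

/-- The normalized central configuration similar to a given triangle. -/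
theorem exists_central_of_triangle (hm : ∀ i, 0 < m i) (hδ : ∀ i j, i ≠ j → 0 < delta m e i j)
    {x : Fin 3 → ℂ} (hx : x 0 + x 1 + x 2 = 0)
    (hside : ∀ i, ‖x i‖ ^ 3 = delta m e i (i + 1)) (harea : (starRingEnd ℂ (x 0) * x 1).im ≠ 0) :
    ∃ (a : Fin 3 → ℂ) (N : ℝ), 0 < N ∧ (∀ i, N * (a i - a (i + 1)) = x i) ∧
      IsCentralConfiguration m e a ∧ ¬ Collinear ℝ (Set.range a) ∧
      ∑ i, m i * ‖a i‖ ^ 2 = 1 ∧ ∑ i, m i • a i = 0 ∧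
      forceFunction m e a = (∑ j, m j) * N ^ 3 ∧
      ∀ i, (forceFunction m e a * m i) • a i + force m e a i = 0 := by
  have hM : 0 < ∑ i, m i := Finset.sum_pos (fun i _ => hm i) Finset.univ_nonempty
  have hMC : (m 0 + m 1 + m 2 : ℂ) ≠ 0 := by
    rw [Fin.sum_univ_three] at hM
    exact_mod_cast hM.ne'
  have hx2 : x 2 = -x 0 - x 1 := by linear_combination hx
  -- The vertices with centre of mass 0 and side vectors x_i; dividing by N then normalizes the
  -- moment of inertia.
  obtain ⟨A, hA⟩ : ∃ A : Fin 3 → ℂ, A =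
      fun i => ((m (i + 1) : ℂ) * x i - m (i + 2) * x (i + 2)) / (m 0 + m 1 + m 2) := ⟨_, rfl⟩
  have hAx : ∀ i, A i - A (i + 1) = x i := by
    intro i
    rw [hA]
    fin_cases i <;> simp [show (1 : Fin 3) + 1 = 2 from rfl, show (2 : Fin 3) + 1 = 0 from rfl,
      show (1 : Fin 3) + 2 = 0 from rfl, show (2 : Fin 3) + 2 = 1 from rfl, hx2] <;>
      field_simp <;> ring
  have hAsum : ∑ i, m i • A i = 0 := by
    rw [hA]
    simp only [Fin.sum_univ_three, Complex.real_smul, show (0 : Fin 3) + 1 = 1 from rfl,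
      show (1 : Fin 3) + 1 = 2 from rfl, show (2 : Fin 3) + 1 = 0 from rfl,
      show (0 : Fin 3) + 2 = 2 from rfl, show (1 : Fin 3) + 2 = 0 from rfl,
      show (2 : Fin 3) + 2 = 1 from rfl]
    field_simp
    ring
  have hδi : ∀ i : Fin 3, 0 < delta m e i (i + 1) := fun i => hδ i _ (by fin_cases i <;> decide)
  have hx0 : ∀ i, x i ≠ 0 := fun i h => by
    have := hside i
    rw [h] at this
    have := hδi i
    simp at *
    linarith
  have hAne : A ≠ 0 := fun h => hx0 0 (by rw [← hAx 0, h]; simp)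
  have hN2 : 0 < ∑ i, m i * ‖A i‖ ^ 2 := by
    obtain ⟨i, hi⟩ := Function.ne_iff.1 hAne
    refine Finset.sum_pos' (fun i _ => mul_nonneg (hm i).le (sq_nonneg _))
      ⟨i, Finset.mem_univ i, mul_pos (hm i) (pow_pos (norm_pos_iff.2 hi) 2)⟩
  set N := Real.sqrt (∑ i, m i * ‖A i‖ ^ 2) with hN
  have hN0 : 0 < N := Real.sqrt_pos.2 hN2
  have hNsq : N ^ 2 = ∑ i, m i * ‖A i‖ ^ 2 := Real.sq_sqrt hN2.le
  have hNC : (N : ℂ) ≠ 0 := Complex.ofReal_ne_zero.2 hN0.ne'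
  obtain ⟨a, ha⟩ : ∃ a : Fin 3 → ℂ, a = fun i => A i / N := ⟨_, rfl⟩
  have hax : ∀ i, N * (a i - a (i + 1)) = x i := fun i => by
    rw [ha, ← hAx i]; field_simp
  have hne' : ∀ i, a i ≠ a (i + 1) := fun i h => hx0 i (by rw [← hax i, h]; simp)
  have hne : ∀ i j, i ≠ j → a i ≠ a j := by
    intro i j hij
    have : j = i + 1 ∨ i = j + 1 := by revert i j; decide
    rcases this with rfl | rfl
    · exact hne' i
    · exact (hne' j).symm
  have hnorm : ∑ i, m i * ‖a i‖ ^ 2 = 1 := by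
    have : ∀ i, m i * ‖a i‖ ^ 2 = m i * ‖A i‖ ^ 2 / N ^ 2 := fun i => by
      rw [ha]
      simp only [norm_div, Complex.norm_real, Real.norm_of_nonneg hN0.le]
      ring
    simp only [this]
    rw [← Finset.sum_div, ← hNsq, div_self (pow_pos hN0 2).ne']
  have hsum : ∑ i, m i • a i = 0 := by
    have : ∀ i, m i • a i = (m i • A i) / N := fun i => by
      rw [ha]; simp only [Complex.real_smul]; ring
    simp only [this]
    rw [← Finset.sum_div, hAsum, zero_div]
  -- The multiplier is M N³ because the sides of a are those of x divided by N and |x_i|³ = δ.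
  have hcen : ∀ i, ((∑ j, m j) * N ^ 3 * m i) • a i + force m e a i = 0 := by
    refine central_of_sides hm hsum (fun i => ?_) hne'
    rw [← hside i, ← hax i, norm_mul, Complex.norm_real, Real.norm_of_nonneg hN0.le]
    ring
  have hU := multiplier_eq_forceFunction hne' hcen hnorm
  refine ⟨a, N, hN0, hax, ⟨hne, _, hcen⟩, not_collinear_of_area_ne_zero fun h => harea ?_, hnorm,
    hsum, hU.symm, by rwa [← hU]⟩
  rw [← hax 0, ← hax 1, map_mul, Complex.conj_ofReal,
    show (N : ℂ) * starRingEnd ℂ (a 0 - a (0 + 1)) * (N * (a 1 - a (1 + 1))) =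
      ((N ^ 2 : ℝ) : ℂ) * (starRingEnd ℂ (a 0 - a 1) * (a 1 - a 2)) by
        push_cast; ring,
    Complex.im_ofReal_mul]
  rw [area] at h
  rw [h, mul_zero]

end Central

end ChargedThreeBody
end

noncomputable section
namespace ChargedThreeBody

/-! ### Elliptic triangle solutions are minimizers -/

section Elliptic

variable {m e : Fin 3 → ℝ} {τ : ℝ} {k : Fin 3 → ℤ} {q : Fin 3 → ℝ → ℂ}

/-- Bootstrap: z' = w, and w' is a smooth function of z away from 0. -/
lemma contDiff_of_kepler {μ : ℝ} {z w : ℝ → ℂ} (h0 : ∀ t, z t ≠ 0)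
    (hz : ∀ t, HasDerivAt z (w t) t) (hw : ∀ t, HasDerivAt w ((-μ / ‖z t‖ ^ 3 : ℝ) • z t) t) :
    ContDiff ℝ ∞ z := by
  have key : ∀ n : ℕ, ContDiff ℝ n z ∧ ContDiff ℝ n w := by
    intro n
    induction n with
    | zero =>
      simp only [Nat.cast_zero, contDiff_zero]
      exact ⟨continuous_iff_continuousAt.2 fun t => (hz t).continuousAt,
        continuous_iff_continuousAt.2 fun t => (hw t).continuousAt⟩
    | succ n ih =>
      have hdz : deriv z = w := funext fun t => (hz t).deriv
      have hdw : deriv w = fun t => (-μ / ‖z t‖ ^ 3 : ℝ) • z t := funext fun t => (hw t).deriv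
      push_cast
      refine ⟨contDiff_succ_iff_deriv.2 ⟨fun t => (hz t).differentiableAt, by simp, hdz ▸ ih.2⟩,
        contDiff_succ_iff_deriv.2 ⟨fun t => (hw t).differentiableAt, by simp, hdw ▸ ?_⟩⟩
      exact (contDiff_const.div ((ih.1.norm ℝ h0).pow 3)
        fun t => pow_ne_zero 3 (norm_ne_zero_iff.2 (h0 t))).smul ih.1
  exact contDiff_infty.2 fun n => (key n).1

lemma smoothLoops_subset_loopSpace : smoothLoops m τ k ⊆ loopSpace m τ k := by
  intro q hq
  refine ⟨fun i => ⟨hq.2.1 i, ?_, ?_⟩, fun ε hε => ⟨q, hq, ?_⟩⟩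
  · exact absolutelyContinuousOnInterval_of_contDiff ((hq.1 i).of_le (by exact_mod_cast le_top)) 0 τ
  · have hc : Continuous (deriv (q i)) := (hq.1 i).continuous_deriv (by exact_mod_cast le_top)
    obtain ⟨C, hC⟩ := isCompact_Icc.exists_bound_of_continuousOn (s := Set.Icc 0 τ)
      hc.continuousOn
    refine MemLp.of_bound hc.aestronglyMeasurable C ?_
    rw [ae_restrict_iff' measurableSet_Ioc]
    exact .of_forall fun t ht => hC t (Set.Ioc_subset_Icc_self ht)
  · simpa [sobolevDistSq] using hε

/-- The data of an elliptic triangle solution, with the shape of the triangle determined. -/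
lemma IsEllipticTriangleSolution.exists_kepler (hm : ∀ i, 0 < m i)
    (hδ : ∀ i j, i ≠ j → 0 < delta m e i j) (h : IsEllipticTriangleSolution m e q) :
    ∃ (a : Fin 3 → ℂ) (μ : ℝ) (z w : ℝ → ℂ), 0 < μ ∧ (∀ i j, i ≠ j → a i ≠ a j) ∧
      (∑ i, m i • a i = 0) ∧
      (∀ i, μ * ‖a i - a (i + 1)‖ ^ 3 = (∑ j, m j) * delta m e i (i + 1)) ∧
      (∀ i t, q i t = z t * a i) ∧ (∀ t, z t ≠ 0) ∧ (∀ t, HasDerivAt z (w t) t) ∧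
      (∀ t, HasDerivAt w ((-μ / ‖z t‖ ^ 3 : ℝ) • z t) t) ∧
      (∀ t, ‖w t‖ ^ 2 / 2 - μ / ‖z t‖ < 0) ∧
      ∀ t, (z t).re * (w t).im - (z t).im * (w t).re ≠ 0 := by
  obtain ⟨-, a, r, θ, hc, hcol, hn, -, ⟨hz0, w, hw⟩, hq⟩ := h
  obtain ⟨-, hsum, hside⟩ := sides_of_central hm hδ hc hcol hn
  exact ⟨a, forceFunction m e a, _, w,
    forceFunction_pos hm hδ fun i => hc.1 _ _ (by fin_cases i <;> decide), hc.1, hsum, hside, hq,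
    hz0, fun t => (hw t).1, fun t => (hw t).2.1, fun t => (hw t).2.2.1, fun t => (hw t).2.2.2⟩

theorem IsEllipticTriangleSolution.mem_smoothLoops (hm : ∀ i, 0 < m i)
    (hδ : ∀ i j, i ≠ j → 0 < delta m e i j) (h : IsEllipticTriangleSolution m e q)
    (hper : ∀ i, Function.Periodic (q i) τ)
    (hi : ∀ i, HasIndex τ (fun t => q i t - q (i + 1) t) (k i)) : q ∈ smoothLoops m τ k := by
  obtain ⟨a, μ, z, w, -, hne, hsum, -, hq, hz0, hz, hw, -⟩ := h.exists_kepler hm hδ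
  refine ⟨fun i => ?_, hper, fun t => ?_, fun t i j hij => ?_, hi⟩
  · rw [show q i = fun t => z t * a i from funext (hq i)]
    exact (contDiff_of_kepler hz0 hz hw).mul contDiff_const
  · simp only [hq]
    simp only [← mul_smul_comm]
    rw [← Finset.mul_sum, hsum, mul_zero]
  · rw [hq, hq]
    exact fun hc => hne i j hij (mul_left_cancel₀ (hz0 t) hc)

/-- Each side is z b with b constant, hence a Kepler orbit with constant μ |b|³ = M δ, negative
energy and nonzero angular momentum. So every pair attains Gordon's bound. -/
theorem IsEllipticTriangleSolution.action_eq (hm : ∀ i, 0 < m i) (hτ : 0 < τ)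
    (hk : ∀ i, k i = 1 ∨ k i = -1)
    (hδ : ∀ i j, i ≠ j → 0 < delta m e i j) (h : IsEllipticTriangleSolution m e q)
    (hper : ∀ i, Function.Periodic (q i) τ)
    (hi : ∀ i, HasIndex τ (fun t => q i t - q (i + 1) t) (k i)) :
    action m e τ q = ENNReal.ofReal (minimalAction m e τ) := by
  rw [action_eq_sum_pairAction hm hτ hδ
    (smoothLoops_subset_loopSpace (h.mem_smoothLoops hm hδ hper hi)), ofReal_minimalAction hm hτ hδ]
  have hM : 0 < ∑ i, m i := Finset.sum_pos (fun i _ => hm i) Finset.univ_nonempty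
  obtain ⟨a, μ, z, w, hμ, hne, hsum, hside, hq, hz0, hz, hw, hE, hL⟩ := h.exists_kepler hm hδ
  refine Finset.sum_congr rfl fun i _ => ?_
  congr 1
  have hδi : 0 < delta m e i (i + 1) := hδ i _ (by fin_cases i <;> decide)
  have hpos := mul_pos hM hδi
  set b := a i - a (i + 1) with hb
  have hb0 : b ≠ 0 := sub_ne_zero.2 (hne _ _ (by fin_cases i <;> decide))
  have hbn : ‖b‖ ≠ 0 := norm_ne_zero_iff.2 hb0
  have hx : (fun t => q i t - q (i + 1) t) = fun t => z t * b := by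
    ext t; rw [hq, hq, hb]; ring
  have hip := hi i
  have hperp : Function.Periodic (fun t => q i t - q (i + 1) t) τ := (hper i).sub (hper (i + 1))
  rw [hx] at hip hperp ⊢
  have hd : ∀ t, HasDerivAt (fun t => z t * b) (w t * b) t := fun t => (hz t).mul_const b
  have hzn : ∀ t, ‖z t‖ ≠ 0 := fun t => norm_ne_zero_iff.2 (hz0 t)
  have hd2 : ∀ t, HasDerivAt (fun t => w t * b)
      ((-((∑ j, m j) * delta m e i (i + 1)) / ‖z t * b‖ ^ 3 : ℝ) • (z t * b)) t := fun t => by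
    refine ((hw t).mul_const b).congr_deriv ?_
    have : -((∑ j, m j) * delta m e i (i + 1)) / ‖z t * b‖ ^ 3 = -μ / ‖z t‖ ^ 3 := by
      rw [← hside i, ← hb, norm_mul]
      have := hzn t
      field_simp
    rw [this, smul_mul_assoc]
  have hwc : Continuous w := continuous_iff_continuousAt.2 fun t => (hw t).continuousAt
  rw [pairAction_eq_ofReal hpos hτ hd (hwc.mul continuous_const) hip.1,
    integral_eq_gordonBound_of_kepler hpos hτ (hk i) hd hd2 hperp hip]
  · have h1 : ‖w 0 * b‖ ^ 2 / 2 - (∑ j, m j) * delta m e i (i + 1) / ‖z 0 * b‖ =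
        ‖b‖ ^ 2 * (‖w 0‖ ^ 2 / 2 - μ / ‖z 0‖) := by
      rw [← hside i, ← hb, norm_mul, norm_mul]
      have := hzn 0
      field_simp
    rw [h1]
    exact mul_neg_of_pos_of_neg (by positivity) (hE 0)
  · intro t
    have h1 : (z t * b).re * (w t * b).im - (z t * b).im * (w t * b).re =
        ‖b‖ ^ 2 * ((z t).re * (w t).im - (z t).im * (w t).re) := by
      rw [Complex.sq_norm, Complex.normSq_apply]
      simp only [Complex.mul_re, Complex.mul_im]
      ring
    rw [h1]
    exact mul_ne_zero (pow_ne_zero 2 hbn) (hL t)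

/-- A triangle with prescribed sides. -/
lemma exists_triangle {b₀ b₁ b₂ : ℝ} (h0 : 0 < b₀) (h1 : 0 < b₁) (h2 : 0 < b₂)
    (t0 : b₀ < b₁ + b₂) (t1 : b₁ < b₂ + b₀) (t2 : b₂ < b₀ + b₁) :
    ∃ x : Fin 3 → ℂ, x 0 + x 1 + x 2 = 0 ∧ ‖x 0‖ = b₀ ∧ ‖x 1‖ = b₁ ∧ ‖x 2‖ = b₂ ∧
      (starRingEnd ℂ (x 0) * x 1).im ≠ 0 := by
  -- Law of cosines: the first side lies on the real axis, the second is κ + iσ, and κ makes their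
  -- sum have length b₂. The triangle inequalities say |κ| < b₁.
  set κ := (b₂ ^ 2 - b₀ ^ 2 - b₁ ^ 2) / (2 * b₀) with hκ
  have hκe : 2 * b₀ * κ = b₂ ^ 2 - b₀ ^ 2 - b₁ ^ 2 := by rw [hκ]; field_simp
  have hlt : 0 < b₁ ^ 2 - κ ^ 2 := by
    have e1 : 0 < 2 * b₀ * (b₁ - κ) := by nlinarith
    have e2 : 0 < 2 * b₀ * (b₁ + κ) := by nlinarith
    have e3 : 0 < b₁ - κ := (mul_pos_iff_of_pos_left (by positivity)).1 e1
    have e4 : 0 < b₁ + κ := (mul_pos_iff_of_pos_left (by positivity)).1 e2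
    nlinarith
  set σ := Real.sqrt (b₁ ^ 2 - κ ^ 2) with hσ
  have hσ0 : 0 < σ := Real.sqrt_pos.2 hlt
  have hσ2 : σ ^ 2 = b₁ ^ 2 - κ ^ 2 := Real.sq_sqrt hlt.le
  have hn : ∀ {z : ℂ} {b : ℝ}, 0 < b → z.re * z.re + z.im * z.im = b ^ 2 → ‖z‖ = b := by
    intro z b hb h
    rw [← Complex.normSq_apply, Complex.normSq_eq_norm_sq] at h
    exact (pow_left_inj₀ (norm_nonneg _) hb.le two_ne_zero).1 h
  refine ⟨![⟨b₀, 0⟩, ⟨κ, σ⟩, ⟨-b₀ - κ, -σ⟩], ?_, hn h0 ?_, hn h1 ?_, hn h2 ?_, ?_⟩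
  · apply Complex.ext <;> simp
  · simp; ring
  · simp; linarith
  · simp; linarith
  · simp
    exact ⟨h0.ne', hσ0.ne'⟩

/-- Eccentricity 0 suffices: the triangle rotates uniformly, once per period, in the direction
prescribed by k. -/
theorem exists_isEllipticTriangleSolution (hm : ∀ i, 0 < m i) (hτ : 0 < τ)
    (hk : k = ![1, 1, 1] ∨ k = ![-1, -1, -1])
    (hδ : ∀ i j, i ≠ j → 0 < delta m e i j)
    (htri : ∀ i : Fin 3,
      delta m e (i + 2) i ^ (1 / 3 : ℝ) <
        delta m e i (i + 1) ^ (1 / 3 : ℝ) + delta m e (i + 1) (i + 2) ^ (1 / 3 : ℝ)) :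
    ∃ q, IsEllipticTriangleSolution m e q ∧ (∀ i, Function.Periodic (q i) τ) ∧
      ∀ i, HasIndex τ (fun t => q i t - q (i + 1) t) (k i) := by
  have hM : 0 < ∑ i, m i := Finset.sum_pos (fun i _ => hm i) Finset.univ_nonempty
  have hδi : ∀ i : Fin 3, 0 < delta m e i (i + 1) := fun i => hδ i _ (by fin_cases i <;> decide)
  obtain ⟨n, hn, hkn⟩ : ∃ n : ℤ, (n = 1 ∨ n = -1) ∧ ∀ i, k i = n := by
    rcases hk with rfl | rfl
    · exact ⟨1, Or.inl rfl, fun i => by fin_cases i <;> rfl⟩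
    · exact ⟨-1, Or.inr rfl, fun i => by fin_cases i <;> rfl⟩
  obtain ⟨x, hx, hx0, hx1, hx2, harea⟩ := exists_triangle
    (Real.rpow_pos_of_pos (hδi 0) (1 / 3)) (Real.rpow_pos_of_pos (hδi 1) (1 / 3))
    (Real.rpow_pos_of_pos (hδi 2) (1 / 3)) (htri 1) (htri 2) (htri 0)
  have hcube : ∀ i, (delta m e i (i + 1) ^ (1 / 3 : ℝ)) ^ 3 = delta m e i (i + 1) := fun i => by
    rw [← Real.rpow_natCast, ← Real.rpow_mul (hδi i).le]; norm_num
  obtain ⟨a, N, hN, hax, hcen, hcol, hnorm, hsum, hU, hbal⟩ :=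
    exists_central_of_triangle hm hδ hx (fun i => by
      rw [← hcube i]
      fin_cases i
      · exact congrArg (· ^ 3) hx0
      · exact congrArg (· ^ 3) hx1
      · exact congrArg (· ^ 3) hx2) harea
  set μ := forceFunction m e a
  have hμ : 0 < μ := by rw [hU]; positivity
  have hpi := Real.pi_pos
  have hnn : (n : ℝ) ^ 2 = 1 := by rcases hn with rfl | rfl <;> norm_num
  have hn0 : (n : ℝ) ≠ 0 := fun h => by rw [h] at hnn; norm_num at hnn
  set ν : ℝ := 2 * Real.pi / τ * n with hν
  have hν0 : ν ≠ 0 := mul_ne_zero (by positivity) hn0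
  have hν2 : 0 < ν ^ 2 := by positivity
  -- Kepler's third law R³ ν² = μ for the circular orbit.
  set R := (μ / ν ^ 2) ^ (1 / 3 : ℝ) with hR
  have hR0 : 0 < R := Real.rpow_pos_of_pos (by positivity) _
  have hR3 : R ^ 3 = μ / ν ^ 2 := by
    rw [hR, ← Real.rpow_natCast, ← Real.rpow_mul (by positivity)]; norm_num
  have hμR : μ = R ^ 3 * ν ^ 2 := by rw [hR3]; field_simp
  set z : ℝ → ℂ := fun t => R * Complex.exp ((ν * t : ℝ) * Complex.I) with hz
  have hzn : ∀ t, ‖z t‖ = R := fun t => by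
    simp only [hz]
    rw [norm_mul, Complex.norm_exp_ofReal_mul_I, Complex.norm_real, Real.norm_of_nonneg hR0.le,
      mul_one]
  have hz0 : ∀ t, z t ≠ 0 := fun t h => hR0.ne' (by rw [← hzn t, h, norm_zero])
  have hexp : ∀ t, HasDerivAt z (ν * Complex.I * z t) t := by
    intro t
    have h1 : HasDerivAt (fun t : ℝ => (ν * t : ℝ) * Complex.I) (ν * Complex.I) t := by
      have := ((hasDerivAt_id t).const_mul ν).ofReal_comp.mul_const Complex.I
      simpa using this
    refine (h1.cexp.const_mul (R : ℂ)).congr_deriv ?_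
    simp only [hz]; ring
  have hexp2 : ∀ t, HasDerivAt (fun t => ν * Complex.I * z t)
      ((-μ / ‖z t‖ ^ 3 : ℝ) • z t) t := by
    intro t
    refine ((hexp t).const_mul _).congr_deriv ?_
    rw [hzn, hμR, show -(R ^ 3 * ν ^ 2) / R ^ 3 = -ν ^ 2 by field_simp, Complex.real_smul]
    push_cast
    linear_combination (ν : ℂ) ^ 2 * z t * Complex.I_sq
  have hexpτ : ∀ t, z (t + τ) = z t := by
    intro t
    simp only [hz]
    have : ((ν * (t + τ) : ℝ) : ℂ) * Complex.I =
        (ν * t : ℝ) * Complex.I + n * (2 * Real.pi * Complex.I) := by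
      have h : ν * (t + τ) = ν * t + n * (2 * Real.pi) := by rw [hν]; field_simp
      rw [h]; push_cast; ring
    rw [this, Complex.exp_add, Complex.exp_int_mul_two_pi_mul_I, mul_one]
  refine ⟨fun i t => z t * a i, ⟨isSolution_of_central hcen.1 hbal hz0 hexp hexp2, a, fun _ => R,
    fun t => ν * t, hcen, hcol, hnorm, fun _ => hR0, ⟨hz0, fun t => ν * Complex.I * z t,
    fun t => ⟨hexp t, hexp2 t, ?_, ?_⟩⟩, fun i t => rfl⟩, fun i t => ?_, fun i => ⟨fun t => ?_,
    fun t => ν * t + Complex.arg (a i - a (i + 1)), ?_, fun t => ?_, ?_⟩⟩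
  · change ‖ν * Complex.I * z t‖ ^ 2 / 2 - μ / ‖z t‖ < 0
    rw [norm_mul, norm_mul, hzn, Complex.norm_I, Complex.norm_real, hμR, Real.norm_eq_abs, mul_one,
      mul_pow, sq_abs]
    have : R ^ 3 * ν ^ 2 / R = ν ^ 2 * R ^ 2 := by field_simp
    rw [this]
    have : 0 < ν ^ 2 * R ^ 2 := by positivity
    linarith
  · change (z t).re * (ν * Complex.I * z t).im - (z t).im * (ν * Complex.I * z t).re ≠ 0
    have h1 : (z t).re * (ν * Complex.I * z t).im - (z t).im * (ν * Complex.I * z t).re =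
        ν * ‖z t‖ ^ 2 := by
      rw [Complex.sq_norm, Complex.normSq_apply]
      simp [Complex.mul_re, Complex.mul_im]
      ring
    rw [h1, hzn]
    exact mul_ne_zero hν0 (pow_ne_zero 2 hR0.ne')
  · simp only [hexpτ t]
  · exact sub_ne_zero.2 fun h =>
      hcen.1 i (i + 1) (by fin_cases i <;> decide) (mul_left_cancel₀ (hz0 t) h)
  · exact (continuous_const.mul continuous_id).add continuous_const
  · change z t * a i - z t * a (i + 1) = (‖z t * a i - z t * a (i + 1)‖ : ℂ) *
      Complex.exp ((ν * t + Complex.arg (a i - a (i + 1)) : ℝ) * Complex.I)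
    rw [← mul_sub, norm_mul, hzn]
    conv_lhs => rw [← Complex.norm_mul_exp_arg_mul_I (a i - a (i + 1))]
    simp only [hz]
    push_cast
    rw [add_mul, Complex.exp_add]
    ring
  · rw [hkn i, hν]
    field_simp
    ring

end Elliptic

end ChargedThreeBody
end

noncomputable section
namespace ChargedThreeBody

/-! ### Minimizers of class `C²` -/

section Collision

variable {μ τ : ℝ} {x x' : ℝ → ℂ}

/-- A loop of class `C¹` with finite action has no collision. -/
theorem ne_zero_of_pairAction_ne_top (hμ : 0 < μ) (hτ : 0 < τ) (hx : ContDiff ℝ 1 x)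
    (hfin : pairAction μ τ x ≠ ⊤) {t₀ : ℝ} (ht₀ : t₀ ∈ Set.Icc 0 τ) : x t₀ ≠ 0 := by
  intro h0
  obtain ⟨K, hK⟩ := hx.contDiffOn.exists_lipschitzOnWith (by decide) (convex_Icc 0 τ)
    isCompact_Icc
  -- From |x(t)| ≤ K |t - t₀| follows 1/|t - t₀| ≤ C μ/|x(t)|, so finite action would make 1/|t -
  -- t₀| integrable. Adding 1 keeps C positive.
  set C : ℝ := (K + 1) / μ with hC
  have hC0 : 0 < C := by positivity
  have hle : ∫⁻ t in Set.Ioc 0 τ, ‖(t - t₀)⁻¹‖ₑ ≤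
      ENNReal.ofReal C * ∫⁻ t in Set.Ioc 0 τ, (ENNReal.ofReal (1 / 2 * ‖deriv x t‖ ^ 2) +
        ENNReal.ofReal μ / ‖x t‖ₑ) := by
    rw [← lintegral_const_mul' _ _ ENNReal.ofReal_ne_top]
    refine setLIntegral_mono' measurableSet_Ioc fun t ht => ?_
    refine le_trans ?_ (mul_le_mul_of_nonneg_left le_add_self zero_le)
    have hlip := hK.dist_le_mul t (Set.Ioc_subset_Icc_self ht) t₀ ht₀
    rw [dist_eq_norm, dist_eq_norm, h0, sub_zero] at hlip
    by_cases hxt : x t = 0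
    · rw [hxt, enorm_zero, ENNReal.div_zero (by simpa using hμ),
        ENNReal.mul_top (by simpa using hC0)]
      exact le_top
    · rw [ofReal_div_enorm μ hxt, ← ENNReal.ofReal_mul hC0.le, ← ofReal_norm]
      refine ENNReal.ofReal_le_ofReal ?_
      have hxn : 0 < ‖x t‖ := norm_pos_iff.2 hxt
      have htn : 0 < ‖t - t₀‖ := by
        by_contra! hcon
        have : ‖t - t₀‖ = 0 := le_antisymm hcon (norm_nonneg _)
        rw [this, mul_zero] at hlip
        linarith
      have hCμ : C * (μ / ‖x t‖) = (K + 1) / ‖x t‖ := by rw [hC]; field_simp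
      rw [hCμ, norm_inv, inv_eq_one_div, div_le_div_iff₀ htn hxn]
      nlinarith
  have hint : IntervalIntegrable (fun t => (t - t₀)⁻¹) volume 0 τ := by
    rw [intervalIntegrable_iff_integrableOn_Ioc_of_le hτ.le]
    refine ⟨(measurable_id.sub_const t₀).inv.aestronglyMeasurable, hle.trans_lt ?_⟩
    exact ENNReal.mul_lt_top ENNReal.ofReal_lt_top (lt_top_iff_ne_top.2 hfin)
  rw [intervalIntegrable_sub_inv_iff, Set.uIcc_of_le hτ.le] at hint
  rcases hint with h | h
  · exact hτ.ne h
  · exact h ht₀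

lemma angularMomentum_const (hx : ∀ t, HasDerivAt x (x' t) t)
    (hx' : ∀ t, HasDerivAt x' ((-μ / ‖x t‖ ^ 3 : ℝ) • x t) t) (t s : ℝ) :
    (starRingEnd ℂ (x t) * x' t).im = (starRingEnd ℂ (x s) * x' s).im := by
  have hd : ∀ t, HasDerivAt (fun t => (starRingEnd ℂ (x t) * x' t).im) 0 t := by
    intro t
    have hconj : HasDerivAt (fun s => starRingEnd ℂ (x s)) (starRingEnd ℂ (x' t)) t :=
      Complex.conjCLE.toContinuousLinearMap.hasFDerivAt.comp_hasDerivAt t (hx t)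
    refine (Complex.imCLM.hasFDerivAt.comp_hasDerivAt t (hconj.mul (hx' t))).congr_deriv ?_
    simp only [Complex.real_smul, Complex.imCLM_apply, Complex.add_im, Complex.mul_im,
      Complex.mul_re, Complex.conj_re, Complex.conj_im, Complex.ofReal_re, Complex.ofReal_im]
    ring
  exact is_const_of_deriv_eq_zero (fun s => (hd s).differentiableAt) (fun s => (hd s).deriv) t s

/-- Periodic Kepler orbits without collision have nonzero angular momentum. -/
theorem angularMomentum_ne_zero (hμ : 0 < μ) (hτ : 0 < τ) (hx : ∀ t, HasDerivAt x (x' t) t)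
    (hx' : ∀ t, HasDerivAt x' ((-μ / ‖x t‖ ^ 3 : ℝ) • x t) t) (h0 : ∀ t, x t ≠ 0)
    (hper : Function.Periodic x τ) (t : ℝ) : (starRingEnd ℂ (x t) * x' t).im ≠ 0 := by
  intro hz
  have hL : ∀ s, (starRingEnd ℂ (x s) * x' s).im = 0 := fun s =>
    (angularMomentum_const hx hx' s t).trans hz
  have hc0 : ∀ s, starRingEnd ℂ (x s) ≠ 0 := fun s => (map_ne_zero _).2 (h0 s)
  -- With zero angular momentum x / conj x is constant, so x stays on one line through 0, and on one
  -- side of it because it never vanishes.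
  have hdir : ∀ s, x s / starRingEnd ℂ (x s) = x 0 / starRingEnd ℂ (x 0) := by
    have hd : ∀ s, HasDerivAt (fun s => x s / starRingEnd ℂ (x s)) 0 s := by
      intro s
      have hconj : HasDerivAt (fun s => starRingEnd ℂ (x s)) (starRingEnd ℂ (x' s)) s :=
        Complex.conjCLE.toContinuousLinearMap.hasFDerivAt.comp_hasDerivAt s (hx s)
      refine ((hx s).div hconj (hc0 s)).congr_deriv ?_
      rw [div_eq_zero_iff]
      left
      have h1 : x' s * starRingEnd ℂ (x s) - x s * starRingEnd ℂ (x' s) =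
          ((2 * (starRingEnd ℂ (x s) * x' s).im : ℝ) : ℂ) * Complex.I := by
        apply Complex.ext <;> simp <;> ring
      rw [h1, hL s]; simp
    exact fun s => is_const_of_deriv_eq_zero (fun s => (hd s).differentiableAt)
      (fun s => (hd s).deriv) s 0
  set b := starRingEnd ℂ (x 0) with hb
  have hreal : ∀ s, (x s * b).im = 0 := by
    intro s
    have h1 : x s * b = starRingEnd ℂ (x s * b) := by
      have := hdir s
      rw [div_eq_div_iff (hc0 s) (hc0 0)] at this
      rw [map_mul, hb, Complex.conj_conj, ← hb, this, mul_comm]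
    exact Complex.conj_eq_iff_im.1 h1.symm
  have hre : ∀ {f : ℝ → ℂ} {f' : ℂ} {s : ℝ}, HasDerivAt f f' s →
      HasDerivAt (fun s => (f s * b).re) (f' * b).re s := fun h =>
    Complex.reCLM.hasFDerivAt.comp_hasDerivAt _ (h.mul_const b)
  have hne : ∀ s, (x s * b).re ≠ 0 := fun s h =>
    mul_ne_zero (h0 s) (hc0 0) (Complex.ext h (hreal s))
  have hψc : Continuous fun s => (x s * b).re :=
    continuous_iff_continuousAt.2 fun s => (hre (hx s)).continuousAt
  have hψ0 : 0 < (x 0 * b).re := by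
    rw [hb, Complex.mul_conj, Complex.ofReal_re, Complex.normSq_pos]
    exact h0 0
  have hψ : ∀ s, 0 < (x s * b).re := by
    intro s
    by_contra! hneg
    have := intermediate_value_uIcc (a := 0) (b := s) hψc.continuousOn
    obtain ⟨r, -, hr⟩ := this (Set.mem_uIcc.2 (Or.inr ⟨hneg, hψ0.le⟩))
    exact hne r hr
  -- On a half-line the attraction makes the radial velocity strictly decreasing, which excludes
  -- periodicity.
  have hanti : StrictAnti fun s => (x' s * b).re := by
    refine strictAnti_of_deriv_neg fun s => ?_
    rw [(hre (hx' s)).deriv, smul_mul_assoc, Complex.real_smul, Complex.re_ofReal_mul]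
    exact mul_neg_of_neg_of_pos (div_neg_of_neg_of_pos (by linarith)
      (pow_pos (norm_pos_iff.2 (h0 s)) 3)) (hψ s)
  have h1 := hanti hτ
  have h2 := periodic_deriv hx hper 0
  rw [zero_add] at h2
  simp only [h2] at h1
  exact lt_irrefl _ h1

end Collision

/-! ### Rigidity of the shape of the triangle. -/

section Homothety

variable {M : ℝ}

/-- Two Kepler orbits that remain collinear are equal up to sign. -/
lemma exists_sign_of_parallel (hM : 0 < M) {y₀ v₀ y₁ v₁ : ℝ → ℂ}
    (hy₀ : ∀ t, HasDerivAt y₀ (v₀ t) t) (hy₁ : ∀ t, HasDerivAt y₁ (v₁ t) t)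
    (hv₀ : ∀ t, HasDerivAt v₀ ((-M / ‖y₀ t‖ ^ 3 : ℝ) • y₀ t) t)
    (hv₁ : ∀ t, HasDerivAt v₁ ((-M / ‖y₁ t‖ ^ 3 : ℝ) • y₁ t) t)
    (h₀ : ∀ t, y₀ t ≠ 0) (h₁ : ∀ t, y₁ t ≠ 0)
    (hL : ∀ t, (starRingEnd ℂ (y₀ t) * v₀ t).im ≠ 0) (hpar : ∀ t, (y₁ t / y₀ t).im = 0) :
    ∃ c : ℝ, c ^ 2 = 1 ∧ ∀ t, y₁ t = c * y₀ t := by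
  have hg : ∀ t, HasDerivAt (fun t => y₁ t / y₀ t)
      ((v₁ t * y₀ t - y₁ t * v₀ t) / y₀ t ^ 2) t := fun t => (hy₁ t).div (hy₀ t) (h₀ t)
  set g : ℝ → ℝ := fun t => (y₁ t / y₀ t).re with hgdef
  set g' : ℝ → ℝ := fun t => ((v₁ t * y₀ t - y₁ t * v₀ t) / y₀ t ^ 2).re with hg'def
  have hgd : ∀ t, HasDerivAt g (g' t) t := fun t =>
    Complex.reCLM.hasFDerivAt.comp_hasDerivAt t (hg t)
  have hgim : ∀ t, ((v₁ t * y₀ t - y₁ t * v₀ t) / y₀ t ^ 2).im = 0 := fun t => by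
    have h1 : HasDerivAt (fun t => (y₁ t / y₀ t).im) _ t :=
      Complex.imCLM.hasFDerivAt.comp_hasDerivAt t (hg t)
    rw [funext hpar] at h1
    exact h1.unique (hasDerivAt_const t 0)
  have e1 : ∀ t, y₁ t = g t * y₀ t := fun t => by
    have : y₁ t / y₀ t = (g t : ℂ) := Complex.ext (by simp [hgdef]) (by simp [hpar t])
    rw [← this, div_mul_cancel₀ _ (h₀ t)]
  have e2 : ∀ t, v₁ t = g' t * y₀ t + g t * v₀ t := fun t => by
    have : (v₁ t * y₀ t - y₁ t * v₀ t) / y₀ t ^ 2 = (g' t : ℂ) :=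
      Complex.ext (by simp [hg'def]) (by rw [hgim t, Complex.ofReal_im])
    rw [← this, e1 t]
    have := h₀ t
    field_simp
    ring
  have hgne : ∀ t, g t ≠ 0 := fun t h => h₁ t (by rw [e1 t, h]; simp)
  -- If y₁ = g y₀ with g real, its angular momentum is g² times that of y₀. Both are constant, so g
  -- is constant.
  have hsq : ∀ t, g t ^ 2 * (starRingEnd ℂ (y₀ 0) * v₀ 0).im =
      (starRingEnd ℂ (y₁ 0) * v₁ 0).im := by
    intro t
    rw [angularMomentum_const hy₀ hv₀ 0 t, angularMomentum_const hy₁ hv₁ 0 t, e1 t, e2 t]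
    simp
    ring
  have hg'0 : ∀ t, g' t = 0 := by
    intro t
    have h1 := ((hgd t).pow 2).mul_const (starRingEnd ℂ (y₀ 0) * v₀ 0).im
    have h2 : (fun t => (g ^ 2) t * (starRingEnd ℂ (y₀ 0) * v₀ 0).im) = fun _ => _ := funext hsq
    rw [h2] at h1
    have h3 := h1.unique (hasDerivAt_const t _)
    have h4 := (mul_eq_zero.1 h3).resolve_right (hL 0)
    simpa [hgne t] using h4
  have hgc : ∀ t, g t = g 0 := fun t => is_const_of_deriv_eq_zero
    (fun s => (hgd s).differentiableAt) (fun s => by rw [(hgd s).deriv, hg'0]) t 0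
  refine ⟨g 0, ?_, fun t => by rw [← hgc t]; exact e1 t⟩
  have hvv : v₁ = fun t => (g 0 : ℂ) * v₀ t := funext fun t => by
    rw [e2 t, hg'0 t, hgc t]; simp
  -- The Kepler equation is not invariant under scaling of space alone, so the constant ratio has
  -- absolute value 1.
  have h5 := hv₁ 0
  rw [hvv] at h5
  have h6 := h5.unique ((hv₀ 0).const_mul (g 0 : ℂ))
  rw [e1 0, Complex.real_smul, Complex.real_smul,
    show (g 0 : ℂ) * (((-M / ‖y₀ 0‖ ^ 3 : ℝ) : ℂ) * y₀ 0) =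
      ((-M / ‖y₀ 0‖ ^ 3 : ℝ) : ℂ) * (g 0 * y₀ 0) by ring] at h6
  have h7 := mul_right_cancel₀ (mul_ne_zero (Complex.ofReal_ne_zero.2 (hgne 0)) (h₀ 0)) h6
  have h8 : -M / ‖(g 0 : ℂ) * y₀ 0‖ ^ 3 = -M / ‖y₀ 0‖ ^ 3 := by exact_mod_cast h7
  rw [norm_mul, Complex.norm_real] at h8
  have hn0 : 0 < ‖y₀ 0‖ := norm_pos_iff.2 (h₀ 0)
  have hgn : 0 < ‖g 0‖ := norm_pos_iff.2 (hgne 0)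
  have h9 : ‖g 0‖ ^ 3 = 1 := by
    rw [div_eq_div_iff (by positivity) (by positivity)] at h8
    have : M * ‖y₀ 0‖ ^ 3 ≠ 0 := by positivity
    apply mul_left_cancel₀ this
    linear_combination h8
  have h10 : ‖g 0‖ = 1 := (pow_eq_one_iff_of_nonneg (norm_nonneg _) three_ne_zero).1 h9
  rw [← sq_abs, ← Real.norm_eq_abs, h10, one_pow]

/-- Three Kepler orbits with a linear relation satisfying the strict triangle inequalities are
rotations of each other by constant angles. -/
theorem exists_rotation_of_kepler (hM : 0 < M) {β : Fin 3 → ℝ} (hβ : ∀ i, 0 < β i)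
    (t0 : β 0 < β 1 + β 2) (t1 : β 1 < β 2 + β 0) (t2 : β 2 < β 0 + β 1)
    {y v : Fin 3 → ℝ → ℂ} (hy : ∀ i t, HasDerivAt (y i) (v i t) t)
    (hv : ∀ i t, HasDerivAt (v i) ((-M / ‖y i t‖ ^ 3 : ℝ) • y i t) t)
    (h0 : ∀ i t, y i t ≠ 0) (hsum : ∀ t, (β 0 : ℂ) * y 0 t + β 1 * y 1 t + β 2 * y 2 t = 0)
    (hL : ∀ t, (starRingEnd ℂ (y 0 t) * v 0 t).im ≠ 0) :
    ∃ c : ℂ, c.im ≠ 0 ∧ ‖c‖ = 1 ∧ ‖β 0 + β 1 * c‖ = β 2 ∧ ∀ t, y 1 t = c * y 0 t := by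
  have hβC : ∀ i, (β i : ℂ) ≠ 0 := fun i => Complex.ofReal_ne_zero.2 (hβ i).ne'
  have hsumv : ∀ t, (β 0 : ℂ) * v 0 t + β 1 * v 1 t + β 2 * v 2 t = 0 := by
    intro t
    have h1 := (((hy 0 t).const_mul (β 0 : ℂ)).add ((hy 1 t).const_mul (β 1 : ℂ))).add
      ((hy 2 t).const_mul (β 2 : ℂ))
    exact (h1.congr_of_eventuallyEq (.of_forall fun t => (hsum t).symm)).unique
      (hasDerivAt_const t 0)
  have hsuma : ∀ t, (β 0 : ℂ) * ((-M / ‖y 0 t‖ ^ 3 : ℝ) • y 0 t) +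
      β 1 * ((-M / ‖y 1 t‖ ^ 3 : ℝ) • y 1 t) + β 2 * ((-M / ‖y 2 t‖ ^ 3 : ℝ) • y 2 t) = 0 := by
    intro t
    have h1 := (((hv 0 t).const_mul (β 0 : ℂ)).add ((hv 1 t).const_mul (β 1 : ℂ))).add
      ((hv 2 t).const_mul (β 2 : ℂ))
    exact (h1.congr_of_eventuallyEq (.of_forall fun t => (hsumv t).symm)).unique
      (hasDerivAt_const t 0)
  set g : ℝ → ℂ := fun t => y 1 t / y 0 t with hg
  have hyc : ∀ i, Continuous (y i) := fun i =>
    continuous_iff_continuousAt.2 fun t => (hy i t).continuousAt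
  have hgc : Continuous g := (hyc 1).div (hyc 0) (h0 0)
  have hgy : ∀ t, y 1 t = g t * y 0 t := fun t => (div_mul_cancel₀ _ (h0 0 t)).symm
  have hy2 : ∀ t, y 2 t = -(β 0 + β 1 * g t) / β 2 * y 0 t := fun t => by
    have := hβC 2
    have h1 := hsum t
    rw [hgy t] at h1
    field_simp
    linear_combination h1
  -- Where y_0 and y_1 are independent, eliminating y_2 between the linear relation and its second
  -- derivative forces |y_0| = |y_1| = |y_2|.
  have hpt : ∀ t, (g t).im ≠ 0 → ‖g t‖ = 1 ∧ ‖β 0 + β 1 * g t‖ = β 2 := by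
    intro t ht
    have hsa := hsuma t
    have hs := hsum t
    simp only [Complex.real_smul] at hsa
    have hind : (starRingEnd ℂ (y 0 t) * y 1 t).im ≠ 0 := by
      have : starRingEnd ℂ (y 0 t) * y 1 t = ((‖y 0 t‖ ^ 2 : ℝ) : ℂ) * g t := by
        rw [← Complex.normSq_eq_norm_sq, ← Complex.mul_conj, hgy t]; ring
      rw [this, Complex.im_ofReal_mul]
      exact mul_ne_zero (pow_ne_zero 2 (norm_ne_zero_iff.2 (h0 0 t))) ht
    obtain ⟨p1, p2⟩ := eq_of_smul_add_smul_eq hind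
      (p := β 0 * (-M / ‖y 0 t‖ ^ 3)) (q := β 1 * (-M / ‖y 1 t‖ ^ 3))
      (p' := β 0 * (-M / ‖y 2 t‖ ^ 3)) (q' := β 1 * (-M / ‖y 2 t‖ ^ 3)) (by
        push_cast at hsa ⊢
        linear_combination hsa - (-M / ‖y 2 t‖ ^ 3 : ℂ) * hs)
    have hn : ∀ i, 0 < ‖y i t‖ := fun i => norm_pos_iff.2 (h0 i t)
    have cancel : ∀ i, -M / ‖y i t‖ ^ 3 = -M / ‖y 2 t‖ ^ 3 → ‖y i t‖ = ‖y 2 t‖ := by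
      intro i h
      have h1 := hn i
      have h2 := hn 2
      rw [div_eq_div_iff (by positivity) (by positivity)] at h
      have h3 : ‖y i t‖ ^ 3 = ‖y 2 t‖ ^ 3 := by
        apply mul_left_cancel₀ hM.ne'
        linear_combination h
      exact (pow_left_inj₀ h1.le h2.le three_ne_zero).1 h3
    have n0 := cancel 0 (mul_left_cancel₀ (hβ 0).ne' p1)
    have n1 := cancel 1 (mul_left_cancel₀ (hβ 1).ne' p2)
    constructor
    · simp only [hg]
      rw [norm_div, n1, n0, div_self (hn 2).ne']
    · have h3 := congrArg norm (hy2 t)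
      rw [norm_mul, norm_div, norm_neg, Complex.norm_real, Real.norm_of_nonneg (hβ 2).le, n0] at h3
      have h4 := hn 2
      have h5 := hβ 2
      field_simp at h3
      linarith
  -- If the orbits were always parallel they would agree up to signs, and ±β 0 ± β 1 ± β 2 = 0
  -- contradicts the strict triangle inequalities or positivity.
  have hne : ∃ t, (g t).im ≠ 0 := by
    by_contra! hall
    obtain ⟨c₁, hc₁, e1⟩ := exists_sign_of_parallel hM (hy 0) (hy 1) (hv 0) (hv 1) (h0 0) (h0 1) hL
      hall
    obtain ⟨c₂, hc₂, e2⟩ := exists_sign_of_parallel hM (hy 0) (hy 2) (hv 0) (hv 2) (h0 0) (h0 2) hL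
      (fun t => by
        rw [hy2 t, mul_div_cancel_right₀ _ (h0 0 t),
          show -(β 0 + β 1 * g t) / (β 2 : ℂ) = ((-1 / β 2 : ℝ) : ℂ) * (β 0 + β 1 * g t) by
            push_cast; ring, Complex.im_ofReal_mul]
        simp [hall t])
    have h1 := hsum 0
    rw [e1 0, e2 0] at h1
    have h2 : (β 0 + β 1 * c₁ + β 2 * c₂ : ℂ) = 0 := by
      apply mul_right_cancel₀ (h0 0 0)
      linear_combination h1
    have h3 : β 0 + β 1 * c₁ + β 2 * c₂ = 0 := by exact_mod_cast h2
    rcases eq_or_eq_neg_of_sq_eq_sq c₁ 1 (by rw [hc₁, one_pow]) with rfl | rfl <;>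
    rcases eq_or_eq_neg_of_sq_eq_sq c₂ 1 (by rw [hc₂, one_pow]) with rfl | rfl <;>
    linarith [hβ 0, hβ 1, hβ 2]
  obtain ⟨t₀, ht₀⟩ := hne
  -- The modulus of g and that of β 0 + β 1 g determine Re g, and then (Im g)².
  have him2 : ∀ t, (g t).im ≠ 0 → (g t).re = (g t₀).re ∧ (g t).im ^ 2 = (g t₀).im ^ 2 := by
    have hr : ∀ t, (g t).im ≠ 0 → (g t).re ^ 2 + (g t).im ^ 2 = 1 ∧
        β 0 ^ 2 + 2 * β 0 * β 1 * (g t).re + β 1 ^ 2 = β 2 ^ 2 := by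
      intro t ht
      obtain ⟨n1, n2⟩ := hpt t ht
      have m1 := Complex.normSq_eq_norm_sq (g t)
      have m2 := Complex.normSq_eq_norm_sq (β 0 + β 1 * g t)
      rw [n1, Complex.normSq_apply] at m1
      rw [n2, Complex.normSq_apply] at m2
      simp at m2
      refine ⟨by linarith, ?_⟩
      linear_combination m2 - β 1 ^ 2 * m1
    intro t ht
    obtain ⟨a1, a2⟩ := hr t ht
    obtain ⟨b1, b2⟩ := hr t₀ ht₀
    have hββ : 2 * β 0 * β 1 ≠ 0 := by
      have := hβ 0
      have := hβ 1
      positivity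
    have hre : (g t).re = (g t₀).re := by
      apply mul_left_cancel₀ hββ
      linarith
    rw [hre] at a1
    exact ⟨hre, by linarith⟩
  have hic : Continuous fun t => (g t).im := Complex.continuous_im.comp hgc
  -- The continuous function (Im g)² takes at most the value 0 and one positive value, so by the
  -- intermediate value theorem it never reaches 0.
  have hnever : ∀ t, (g t).im ≠ 0 := by
    intro t ht
    have hpos : 0 < (g t₀).im ^ 2 := by positivity
    have hiv := intermediate_value_uIcc (a := t) (b := t₀) (hic.pow 2).continuousOn
    obtain ⟨s, -, hs⟩ := @hiv ((g t₀).im ^ 2 / 2) (Set.mem_uIcc.2 (Or.inl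
      ⟨by simp only [Pi.pow_apply, ht]; norm_num; linarith,
        by simp only [Pi.pow_apply]; linarith⟩))
    simp only [Pi.pow_apply] at hs
    by_cases h : (g s).im = 0
    · rw [h, zero_pow two_ne_zero] at hs; linarith
    · rw [(him2 s h).2] at hs; linarith
  have hconst : ∀ t, g t = g t₀ := by
    have heq : Set.EqOn (fun t => (g t).im) (fun _ => (g t₀).im) Set.univ :=
      isPreconnected_univ.eq_of_sq_eq hic.continuousOn continuousOn_const
        (fun t _ => (him2 t (hnever t)).2) (fun _ => ht₀) (Set.mem_univ t₀) rfl
    exact fun t => Complex.ext (him2 t (hnever t)).1 (heq (Set.mem_univ t))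
  exact ⟨g t₀, ht₀, (hpt t₀ ht₀).1, (hpt t₀ ht₀).2, fun t => by rw [← hconst t]; exact hgy t⟩

end Homothety

end ChargedThreeBody
end

noncomputable section
namespace ChargedThreeBody

/-! ### From equality in the three bounds to the homographic form. -/

section Minimizer

variable {m e : Fin 3 → ℝ} {τ : ℝ} {k : Fin 3 → ℤ} {q : Fin 3 → ℝ → ℂ}

/-- If the action of a loop of class `C²` is minimal, its relative positions are elliptic Kepler
orbits. -/
theorem kepler_of_action_le (hm : ∀ i, 0 < m i) (hτ : 0 < τ)
    (hk : ∀ i, k i = 1 ∨ k i = -1) (hδ : ∀ i j, i ≠ j → 0 < delta m e i j)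
    (hq : q ∈ loopSpace m τ k) (hC : ∀ i, ContDiff ℝ 2 (q i))
    (hle : action m e τ q ≤ ENNReal.ofReal (minimalAction m e τ)) (i : Fin 3) :
    (∀ t, q i t - q (i + 1) t ≠ 0) ∧ ∃ x' : ℝ → ℂ, ∀ t,
      HasDerivAt (fun t => q i t - q (i + 1) t) (x' t) t ∧
      HasDerivAt x' ((-((∑ j, m j) * delta m e i (i + 1)) / ‖q i t - q (i + 1) t‖ ^ 3 : ℝ) •
        (q i t - q (i + 1) t)) t ∧
      ‖x' t‖ ^ 2 / 2 - (∑ j, m j) * delta m e i (i + 1) / ‖q i t - q (i + 1) t‖ < 0 := by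
  have hμ : 0 < (∑ j, m j) * delta m e i (i + 1) :=
    mul_pos (Finset.sum_pos (fun i _ => hm i) Finset.univ_nonempty)
      (hδ i _ (by fin_cases i <;> decide))
  have hp := pairAction_eq_of_action_eq hm hτ hk hδ hq hle i
  set μ := (∑ j, m j) * delta m e i (i + 1)
  set x : ℝ → ℂ := fun t => q i t - q (i + 1) t with hx
  have hxC : ContDiff ℝ 2 x := (hC i).sub (hC (i + 1))
  have hper : Function.Periodic x τ := (hq.1 i).1.sub (hq.1 (i + 1)).1
  have h0 : ∀ t, x t ≠ 0 := by
    intro t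
    obtain ⟨s, hs, hst⟩ := hper.exists_mem_Ico₀ hτ t
    rw [hst]
    exact ne_zero_of_pairAction_ne_top hμ hτ (hxC.of_le one_le_two)
      (by rw [hp]; exact ENNReal.ofReal_ne_top) (Set.Ico_subset_Icc_self hs)
  have hd : ∀ t, HasDerivAt x (deriv x t) t := fun t =>
    (hxC.differentiable two_ne_zero t).hasDerivAt
  have hdc : Continuous (deriv x) := hxC.continuous_deriv one_le_two
  have hi : HasIndex τ x (k i) :=
    hasIndex_of_mem_loopSpace hτ hq i fun t => sub_ne_zero.1 (h0 t)
  have heq : ∫ t in (0 : ℝ)..τ, (1 / 2 * ‖deriv x t‖ ^ 2 + μ / ‖x t‖) = gordonBound μ τ := by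
    rw [pairAction_eq_ofReal hμ hτ hd hdc h0] at hp
    have hg := gordonBound_pos hμ hτ
    have hge := gordonBound_le_integral hμ hτ (hk i) hd hdc hper hi
    exact (ENNReal.ofReal_eq_ofReal_iff (hg.le.trans hge) hg.le).1 hp
  refine ⟨h0, deriv x, fun t => ⟨hd t, ?_⟩⟩
  exact kepler_of_integral_eq_gordonBound hμ hτ (hk i) hd hdc hper hi heq t

/-- A loop of class `C²` with minimal action is an elliptic triangle solution. -/
theorem isEllipticTriangleSolution_of_action_le (hm : ∀ i, 0 < m i) (hτ : 0 < τ)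
    (hk : ∀ i, k i = 1 ∨ k i = -1) (hδ : ∀ i j, i ≠ j → 0 < delta m e i j)
    (htri : ∀ i : Fin 3,
      delta m e (i + 2) i ^ (1 / 3 : ℝ) <
        delta m e i (i + 1) ^ (1 / 3 : ℝ) + delta m e (i + 1) (i + 2) ^ (1 / 3 : ℝ))
    (hq : q ∈ loopSpace m τ k) (hC : ∀ i, ContDiff ℝ 2 (q i))
    (hle : action m e τ q ≤ ENNReal.ofReal (minimalAction m e τ)) :
    IsEllipticTriangleSolution m e q := by
  have hM : 0 < ∑ i, m i := Finset.sum_pos (fun i _ => hm i) Finset.univ_nonempty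
  have hδi : ∀ i : Fin 3, 0 < delta m e i (i + 1) := fun i => hδ i _ (by fin_cases i <;> decide)
  choose h0 x' hK using kepler_of_action_le hm hτ hk hδ hq hC hle
  have hcm := sum_smul_eq_zero_of_mem_loopSpace hτ hm hq
  set M := ∑ i, m i
  set β : Fin 3 → ℝ := fun i => delta m e i (i + 1) ^ (1 / 3 : ℝ) with hβdef
  have hβ : ∀ i, 0 < β i := fun i => Real.rpow_pos_of_pos (hδi i) _
  have hβC : ∀ i, (β i : ℂ) ≠ 0 := fun i => Complex.ofReal_ne_zero.2 (hβ i).ne'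
  have hcube : ∀ i, β i ^ 3 = delta m e i (i + 1) := fun i => by
    simp only [hβdef]
    rw [← Real.rpow_natCast, ← Real.rpow_mul (hδi i).le]; norm_num
  -- The constant of x_i is M δ = M (β i)³, so dividing lengths by β i gives all three orbits the
  -- common constant M.
  set y : Fin 3 → ℝ → ℂ := fun i t => (q i t - q (i + 1) t) / β i with hydef
  set v : Fin 3 → ℝ → ℂ := fun i t => x' i t / β i with hvdef
  have hxy : ∀ i t, q i t - q (i + 1) t = β i * y i t := fun i t =>
    (mul_div_cancel₀ _ (hβC i)).symm
  have hyn : ∀ i t, ‖q i t - q (i + 1) t‖ = β i * ‖y i t‖ := fun i t => by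
    rw [hxy, norm_mul, Complex.norm_real, Real.norm_of_nonneg (hβ i).le]
  have hy0 : ∀ i t, y i t ≠ 0 := fun i t => div_ne_zero (h0 i t) (hβC i)
  have hy : ∀ i t, HasDerivAt (y i) (v i t) t := fun i t => (hK i t).1.div_const _
  have hv : ∀ i t, HasDerivAt (v i) ((-M / ‖y i t‖ ^ 3 : ℝ) • y i t) t := by
    intro i t
    refine ((hK i t).2.1.div_const (β i : ℂ)).congr_deriv ?_
    have h1 := (norm_pos_iff.2 (hy0 i t)).ne'
    have h2 := (hβ i).ne'
    rw [hyn, hxy, ← hcube, Complex.real_smul, Complex.real_smul,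
      show -(M * β i ^ 3) / (β i * ‖y i t‖) ^ 3 = -M / ‖y i t‖ ^ 3 by field_simp]
    have := hβC i
    field_simp
  have hsum : ∀ t, (β 0 : ℂ) * y 0 t + β 1 * y 1 t + β 2 * y 2 t = 0 := by
    intro t
    rw [← hxy, ← hxy, ← hxy]
    change q 0 t - q 1 t + (q 1 t - q 2 t) + (q 2 t - q 0 t) = 0
    ring
  have hper : Function.Periodic (y 0) τ := fun t => by
    simp only [hydef, (hq.1 _).1 t]
  obtain ⟨c, hc, hc1, hc2, hy1⟩ := exists_rotation_of_kepler hM hβ (htri 1) (htri 2) (htri 0)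
    hy hv hy0 hsum (angularMomentum_ne_zero hM hτ (hy 0) (hv 0) (hy0 0) hper)
  -- At each time the sides are y_0(t) times this fixed triangle. Normalizing the triangle moves the
  -- factor N into z = N y_0.
  obtain ⟨a, N, hN, hax, hcen, hcol, hnorm, hsuma, hU, hbal⟩ :=
    exists_central_of_triangle (x := ![β 0, β 1 * c, -(β 0 + β 1 * c)]) hm hδ
      (by simp)
      (fun i => by
        rw [← hcube i]
        congr 1
        fin_cases i
        · simp [abs_of_pos (hβ 0)]
        · simp [hc1, abs_of_pos (hβ 1)]
        · change ‖-(β 0 + β 1 * c)‖ = β 2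
          rw [norm_neg, hc2])
      (by
        have : (starRingEnd ℂ (β 0 : ℂ) * (β 1 * c)).im = β 0 * β 1 * c.im := by
          simp; ring
        change (starRingEnd ℂ (β 0 : ℂ) * (β 1 * c)).im ≠ 0
        rw [this]
        exact mul_ne_zero (mul_ne_zero (hβ 0).ne' (hβ 1).ne') hc)
  have hNC : (N : ℂ) ≠ 0 := Complex.ofReal_ne_zero.2 hN.ne'
  set z : ℝ → ℂ := fun t => N * y 0 t with hzdef
  set w : ℝ → ℂ := fun t => N * v 0 t with hwdef
  have hz0 : ∀ t, z t ≠ 0 := fun t => mul_ne_zero hNC (hy0 0 t)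
  have hzn : ∀ t, ‖z t‖ = N * ‖y 0 t‖ := fun t => by
    simp only [hzdef]
    rw [norm_mul, Complex.norm_real, Real.norm_of_nonneg hN.le]
  have hz : ∀ t, HasDerivAt z (w t) t := fun t => (hy 0 t).const_mul _
  have hw : ∀ t, HasDerivAt w ((-forceFunction m e a / ‖z t‖ ^ 3 : ℝ) • z t) t := by
    intro t
    refine ((hv 0 t).const_mul (N : ℂ)).congr_deriv ?_
    have h1 := (norm_pos_iff.2 (hy0 0 t)).ne'
    have h2 := hN.ne'
    rw [hU, hzn, show -(M * N ^ 3) / (N * ‖y 0 t‖) ^ 3 = -M / ‖y 0 t‖ ^ 3 by field_simp,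
      Complex.real_smul, Complex.real_smul]
    simp only [hzdef]
    ring
  have hdiff : ∀ i t, q i t - q (i + 1) t = z t * (a i - a (i + 1)) := by
    intro i t
    have e0 : q 0 t - q 1 t = z t * (a 0 - a 1) := by
      have h1 : (N : ℂ) * (a 0 - a 1) = β 0 := hax 0
      rw [show q 0 t - q 1 t = β 0 * y 0 t from hxy 0 t, ← h1]
      simp only [hzdef]; ring
    have e1 : q 1 t - q 2 t = z t * (a 1 - a 2) := by
      have h1 : (N : ℂ) * (a 1 - a 2) = β 1 * c := hax 1
      rw [show q 1 t - q 2 t = β 1 * y 1 t from hxy 1 t, hy1 t]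
      simp only [hzdef]; linear_combination -y 0 t * h1
    fin_cases i
    · exact e0
    · exact e1
    · change q 2 t - q 0 t = z t * (a 2 - a 0)
      linear_combination -e0 - e1
  have hqz : ∀ i t, q i t = z t * a i := by
    have h1 : ∀ t, q 0 t = z t * a 0 ∧ q 1 t = z t * a 1 ∧ q 2 t = z t * a 2 := by
      intro t
      have d0 : q 0 t - q 1 t = z t * (a 0 - a 1) := hdiff 0 t
      have d1 : q 1 t - q 2 t = z t * (a 1 - a 2) := hdiff 1 t
      have s1 := hcm t
      have s2 := hsuma
      simp only [Fin.sum_univ_three, Complex.real_smul] at s1 s2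
      have hMC : (m 0 + m 1 + m 2 : ℂ) ≠ 0 := by
        have := hm 0
        have := hm 1
        have := hm 2
        exact_mod_cast (by positivity : m 0 + m 1 + m 2 ≠ 0)
      have h0 : q 0 t = z t * a 0 := by
        apply mul_left_cancel₀ hMC
        linear_combination s1 - z t * s2 + (m 1 + m 2) * d0 + m 2 * d1
      exact ⟨h0, by linear_combination h0 - d0, by linear_combination h0 - d0 - d1⟩
    intro i t
    fin_cases i
    · exact (h1 t).1
    · exact (h1 t).2.1
    · exact (h1 t).2.2
  have hpolar : ∀ t, (‖z t‖ : ℂ) * Complex.exp (Complex.arg (z t) * Complex.I) = z t := fun t =>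
    Complex.norm_mul_exp_arg_mul_I (z t)
  have hqfun : q = fun i t => z t * a i := funext fun i => funext fun t => hqz i t
  refine ⟨hqfun ▸ isSolution_of_central hcen.1 hbal hz0 hz hw, a, fun t => ‖z t‖,
    fun t => Complex.arg (z t), hcen, hcol, hnorm, fun t => norm_pos_iff.2 (hz0 t), ?_,
    fun i t => by rw [hpolar]; exact hqz i t⟩
  simp only [hpolar]
  refine ⟨hz0, w, fun t => ⟨hz t, hw t, ?_, ?_⟩⟩
  · have h1 := (hK 0 t).2.2
    have h2 : x' 0 t = β 0 * v 0 t := (mul_div_cancel₀ _ (hβC 0)).symm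
    have hn := (norm_pos_iff.2 (hy0 0 t)).ne'
    have hb := hβ 0
    rw [hyn, ← hcube, h2, norm_mul, Complex.norm_real, Real.norm_of_nonneg hb.le,
      show (β 0 * ‖v 0 t‖) ^ 2 / 2 - M * β 0 ^ 3 / (β 0 * ‖y 0 t‖) =
        β 0 ^ 2 * (‖v 0 t‖ ^ 2 / 2 - M / ‖y 0 t‖) by field_simp] at h1
    have h3 : ‖v 0 t‖ ^ 2 / 2 - M / ‖y 0 t‖ < 0 := by
      by_contra! hcon
      exact absurd h1 (not_lt.2 (by positivity))
    have hwn : ‖w t‖ = N * ‖v 0 t‖ := by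
      simp only [hwdef]
      rw [norm_mul, Complex.norm_real, Real.norm_of_nonneg hN.le]
    rw [hwn, hzn, hU, show (N * ‖v 0 t‖) ^ 2 / 2 - M * N ^ 3 / (N * ‖y 0 t‖) =
      N ^ 2 * (‖v 0 t‖ ^ 2 / 2 - M / ‖y 0 t‖) by field_simp]
    exact mul_neg_of_pos_of_neg (by positivity) h3
  · have h1 := angularMomentum_ne_zero hM hτ (hy 0) (hv 0) (hy0 0) hper t
    have h2 : (z t).re * (w t).im - (z t).im * (w t).re =
        N ^ 2 * (starRingEnd ℂ (y 0 t) * v 0 t).im := by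
      simp [hzdef, hwdef]
      ring
    rw [h2]
    exact mul_ne_zero (by positivity) h1

end Minimizer

end ChargedThreeBody
end

/-! ### The main theorem. -/

theorem theorem2p3 (m e : Fin 3 → ℝ) (hm : ∀ i, 0 < m i) (τ : ℝ) (hτ : 0 < τ)
    (k : Fin 3 → ℤ) (hk : k = ![1, 1, 1] ∨ k = ![-1, -1, -1])
    (hδ : ∀ i j, i ≠ j → 0 < ChargedThreeBody.delta m e i j)
    (htri : ∀ i : Fin 3,
      ChargedThreeBody.delta m e (i + 2) i ^ (1 / 3 : ℝ) <
        ChargedThreeBody.delta m e i (i + 1) ^ (1 / 3 : ℝ) +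
          ChargedThreeBody.delta m e (i + 1) (i + 2) ^ (1 / 3 : ℝ)) :
    -- the value of the infimum; the first factor is `1` for masses normalized to total mass `1`
    (⨅ q ∈ ChargedThreeBody.loopSpace m τ k, ChargedThreeBody.action m e τ q) =
      ENNReal.ofReal ((∑ i, m i) ^ (-(1 / 3) : ℝ) *
        ((∑ i : Fin 3, m i * m (i + 1) * ChargedThreeBody.delta m e i (i + 1) ^ (2 / 3 : ℝ)) *
          (3 * (2 : ℝ) ^ (-(1 / 3) : ℝ) * Real.pi ^ (2 / 3 : ℝ) * τ ^ (1 / 3 : ℝ)))) ∧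
    -- elliptic triangle solutions exist in the loop space, and all of them are minimizers
    (∃ q ∈ ChargedThreeBody.loopSpace m τ k, ChargedThreeBody.IsEllipticTriangleSolution m e q) ∧
    (∀ q : Fin 3 → ℝ → ℂ, ChargedThreeBody.IsEllipticTriangleSolution m e q →
      (∀ i, Function.Periodic (q i) τ) →
      (∀ i, ChargedThreeBody.HasIndex τ (fun t => q i t - q (i + 1) t) (k i)) →
      q ∈ ChargedThreeBody.loopSpace m τ k ∧
        IsMinOn (ChargedThreeBody.action m e τ) (ChargedThreeBody.loopSpace m τ k) q) ∧
    -- every minimizer of class `C²` is an elliptic triangle solution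
    (∀ q ∈ ChargedThreeBody.loopSpace m τ k, (∀ i, ContDiff ℝ 2 (q i)) →
      IsMinOn (ChargedThreeBody.action m e τ) (ChargedThreeBody.loopSpace m τ k) q →
      ChargedThreeBody.IsEllipticTriangleSolution m e q) := by
  have hk' : ∀ i, k i = 1 ∨ k i = -1 := by
    intro i
    rcases hk with rfl | rfl <;> fin_cases i <;> simp
  have hmin : ∀ q : Fin 3 → ℝ → ℂ, ChargedThreeBody.IsEllipticTriangleSolution m e q →
      (∀ i, Function.Periodic (q i) τ) →
      (∀ i, ChargedThreeBody.HasIndex τ (fun t => q i t - q (i + 1) t) (k i)) →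
      q ∈ ChargedThreeBody.loopSpace m τ k ∧ ChargedThreeBody.action m e τ q =
        ENNReal.ofReal (ChargedThreeBody.minimalAction m e τ) := fun q h hper hi =>
    ⟨ChargedThreeBody.smoothLoops_subset_loopSpace (h.mem_smoothLoops hm hδ hper hi),
      h.action_eq hm hτ hk' hδ hper hi⟩
  have hle : ∀ q ∈ ChargedThreeBody.loopSpace m τ k,
      ENNReal.ofReal (ChargedThreeBody.minimalAction m e τ) ≤ ChargedThreeBody.action m e τ q :=
    fun q hq => ChargedThreeBody.minimalAction_le_action hm hτ hk' hδ hq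
  obtain ⟨p, hp, hper, hi⟩ :=
    ChargedThreeBody.exists_isEllipticTriangleSolution hm hτ hk hδ htri
  obtain ⟨hpX, hpa⟩ := hmin p hp hper hi
  refine ⟨?_, ⟨p, hpX, hp⟩, fun q h hq hqi => ?_, fun q hq hC hqmin => ?_⟩
  · rw [← ChargedThreeBody.minimalAction_eq hm hτ hδ]
    exact le_antisymm ((iInf₂_le p hpX).trans hpa.le) (le_iInf₂ hle)
  · obtain ⟨hqX, hqa⟩ := hmin q h hq hqi
    exact ⟨hqX, fun y hy => hqa.le.trans (hle y hy)⟩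
  -- The elliptic solution p found above shows that the action of a minimizer is at most the lower
  -- bound.
  · exact ChargedThreeBody.isEllipticTriangleSolution_of_action_le hm hτ hk' hδ htri hq hC
      ((hqmin hpX).trans hpa.le)
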